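/- Let $d\ge 1$. Write $\mathcal P_2(\mathbb R^d)$ for the Borel probability measures with finite second moment $M_2(\rho)=\int|x|^2d\rho$, $W_2$ for the $2$-Wasserstein distance, $s_+=\max(s,0)$, and $\mathcal S(\rho)=\int\rho\log\rho\,dx$ ($=+\infty$ if $\rho\not\ll dx$). **Energy density.** Let $f:\mathbb R\to\mathbb R\cup\{+\infty\}$ be convex and lower semicontinuous with $f(0)=0$, $f=+\infty$ on $(-\infty,0)$ and $\operatorname{int}(\operatorname{dom} f)\neq\emptyset$. Assume there is a nondecreasing concave $H:[0,\infty)\to[0,\infty)$ with $H(0)=0$ and $-H\big(\int(1+|x|^2)\,d\rho\big)\le \mathcal F(\rho):=\int f(\rho(x))\,dx$ for all finite Borel measures $\rho\ll dx$ with finite second moment. **Mollifier.** Let $\varphi\in C^2(\mathbb R^d)$, $\varphi\ge0$, $\int\varphi=1$, $\varphi(-x)=\varphi(x)$, $\varphi(x)\le C_\varphi|x|^{-r}$ for $x\ne 0$ with some $C_\varphi>0$ and $r>\max\{d,2\}$, $\varphi,\nabla\varphi,D^2\varphi\in L^1\cap L^\infty$, and $\int|x|^2\varphi(x)\,dx<\infty$.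 Put $\varphi_\varepsilon(x)=\varepsilon^{-d}\varphi(x/\varepsilon)$. **Regularization.** Let $\delta:(0,1)\to(0,\infty)$ be nondecreasing with $\delta(\varepsilon)\to0$ as $\varepsilon\to0$. With ${}^{\gamma}f(a)=\inf_{b\ge0}\{f(b)+\frac1{2\gamma}|a-b|^2\}$ set $f_\varepsilon(a)=\frac{\delta(\varepsilon)}2a^2+{}^{\delta(\varepsilon)}f(a)-{}^{\delta(\varepsilon)}f(0)$ for $a\ge0$, and let $f_\varepsilon'$ be its derivative on $[0,\infty)$ (from the right at $0$). Set $\mathcal F_\varepsilon(\rho)=\int f_\varepsilon(\varphi_\varepsilon*\rho)\,dx$. **Limit data.** Let $v\in L^1_{\rm loc}([0,\infty);W^{1,1}_{\rm loc}(\mathbb R^d;\mathbb R^d))$ with $\frac{|v|^2+(\nabla\cdot v)_+}{1+|x|^2}\in L^1_{\rm loc}([0,\infty);L^\infty(\mathbb R^d))$, and let $\rho^0\in\mathcal P_2(\mathbb R^d)$ with $\mathcal F(\rho^0)+\mathcal S(\rho^0)<\infty$. **Well-prepared data.** For $\varepsilon\in(0,1)$ let $\rho^0_\varepsilon\in C_c^\infty(\mathbb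 R^d)$ be probability densities and $v_\varepsilon\in C_c^\infty([0,\infty)\times\mathbb R^d;\mathbb R^d)$ be such that for every $T>0$ $$\sup_{\varepsilon\in(0,1)}\Big\{\mathcal F_\varepsilon(\rho_\varepsilon^0)+\mathcal S(\rho_\varepsilon^0)+M_2(\rho_\varepsilon^0)+\int_0^T\Big\|\frac{|v_\varepsilon(t,\cdot)|^2+(\nabla\cdot v_\varepsilon(t,\cdot))_+}{1+|\cdot|^2}\Big\|_{L^\infty}dt\Big\}<\infty,$$ and, as $\varepsilon\to0$, $v_\varepsilon\to v$ in $L^1_{\rm loc}([0,\infty)\times\mathbb R^d)$ and $W_2(\rho_\varepsilon^0,\rho^0)\to0$. **Solutions.** For $\varepsilon\in(0,1)$ let $\rho_\varepsilon\in AC^2_{\rm loc}([0,\infty);\mathcal P_2(\mathbb R^d))$ solve $\partial_t\rho_\varepsilon-\nabla\cdot(\rho_\varepsilon(\nabla p_\varepsilon+v_\varepsilon))=0$ in duality with $C_c^\infty((0,\infty)\times\mathbb R^d)$, with $\rho_\varepsilon(0)=\rho^0_\varepsilon$, where $\mu_\varepsilon=\varphi_\varepsilon*\rho_\varepsilon$,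 $q_\varepsilon=f_\varepsilon'(\mu_\varepsilon)$, $p_\varepsilon=\varphi_\varepsilon*q_\varepsilon$. **Proposition (mollifier exchange).** For every $T>0$ there are $C>0$ and $\varepsilon_0\in(0,1)$ (depending on the objects fixed above and on $T$, but not on $\varepsilon,\theta,g$) such that for all $\varepsilon\in(0,\varepsilon_0)$: (a) for every $t\in[0,T]$, $\rho_\varepsilon(t)$ is absolutely continuous, $p_\varepsilon(t,\cdot)$ is differentiable, and $q_\varepsilon(t,\cdot)$ is Lipschitz; (b) for all $\theta\in(0,1)$ and all real-valued $g\in L^2([0,T];\dot C^\theta(\mathbb R^d))$, where $\|h\|_{\dot C^\theta}=\sup_{x\ne y}\frac{|h(x)-h(y)|}{|x-y|^\theta}$, the function $x\mapsto g[\rho_\varepsilon\nabla p_\varepsilon-\mu_\varepsilon\nabla q_\varepsilon](t,x)$ is integrable for a.e. $t\in[0,T]$, its integral is integrable in $t$ on $[0,T]$, and $$\left|\int_0^T\!\!\int_{\mathbb R^d} g\,[\rho_\varepsilon\nabla p_\varepsilon-\mu_\varepsilon\nabla q_\varepsilon]\,dx\,dt\right|\le C\,\varepsilon^{\frac{\theta(r-d)}{r}}\,\delta(\varepsilon)^{-\frac{r-\theta}{r}}\,\|g\|_{L^2([0,T];\dot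 C^\theta(\mathbb R^d))}.$$ -/

import Mathlib

open MeasureTheory Set Filter Topology
open scoped ENNReal NNReal ContDiff InnerProductSpace

noncomputable section

namespace NonlocalDiffusion

/-- The space `ℝ^d` with its Euclidean norm. -/
abbrev Space (d : ℕ) : Type := EuclideanSpace ℝ (Fin d)

variable {d : ℕ}

/-! ### Measures, Wasserstein distance, energies -/

/-- The second moment `∫ |x|² dρ`. -/
def secondMoment (ρ : Measure (Space d)) : ℝ≥0∞ := ∫⁻ x, ‖x‖ₑ ^ 2 ∂ρ

/-- Membership in `P₂(ℝ^d)`. -/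
def IsP2 (ρ : Measure (Space d)) : Prop :=
  IsProbabilityMeasure ρ ∧ secondMoment ρ < ⊤

/-- The Lebesgue density of (the absolutely continuous part of) `ρ`. -/
def density (ρ : Measure (Space d)) (x : Space d) : ℝ := (ρ.rnDeriv volume x).toReal

/-- The measure `u dx` for a nonnegative function `u`. -/
def toMeasure (u : Space d → ℝ) : Measure (Space d) :=
  volume.withDensity fun x => ENNReal.ofReal (u x)

/-- The `2`-Wasserstein distance: infimum over transport plans. -/
def W2 (ρ ν : Measure (Space d)) : ℝ≥0∞ :=
  (⨅ γ : {γ : Measure (Space d × Space d) // γ.map Prod.fst = ρ ∧ γ.map Prod.snd = ν},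
    ∫⁻ z, ‖z.1 - z.2‖ₑ ^ 2 ∂γ.1) ^ (1 / 2 : ℝ)

/-- `ρ ∈ AC²_loc([0,∞); P₂(ℝ^d))`; only times `t ≥ 0` matter. -/
def IsAC2 (ρ : ℝ → Measure (Space d)) : Prop :=
  (∀ t, 0 ≤ t → IsP2 (ρ t)) ∧
  ∃ m : ℝ → ℝ, (∀ T, 0 < T → MemLp m 2 (volume.restrict (Icc 0 T))) ∧
    ∀ s t, 0 ≤ s → s ≤ t → W2 (ρ t) (ρ s) ≤ ENNReal.ofReal (∫ τ in s..t, m τ)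

/-- Integral with respect to Lebesgue measure of an extended-real-valued function:
integral of the positive part minus integral of the negative part. -/
def eIntegral (h : Space d → EReal) : EReal :=
  ((∫⁻ x, (h x).toENNReal : ℝ≥0∞) : EReal) - ((∫⁻ x, (-(h x)).toENNReal : ℝ≥0∞) : EReal)

/-- The internal energy `F(ρ) = ∫ f(ρ(x)) dx` of the absolutely continuous measure
with density `u`. -/
def internalEnergy (f : ℝ → EReal) (u : Space d → ℝ) : EReal :=
  eIntegral fun x => f (u x)

open Classical in
/-- The entropy `∫ ρ log ρ`, equal to `+∞` if `ρ` is not absolutely continuous. -/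
def entropy (ρ : Measure (Space d)) : EReal :=
  if ρ ≪ volume then
    eIntegral fun x => ((density ρ x * Real.log (density ρ x) : ℝ) : EReal)
  else ⊤

/-! ### Energy density, mollifier, velocity, initial datum -/

/-- Hypotheses on the internal energy density `f : ℝ → ℝ ∪ {+∞}`. The coercivity condition is
required only for absolutely continuous measures; the energy of a measure with singular part is
defined by `W₂`-lower semicontinuous extension, so that the inequality for all finite measures
with finite second moment is equivalent to this one. -/
structure IsEnergyDensity (d : ℕ) (f : ℝ → EReal) : Prop where
  ne_bot : ∀ a, f a ≠ ⊥
  convex : ∀ a b s t : ℝ, 0 ≤ s → 0 ≤ t → s + t = 1 →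
    f (s * a + t * b) ≤ (s : EReal) * f a + (t : EReal) * f b
  lsc : LowerSemicontinuous f
  map_zero : f 0 = 0
  map_neg : ∀ a, a < 0 → f a = ⊤
  interior_dom : (interior {a | f a < ⊤}).Nonempty
  coercive : ∃ H : ℝ → ℝ, ConcaveOn ℝ (Ici 0) H ∧ MonotoneOn H (Ici 0) ∧ H 0 = 0 ∧
    (∀ a, 0 ≤ a → 0 ≤ H a) ∧
    ∀ ρ : Measure (Space d), IsFiniteMeasure ρ → ρ ≪ volume → secondMoment ρ < ⊤ →
      ((-H (∫ x, (1 + ‖x‖ ^ 2) ∂ρ) : ℝ) : EReal) ≤ internalEnergy f (density ρ)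

/-- Hypotheses on the mollifier profile `φ` with decay exponent `r`. -/
structure IsMollifierProfile (φ : Space d → ℝ) (r : ℝ) : Prop where
  contDiff : ContDiff ℝ 2 φ
  nonneg : ∀ x, 0 ≤ φ x
  integral_eq_one : ∫ x, φ x = 1
  even : ∀ x, φ (-x) = φ x
  lt_exponent : max (d : ℝ) 2 < r
  decay : ∃ Cφ : ℝ, 0 < Cφ ∧ ∀ x, x ≠ 0 → φ x ≤ Cφ * ‖x‖ ^ (-r)
  memLp : MemLp φ 1 ∧ MemLp φ ⊤
  memLp_fderiv : MemLp (fderiv ℝ φ) 1 ∧ MemLp (fderiv ℝ φ) ⊤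
  memLp_fderiv2 : MemLp (fderiv ℝ (fderiv ℝ φ)) 1 ∧ MemLp (fderiv ℝ (fderiv ℝ φ)) ⊤

/-- Hypotheses on the regularization parameter `ε ↦ δ(ε)`. -/
structure IsRegularizationScale (δ : ℝ → ℝ) : Prop where
  pos : ∀ ε ∈ Ioo (0 : ℝ) 1, 0 < δ ε
  mono : MonotoneOn δ (Ioo 0 1)
  tendsto : Tendsto δ (𝓝[>] 0) (𝓝 0)

/-- The divergence read off from a derivative. -/
def divOf (A : Space d →L[ℝ] Space d) : ℝ := LinearMap.trace ℝ (Space d) A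

/-- `G` is the weak derivative of the vector field `b` on `ℝ^d`. -/
def IsWeakDeriv (b : Space d → Space d) (G : Space d → Space d →L[ℝ] Space d) : Prop :=
  ∀ ψ : Space d → ℝ, ContDiff ℝ ∞ ψ → HasCompactSupport ψ → ∀ e : Space d,
    ∫ x, ψ x • G x e = -∫ x, (fderiv ℝ ψ x e) • b x

/-- The weight `(|b|² + (div b)₊) / (1 + |x|²)` of a vector field `b` with derivative `G`. -/
def velocityWeight (b : Space d → Space d) (G : Space d → Space d →L[ℝ] Space d)
    (x : Space d) : ℝ :=
  (‖b x‖ ^ 2 + max (divOf (G x)) 0) / (1 + ‖x‖ ^ 2)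

/-- Hypotheses on the limiting velocity field: `v ∈ L¹_loc([0,∞); W^{1,1}_loc)`, and
`(|v|² + (div v)₊) / (1 + |x|²) ∈ L¹_loc([0,∞); L^∞)`. -/
def IsAdmissibleVelocity (v : ℝ → Space d → Space d) : Prop :=
  ∃ G : ℝ → Space d → Space d →L[ℝ] Space d,
    LocallyIntegrableOn (fun z : ℝ × Space d => v z.1 z.2) (Ici 0 ×ˢ univ) ∧
    LocallyIntegrableOn (fun z : ℝ × Space d => G z.1 z.2) (Ici 0 ×ˢ univ) ∧
    (∀ᵐ t ∂(volume.restrict (Ici (0 : ℝ))), IsWeakDeriv (v t) (G t)) ∧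
    ∀ T, 0 < T → ∫⁻ t in Icc 0 T, eLpNorm (velocityWeight (v t) (G t)) ⊤ volume < ⊤

/-- Hypotheses on the limiting initial datum: `ρ₀ ∈ P₂`, `F(ρ₀) + S(ρ₀) < ∞`. (Finiteness of
the entropy forces `ρ₀` to be absolutely continuous, so that `F(ρ₀) = ∫ f(ρ₀(x)) dx`.) -/
def IsAdmissibleDatum (f : ℝ → EReal) (ρ₀ : Measure (Space d)) : Prop :=
  IsP2 ρ₀ ∧ internalEnergy f (density ρ₀) + entropy ρ₀ < ⊤

/-! ### The regularized equation -/

/-- The rescaled mollifier `φ_ε(x) = ε^{-d} φ(x / ε)`. -/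
def rescale (φ : Space d → ℝ) (ε : ℝ) (x : Space d) : ℝ := (ε ^ d)⁻¹ * φ (ε⁻¹ • x)

/-- The Moreau–Yosida regularization `inf_{b ≥ 0} (f(b) + |a - b|² / (2γ))`; the infimum is finite
when `f` is an energy density and `γ > 0`. -/
def moreau (f : ℝ → EReal) (γ a : ℝ) : ℝ :=
  (⨅ b ∈ Ici (0 : ℝ), (f b + (((a - b) ^ 2 / (2 * γ) : ℝ) : EReal))).toReal

/-- The regularized energy density `f_ε` on its domain `[0,∞)`, with `γ = δ(ε)`. It is only ever
evaluated at arguments `a ≥ 0`. -/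
def regDensity (f : ℝ → EReal) (γ a : ℝ) : ℝ :=
  γ / 2 * a ^ 2 + moreau f γ a - moreau f γ 0

/-- The derivative `f_ε'` on `[0,∞)`, one-sided at `0`. -/
def regDensityDeriv (f : ℝ → EReal) (γ a : ℝ) : ℝ :=
  derivWithin (regDensity f γ) (Ici 0) a

/-- `μ_ε = φ_ε * ρ`. -/
def smoothed (φ : Space d → ℝ) (ε : ℝ) (ρ : Measure (Space d)) (x : Space d) : ℝ :=
  ∫ y, rescale φ ε (x - y) ∂ρ

/-- `q_ε = f_ε'(μ_ε)`. -/
def potential (f : ℝ → EReal) (φ : Space d → ℝ) (γ ε : ℝ) (ρ : Measure (Space d))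
    (x : Space d) : ℝ :=
  regDensityDeriv f γ (smoothed φ ε ρ x)

/-- `p_ε = φ_ε * q_ε`. -/
def pressure (f : ℝ → EReal) (φ : Space d → ℝ) (γ ε : ℝ) (ρ : Measure (Space d))
    (x : Space d) : ℝ :=
  ∫ y, rescale φ ε (x - y) * potential f φ γ ε ρ y

/-- The regularized energy `F_ε(ρ) = ∫ f_ε(φ_ε * ρ)`. -/
def regEnergy (f : ℝ → EReal) (φ : Space d → ℝ) (γ ε : ℝ) (ρ : Measure (Space d)) : ℝ :=
  ∫ x, regDensity f γ (smoothed φ ε ρ x)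

/-- `ρ ∈ AC²_loc([0,∞); P₂)` solves `∂ₜρ - ∇·(ρ(∇p_ε + v)) = 0`, `p_ε = φ_ε * f_ε'(φ_ε * ρ)`, in
duality with `C_c^∞((0,∞) × ℝ^d)`, with initial datum `ρ₀`. -/
structure IsSolution (f : ℝ → EReal) (φ : Space d → ℝ) (γ ε : ℝ) (v : ℝ → Space d → Space d)
    (ρ₀ : Measure (Space d)) (ρ : ℝ → Measure (Space d)) : Prop where
  ac : IsAC2 ρ
  initial : ρ 0 = ρ₀
  weak : ∀ ψ : ℝ × Space d → ℝ, ContDiff ℝ ∞ ψ → HasCompactSupport ψ →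
    tsupport ψ ⊆ Ioi 0 ×ˢ univ →
    ∫ t in Ioi (0 : ℝ), ∫ x, (deriv (fun s => ψ (s, x)) t
      - ⟪gradient (fun y => ψ (t, y)) x,
          gradient (pressure f φ γ ε (ρ t)) x + v t x⟫_ℝ) ∂(ρ t) = 0

/-- `v ∈ C_c^∞([0,∞) × ℝ^d)`: restriction to `t ≥ 0` of a smooth compactly supported field. -/
def IsSmoothVelocity (v : ℝ → Space d → Space d) : Prop :=
  ∃ w : ℝ × Space d → Space d, ContDiff ℝ ∞ w ∧ HasCompactSupport w ∧
    ∀ t, 0 ≤ t → ∀ x, v t x = w (t, x)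

/-- Well-prepared initial densities `u₀ ε` and velocities `vε ε`, `ε ∈ (0,1)`, for the limiting
velocity `v` and the limiting initial datum `ρ₀`. All terms in the uniform bound are finite for
smooth compactly supported data. -/
structure WellPrepared (f : ℝ → EReal) (φ : Space d → ℝ) (δ : ℝ → ℝ)
    (v : ℝ → Space d → Space d) (ρ₀ : Measure (Space d))
    (u₀ : ℝ → Space d → ℝ) (vε : ℝ → ℝ → Space d → Space d) : Prop where
  smooth : ∀ ε ∈ Ioo (0 : ℝ) 1, ContDiff ℝ ∞ (u₀ ε) ∧ HasCompactSupport (u₀ ε)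
  nonneg : ∀ ε ∈ Ioo (0 : ℝ) 1, ∀ x, 0 ≤ u₀ ε x
  integral_eq_one : ∀ ε ∈ Ioo (0 : ℝ) 1, ∫ x, u₀ ε x = 1
  velocity : ∀ ε ∈ Ioo (0 : ℝ) 1, IsSmoothVelocity (vε ε)
  bound : ∀ T, 0 < T → ∃ B : ℝ, ∀ ε ∈ Ioo (0 : ℝ) 1,
    regEnergy f φ (δ ε) ε (toMeasure (u₀ ε))
      + (∫ x, u₀ ε x * Real.log (u₀ ε x))
      + (∫ x, ‖x‖ ^ 2 * u₀ ε x)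
      + (∫ t in (0 : ℝ)..T,
          (eLpNorm (velocityWeight (vε ε t) (fderiv ℝ (vε ε t))) ⊤ volume).toReal) ≤ B
  tendsto_velocity : ∀ T R, 0 < T → 0 < R →
    Tendsto (fun ε => ∫⁻ z in Icc (0 : ℝ) T ×ˢ Metric.closedBall (0 : Space d) R,
      ‖vε ε z.1 z.2 - v z.1 z.2‖ₑ) (𝓝[>] 0) (𝓝 0)
  tendsto_datum : Tendsto (fun ε => W2 (toMeasure (u₀ ε)) ρ₀) (𝓝[>] 0) (𝓝 0)

/-! ### Test functions and the exchange error -/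

/-- The norm of `L²([0,T]; Ċ^θ(ℝ^d))`, where `Ċ^θ` carries the Hölder seminorm. -/
def holderL2Norm (T : ℝ) (θ : ℝ≥0) (g : ℝ → Space d → ℝ) : ℝ≥0∞ :=
  eLpNorm (fun t => eHolderNorm θ (g t)) 2 (volume.restrict (Icc 0 T))

/-- Membership in `L²([0,T]; Ċ^θ(ℝ^d))`. -/
structure MemHolderL2 (T : ℝ) (θ : ℝ≥0) (g : ℝ → Space d → ℝ) : Prop where
  aestronglyMeasurable : AEStronglyMeasurable (fun z : ℝ × Space d => g z.1 z.2)
    (volume.restrict (Icc 0 T ×ˢ univ))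
  memHolder : ∀ᵐ t ∂(volume.restrict (Icc 0 T)), MemHolder θ (g t)
  aemeasurable_norm : AEMeasurable (fun t => eHolderNorm θ (g t)) (volume.restrict (Icc 0 T))
  norm_lt_top : holderL2Norm T θ g < ⊤

/-- The vector field `ρ_ε ∇p_ε - μ_ε ∇q_ε` on `ℝ^d` at one time. -/
def exchangeError (f : ℝ → EReal) (φ : Space d → ℝ) (γ ε : ℝ) (ρ : Measure (Space d))
    (x : Space d) : Space d :=
  density ρ x • gradient (pressure f φ γ ε ρ) x
    - smoothed φ ε ρ x • gradient (potential f φ γ ε ρ) x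

end NonlocalDiffusion

end

open NonlocalDiffusion

noncomputable section

namespace NonlocalDiffusion

/-! ### The proximal map and the regularized energy density -/

variable {d : ℕ} {f : ℝ → EReal} {γ : ℝ}

/-! Write γ = δ(ε), σ = 1 − θ/r and D = ∫ ∇q·∇μ. Since φ_ε is even, ∇p = φ_ε * ∇q and μ = φ_ε * ρ,
so at a fixed time the error is a commutator: ∫ g (ρ∇p − μ∇q) dx = ∬ φ_ε(y − x) (g(x) − g(y)) ∇q(y)
dρ(x) dy. Hölder continuity bounds the difference of g by |x − y|^θ. The decay of φ, in the form
|z|^θ φ_ε ≤ K ε^{θ(r−d)/r} φ_ε^σ (`IsMollifierProfile.exists_rpow_mul_rescale_le`), converts this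
weight into a gain in ε at the price of a lower power of the kernel, and Jensen gives ∫ φ_ε(y − x)^σ
dρ(x) ≤ μ(y)^σ. What remains is ∫ |∇q| μ^σ, treated by Cauchy–Schwarz. As f_ε' is monotone with
Lipschitz constant γ + 1/γ, |∇q|² ≤ (γ + 1/γ) ∇q·∇μ; as 1 ≤ 2σ ≤ 2, the integral of μ^{2σ}
interpolates between ∫ μ = 1 and γ ∫ μ². The outcome is a multiple of γ^{−σ} √D
(`norm_integral_smul_exchangeError_le`), and Cauchy–Schwarz in time finishes, provided that sup_t γ
∫ μ² and ∫₀ᵀ D dt are bounded uniformly in ε.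

These two bounds are the a priori estimates (`IsRegularCurve.uniform_bounds`). For fixed ε the drift
u = −(∇p + v) is bounded with bounded Lipschitz derivative, so the solution is the push-forward of
the initial density under the flow of u (`IsWeakCurve.eq_map`); both are compared with the Euler
scheme. This gives absolute continuity and justifies unbounded test functions. The regularity
constants depend badly on ε, but they enter only qualitatively.

Convexity of f_ε yields an energy inequality, which is coupled with the second moment and closed by
Gronwall's lemma. Since f_ε contains γa²/2 and the rest of the energy is bounded below by the second
moment (`exists_regEnergy_lower_bound`), γ ∫ μ² is controlled.

For the dissipation, D = −∫ Δp dρ = ∫ (div u + div v) dρ. The time integral of div u along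
trajectories is the logarithm of the Jacobian of the flow. Gibbs' inequality, applied to the initial
density and a Gaussian transported by the flow, bounds its average by the initial entropy plus π
times the final second moment (`IsFlow.integral_divOf_le`). Neither the entropy nor the smoothness
of ρ at positive times is needed. -/

theorem IsEnergyDensity.coe_toReal (hf : IsEnergyDensity d f) {b : ℝ} (hb : f b ≠ ⊤) :
    ((f b).toReal : EReal) = f b := EReal.coe_toReal hb (hf.ne_bot b)

theorem IsEnergyDensity.nonneg_of_ne_top (hf : IsEnergyDensity d f) {b : ℝ} (hb : f b ≠ ⊤) :
    0 ≤ b := by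
  by_contra h
  exact hb (hf.map_neg b (not_le.1 h))

theorem IsEnergyDensity.toReal_convex (hf : IsEnergyDensity d f) {a b s t : ℝ}
    (ha : f a ≠ ⊤) (hb : f b ≠ ⊤) (hs : 0 ≤ s) (ht : 0 ≤ t) (hst : s + t = 1) :
    f (s * a + t * b) ≠ ⊤ ∧
      (f (s * a + t * b)).toReal ≤ s * (f a).toReal + t * (f b).toReal := by
  have h := hf.convex a b s t hs ht hst
  rw [← hf.coe_toReal ha, ← hf.coe_toReal hb, ← EReal.coe_mul, ← EReal.coe_mul,
    ← EReal.coe_add] at h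
  have h1 : f (s * a + t * b) ≠ ⊤ := ne_top_of_le_ne_top (EReal.coe_ne_top _) h
  refine ⟨h1, ?_⟩
  rw [← hf.coe_toReal h1] at h
  exact_mod_cast h

/-- Supporting-line argument at an interior point a₀ > 0 of the domain: convexity on the chord from
0, where `f` vanishes, to b ≥ a₀, and on the chord from b ≤ a₀ to a second point a₁ > a₀, bounds `f
b` from below. This is what lets the quadratic penalty of the proximal problem win at infinity. -/
theorem IsEnergyDensity.exists_linear_lower_bound (hf : IsEnergyDensity d f) :
    ∃ C : ℝ, 0 ≤ C ∧ ∀ b, f b ≠ ⊤ → -C * (1 + b) ≤ (f b).toReal := by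
  obtain ⟨x, hx⟩ := hf.interior_dom
  obtain ⟨η, hη, hball⟩ := Metric.isOpen_iff.1 isOpen_interior x hx
  have hdom : ∀ y, |y - x| < η → f y ≠ ⊤ := fun y hy =>
    have h : y ∈ {a | f a < ⊤} :=
      interior_subset (hball (by rwa [Metric.mem_ball, Real.dist_eq]))
    ne_of_lt h
  have h0 : 0 ≤ x - η / 2 := hf.nonneg_of_ne_top (hdom _ (by
    rw [show x - η / 2 - x = -(η / 2) by ring, abs_neg, abs_of_pos (by positivity)]; linarith))
  set a₀ := x with ha₀
  set a₁ := x + η / 2 with ha₁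
  have hpos : 0 < a₀ := by linarith
  have hlt : a₀ < a₁ := by simp only [ha₁]; linarith
  have hf₀ : f a₀ ≠ ⊤ := hdom _ (by simpa using hη)
  have hf₁ : f a₁ ≠ ⊤ := hdom _ (by
    rw [ha₁, add_sub_cancel_left, abs_of_pos (by positivity)]; linarith)
  set F₀ := (f a₀).toReal
  set F₁ := (f a₁).toReal
  have hz : f 0 ≠ ⊤ := by simp [hf.map_zero]
  refine ⟨|F₀| / a₀ + (|F₀| + |F₁|) * (a₁ / (a₁ - a₀)), ?_, fun b hb => ?_⟩
  · have : 0 < a₁ - a₀ := by linarith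
    positivity
  have hb0 := hf.nonneg_of_ne_top hb
  have hd : 0 < a₁ - a₀ := by linarith
  have hC1 : 0 ≤ |F₀| / a₀ := by positivity
  have hC2 : 0 ≤ (|F₀| + |F₁|) * (a₁ / (a₁ - a₀)) := by
    have : 0 < a₁ := by linarith
    positivity
  rcases le_total a₀ b with hab | hab
  · have hbpos : 0 < b := by linarith
    have hle : a₀ / b ≤ 1 := by rw [div_le_one hbpos]; exact hab
    have h := (hf.toReal_convex hz hb (s := 1 - a₀ / b) (t := a₀ / b)
      (by linarith) (by positivity) (by ring)).2
    have e : (1 - a₀ / b) * 0 + a₀ / b * b = a₀ := by field_simp; ring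
    rw [e, hf.map_zero] at h
    simp only [EReal.toReal_zero, mul_zero, zero_add] at h
    have h2 : F₀ * b / a₀ ≤ (f b).toReal := by
      rw [div_le_iff₀ hpos]
      have := mul_le_mul_of_nonneg_right h hb0
      calc F₀ * b ≤ a₀ / b * (f b).toReal * b := this
        _ = (f b).toReal * a₀ := by field_simp
    have h3 : -(|F₀| / a₀) * b ≤ F₀ * b / a₀ := by
      rw [show -(|F₀| / a₀) * b = (-|F₀|) * b / a₀ by ring]
      gcongr
      exact neg_abs_le _
    nlinarith
  · have hd' : 0 < a₁ - b := by linarith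
    have hs1 : (a₁ - a₀) / (a₁ - b) ≤ 1 := by rw [div_le_one hd']; linarith
    have hs0 : 0 < (a₁ - a₀) / (a₁ - b) := by positivity
    have h := (hf.toReal_convex hb hf₁ (s := (a₁ - a₀) / (a₁ - b))
      (t := 1 - (a₁ - a₀) / (a₁ - b)) hs0.le (by linarith) (by ring)).2
    have e : (a₁ - a₀) / (a₁ - b) * b + (1 - (a₁ - a₀) / (a₁ - b)) * a₁ = a₀ := by
      field_simp; ring
    rw [e] at h
    set s := (a₁ - a₀) / (a₁ - b)
    have h1 : -(|F₀| + |F₁|) ≤ s * (f b).toReal := by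
      have h5 : (1 - s) * F₁ ≤ |F₁| := by
        calc (1 - s) * F₁ ≤ (1 - s) * |F₁| :=
              mul_le_mul_of_nonneg_left (le_abs_self _) (by linarith)
          _ ≤ 1 * |F₁| := by gcongr; linarith
          _ = _ := one_mul _
      have h6 : -|F₀| ≤ F₀ := neg_abs_le _
      change F₀ ≤ _ at h
      linarith
    have h2 : -(|F₀| + |F₁|) * (1 / s) ≤ (f b).toReal := by
      rw [mul_one_div, div_le_iff₀ hs0]; linarith
    have h3 : 1 / s ≤ a₁ / (a₁ - a₀) := by
      simp only [s, one_div_div]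
      gcongr; linarith
    have h4 : (|F₀| + |F₁|) * (1 / s) ≤ (|F₀| + |F₁|) * (a₁ / (a₁ - a₀)) := by gcongr
    nlinarith

/-- Direct method: lower semicontinuity gives a minimizer on a compact interval, and by the linear
lower bound every point beyond it loses against 0. -/
theorem IsEnergyDensity.exists_prox (hf : IsEnergyDensity d f) (hγ : 0 < γ) (a : ℝ) :
    ∃ p, f p ≠ ⊤ ∧ ∀ b, f b ≠ ⊤ →
      (f p).toReal + (a - p) ^ 2 / (2 * γ) ≤ (f b).toReal + (a - b) ^ 2 / (2 * γ) := by
  obtain ⟨C, hC, hlow⟩ := hf.exists_linear_lower_bound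
  -- For b ≥ B one has b² − 2ab ≥ 2γC(1 + b): the summand 2|a| absorbs 2ab, and 4γC absorbs the
  -- linear lower bound because b ≥ 1.
  set B := 1 + 2 * |a| + 4 * γ * C with hB
  have hB0 : 0 ≤ B := by positivity
  set g : ℝ → EReal := fun b => f b + (((a - b) ^ 2 / (2 * γ) : ℝ) : EReal) with hg
  have hcont : Continuous fun b : ℝ => (((a - b) ^ 2 / (2 * γ) : ℝ) : EReal) :=
    continuous_coe_real_ereal.comp (by fun_prop)
  have hlsc : LowerSemicontinuous g := by
    refine hf.lsc.add' hcont.lowerSemicontinuous fun b => ?_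
    exact EReal.continuousAt_add (Or.inr (EReal.coe_ne_bot _)) (Or.inr (EReal.coe_ne_top _))
  obtain ⟨p, hp, hmin⟩ := LowerSemicontinuousOn.exists_isMinOn (s := Icc 0 B)
    ⟨0, le_rfl, hB0⟩ isCompact_Icc (hlsc.lowerSemicontinuousOn _)
  have hz : f 0 ≠ ⊤ := by simp [hf.map_zero]
  have hgv : ∀ b, f b ≠ ⊤ → g b = (((f b).toReal + (a - b) ^ 2 / (2 * γ) : ℝ) : EReal) := by
    intro b hb
    rw [hg, EReal.coe_add, hf.coe_toReal hb]
  have hpt : f p ≠ ⊤ := by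
    intro h
    have h1 := isMinOn_iff.1 hmin 0 ⟨le_rfl, hB0⟩
    rw [hgv 0 hz, hg] at h1
    simp only [h, EReal.top_add_coe, top_le_iff] at h1
    exact EReal.coe_ne_top _ h1
  have key : ∀ b ∈ Icc 0 B, f b ≠ ⊤ →
      (f p).toReal + (a - p) ^ 2 / (2 * γ) ≤ (f b).toReal + (a - b) ^ 2 / (2 * γ) := by
    intro b hb hbt
    have h1 := isMinOn_iff.1 hmin b hb
    rw [hgv p hpt, hgv b hbt] at h1
    exact_mod_cast h1
  refine ⟨p, hpt, fun b hb => ?_⟩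
  have hb0 := hf.nonneg_of_ne_top hb
  rcases le_total b B with hbB | hbB
  · exact key b ⟨hb0, hbB⟩ hb
  · refine (key 0 ⟨le_rfl, hB0⟩ hz).trans ?_
    rw [hf.map_zero, EReal.toReal_zero, zero_add]
    refine le_trans ?_ (add_le_add_left (hlow b hb) _)
    have : (a - 0) ^ 2 / (2 * γ) + C * (1 + b) ≤ (a - b) ^ 2 / (2 * γ) := by
      rw [div_add' _ _ _ (by positivity)]
      gcongr
      have h1 := le_abs_self a
      have h2 : b * B ≤ b * b := by gcongr
      have h3 : 1 ≤ b := by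
        have : 0 ≤ 2 * |a| + 4 * γ * C := by positivity
        linarith
      have h4 : a * b ≤ |a| * b := by gcongr
      have h5 : C * γ * 1 ≤ C * γ * b := by gcongr
      rw [hB] at h2
      nlinarith
    linarith

open Classical in
/-- The proximal map `a ↦ argmin_b (f(b) + |a - b|² / (2γ))`. -/
def prox (f : ℝ → EReal) (γ a : ℝ) : ℝ :=
  if h : ∃ p, f p ≠ ⊤ ∧ ∀ b, f b ≠ ⊤ →
      (f p).toReal + (a - p) ^ 2 / (2 * γ) ≤ (f b).toReal + (a - b) ^ 2 / (2 * γ)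
  then h.choose else 0

theorem IsEnergyDensity.prox_spec (hf : IsEnergyDensity d f) (hγ : 0 < γ) (a : ℝ) :
    f (prox f γ a) ≠ ⊤ ∧ ∀ b, f b ≠ ⊤ →
      (f (prox f γ a)).toReal + (a - prox f γ a) ^ 2 / (2 * γ)
        ≤ (f b).toReal + (a - b) ^ 2 / (2 * γ) := by
  have h := hf.exists_prox hγ a
  rw [prox, dif_pos h]
  exact h.choose_spec

theorem IsEnergyDensity.prox_nonneg (hf : IsEnergyDensity d f) (hγ : 0 < γ) (a : ℝ) :
    0 ≤ prox f γ a := hf.nonneg_of_ne_top (hf.prox_spec hγ a).1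

theorem IsEnergyDensity.moreau_eq (hf : IsEnergyDensity d f) (hγ : 0 < γ) (a : ℝ) :
    moreau f γ a = (f (prox f γ a)).toReal + (a - prox f γ a) ^ 2 / (2 * γ) := by
  obtain ⟨h1, h2⟩ := hf.prox_spec hγ a
  have : (⨅ b ∈ Ici (0 : ℝ), (f b + (((a - b) ^ 2 / (2 * γ) : ℝ) : EReal)))
      = (((f (prox f γ a)).toReal + (a - prox f γ a) ^ 2 / (2 * γ) : ℝ) : EReal) := by
    apply le_antisymm
    · refine (iInf₂_le (prox f γ a) (hf.prox_nonneg hγ a)).trans ?_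
      rw [EReal.coe_add, hf.coe_toReal h1]
    · refine le_iInf₂ fun b _ => ?_
      by_cases hb : f b = ⊤
      · rw [hb, EReal.top_add_coe]; exact le_top
      · rw [← hf.coe_toReal hb, ← EReal.coe_add]
        exact_mod_cast h2 b hb
  rw [moreau, this, EReal.toReal_coe]

theorem IsEnergyDensity.moreau_le (hf : IsEnergyDensity d f) (hγ : 0 < γ) (a : ℝ) {b : ℝ}
    (hb : f b ≠ ⊤) : moreau f γ a ≤ (f b).toReal + (a - b) ^ 2 / (2 * γ) := by
  rw [hf.moreau_eq hγ]
  exact (hf.prox_spec hγ a).2 b hb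

/-- The proximal objective is strongly convex with modulus 1/γ. Minimality is tested at (1 − t)p +
tb, the inequality is divided by t, and t tends to 0. -/
theorem IsEnergyDensity.prox_strong (hf : IsEnergyDensity d f) (hγ : 0 < γ) (a : ℝ) {b : ℝ}
    (hb : f b ≠ ⊤) :
    moreau f γ a + (b - prox f γ a) ^ 2 / (2 * γ) ≤ (f b).toReal + (a - b) ^ 2 / (2 * γ) := by
  set p := prox f γ a with hp
  have hpt : f p ≠ ⊤ := (hf.prox_spec hγ a).1
  have hstep : ∀ t : ℝ, 0 < t → t ≤ 1 →
      (f p).toReal + (a - p) ^ 2 / (2 * γ) + (1 - t) * ((b - p) ^ 2 / (2 * γ))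
        ≤ (f b).toReal + (a - b) ^ 2 / (2 * γ) := by
    intro t ht ht1
    obtain ⟨h1, h2⟩ := hf.toReal_convex hpt hb (s := 1 - t) (t := t) (by linarith) ht.le (by ring)
    have h3 := (hf.prox_spec hγ a).2 _ h1
    rw [← hp] at h3
    have e : (a - ((1 - t) * p + t * b)) ^ 2 / (2 * γ) = (1 - t) * ((a - p) ^ 2 / (2 * γ))
        + t * ((a - b) ^ 2 / (2 * γ)) - t * ((1 - t) * ((b - p) ^ 2 / (2 * γ))) := by
      field_simp; ring
    rw [e] at h3
    have h4 : t * ((f p).toReal + (a - p) ^ 2 / (2 * γ) + (1 - t) * ((b - p) ^ 2 / (2 * γ)))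
        ≤ t * ((f b).toReal + (a - b) ^ 2 / (2 * γ)) := by linarith
    exact le_of_mul_le_mul_left h4 ht
  rw [hf.moreau_eq hγ, ← hp]
  have hlim : Tendsto (fun t : ℝ => (f p).toReal + (a - p) ^ 2 / (2 * γ)
      + (1 - t) * ((b - p) ^ 2 / (2 * γ))) (𝓝[>] 0)
      (𝓝 ((f p).toReal + (a - p) ^ 2 / (2 * γ) + (1 - 0) * ((b - p) ^ 2 / (2 * γ)))) := by
    apply Tendsto.mono_left _ nhdsWithin_le_nhds
    exact Continuous.tendsto (by fun_prop) 0
  rw [sub_zero, one_mul] at hlim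
  refine le_of_tendsto hlim ?_
  filter_upwards [Ioc_mem_nhdsGT (zero_lt_one' ℝ)] with t ht
  exact hstep t ht.1 ht.2

/-- Add the strong minimality of each proximal point tested at the other one: the values of `f`
cancel. -/
theorem IsEnergyDensity.prox_firm (hf : IsEnergyDensity d f) (hγ : 0 < γ) (a b : ℝ) :
    (prox f γ a - prox f γ b) ^ 2 ≤ (a - b) * (prox f γ a - prox f γ b) := by
  have h1 := hf.prox_strong hγ a (hf.prox_spec hγ b).1
  have h2 := hf.prox_strong hγ b (hf.prox_spec hγ a).1
  rw [hf.moreau_eq hγ] at h1 h2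
  set p := prox f γ a
  set q := prox f γ b
  have h3 : (a - p) ^ 2 / (2 * γ) + (q - p) ^ 2 / (2 * γ) + ((b - q) ^ 2 / (2 * γ)
      + (p - q) ^ 2 / (2 * γ)) ≤ (a - q) ^ 2 / (2 * γ) + (b - p) ^ 2 / (2 * γ) := by linarith
  rw [← add_div, ← add_div, ← add_div, ← add_div, div_le_div_iff_of_pos_right (by positivity)] at h3
  nlinarith

theorem IsEnergyDensity.abs_prox_sub_le (hf : IsEnergyDensity d f) (hγ : 0 < γ) (a b : ℝ) :
    |prox f γ a - prox f γ b| ≤ |a - b| := by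
  have h := hf.prox_firm hγ a b
  rw [← sq_abs] at h
  have h2 := (le_abs_self _).trans_eq (abs_mul (a - b) (prox f γ a - prox f γ b))
  rcases eq_or_lt_of_le (abs_nonneg (prox f γ a - prox f γ b)) with h0 | h0
  · rw [← h0]; positivity
  · nlinarith

theorem IsEnergyDensity.prox_mono (hf : IsEnergyDensity d f) (hγ : 0 < γ) :
    Monotone (prox f γ) := by
  intro a b hab
  by_contra! h
  have := hf.prox_firm hγ a b
  nlinarith

/-- Using the proximal point of x as a competitor at y bounds the first-order remainder from above
by a quadratic. Exchanging x and y, together with the monotonicity and nonexpansiveness of `prox`,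
bounds it from below. -/
theorem IsEnergyDensity.hasDerivAt_moreau (hf : IsEnergyDensity d f) (hγ : 0 < γ) (a : ℝ) :
    HasDerivAt (moreau f γ) ((a - prox f γ a) / γ) a := by
  have hup : ∀ x y : ℝ, moreau f γ y - moreau f γ x - (y - x) * ((x - prox f γ x) / γ)
      ≤ (y - x) ^ 2 / (2 * γ) := by
    intro x y
    have h := hf.moreau_le hγ y (hf.prox_spec hγ x).1
    rw [hf.moreau_eq hγ x]
    have e : (y - prox f γ x) ^ 2 / (2 * γ) = (x - prox f γ x) ^ 2 / (2 * γ)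
      + (y - x) * ((x - prox f γ x) / γ) + (y - x) ^ 2 / (2 * γ) := by field_simp; ring
    linarith
  have hlow : ∀ x y : ℝ, -(2 * ((y - x) ^ 2 / γ)) ≤
      moreau f γ y - moreau f γ x - (y - x) * ((x - prox f γ x) / γ) := by
    intro x y
    have h := hup y x
    have e : (x - y) * ((y - prox f γ y) / γ) = -((y - x) * ((x - prox f γ x) / γ))
      - ((y - x) ^ 2 / γ) + (y - x) * (prox f γ y - prox f γ x) / γ := by ring
    have h2 : (y - x) * (prox f γ y - prox f γ x) / γ ≤ (y - x) ^ 2 / γ := by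
      gcongr
      calc _ ≤ |y - x| * |prox f γ y - prox f γ x| := (le_abs_self _).trans_eq (abs_mul _ _)
        _ ≤ |y - x| * |y - x| :=
          mul_le_mul_of_nonneg_left (hf.abs_prox_sub_le hγ _ _) (abs_nonneg _)
        _ = _ := by rw [← sq, sq_abs]
    have h3 : 0 ≤ (y - x) * (prox f γ y - prox f γ x) / γ :=
      div_nonneg ((sq_nonneg _).trans (hf.prox_firm hγ y x)) hγ.le
    have e2 : (x - y) ^ 2 / (2 * γ) = (y - x) ^ 2 / γ / 2 := by field_simp; ring
    have h4 : 0 ≤ (y - x) ^ 2 / γ := by positivity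
    linarith
  rw [hasDerivAt_iff_isLittleO]
  have hbig : (fun y => moreau f γ y - moreau f γ a - (y - a) • ((a - prox f γ a) / γ))
      =O[𝓝 a] fun y => (y - a) ^ 2 := by
    refine Asymptotics.IsBigO.of_bound (2 / γ) (Eventually.of_forall fun y => ?_)
    rw [smul_eq_mul, Real.norm_eq_abs, Real.norm_eq_abs, abs_of_nonneg (sq_nonneg (y - a)), abs_le]
    have h1 := hup a y
    have h2 := hlow a y
    have h4 : 0 ≤ (y - a) ^ 2 / γ := by positivity
    have e2 : (y - a) ^ 2 / (2 * γ) = (y - a) ^ 2 / γ / 2 := by field_simp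
    have e3 : 2 / γ * (y - a) ^ 2 = 2 * ((y - a) ^ 2 / γ) := by ring
    constructor <;> linarith
  refine hbig.trans_isLittleO ?_
  have : (fun y : ℝ => (y - a) ^ 2) =o[𝓝 a] fun y => (y - a) ^ 1 := by
    have h := Asymptotics.isLittleO_pow_pow (𝕜 := ℝ) (one_lt_two)
    exact h.comp_tendsto (by
      have : Tendsto (fun y : ℝ => y - a) (𝓝 a) (𝓝 (a - a)) := by
        exact Continuous.tendsto (by fun_prop) a
      rwa [sub_self] at this)
  simpa using this

theorem IsEnergyDensity.hasDerivAt_regDensity (hf : IsEnergyDensity d f) (hγ : 0 < γ) (a : ℝ) :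
    HasDerivAt (regDensity f γ) (γ * a + (a - prox f γ a) / γ) a := by
  have h := (((hasDerivAt_pow 2 a).const_mul (γ / 2)).add
    (hf.hasDerivAt_moreau hγ a)).sub_const (moreau f γ 0)
  have e : γ * a + (a - prox f γ a) / γ
      = γ / 2 * (((2 : ℕ) : ℝ) * a ^ (2 - 1)) + (a - prox f γ a) / γ := by
    norm_num; ring
  rw [e]
  exact h

theorem IsEnergyDensity.regDensityDeriv_eq (hf : IsEnergyDensity d f) (hγ : 0 < γ) {a : ℝ}
    (ha : 0 ≤ a) : regDensityDeriv f γ a = γ * a + (a - prox f γ a) / γ :=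
  ((hf.hasDerivAt_regDensity hγ a).hasDerivWithinAt).derivWithin
    (uniqueDiffOn_Ici 0 a ha)

theorem IsEnergyDensity.hasDerivAt_regDensity' (hf : IsEnergyDensity d f) (hγ : 0 < γ) {a : ℝ}
    (ha : 0 ≤ a) : HasDerivAt (regDensity f γ) (regDensityDeriv f γ a) a := by
  rw [hf.regDensityDeriv_eq hγ ha]
  exact hf.hasDerivAt_regDensity hγ a

theorem IsEnergyDensity.abs_regDensityDeriv_sub_le (hf : IsEnergyDensity d f) (hγ : 0 < γ)
    {a b : ℝ} (ha : 0 ≤ a) (hb : 0 ≤ b) :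
    |regDensityDeriv f γ a - regDensityDeriv f γ b| ≤ (γ + 1 / γ) * |a - b| := by
  wlog h : b ≤ a generalizing a b
  · rw [abs_sub_comm, abs_sub_comm a b]; exact this hb ha (le_of_not_ge h)
  rw [hf.regDensityDeriv_eq hγ ha, hf.regDensityDeriv_eq hγ hb, abs_of_nonneg (sub_nonneg.2 h)]
  have h1 := hf.prox_mono hγ h
  have h2 := hf.abs_prox_sub_le hγ a b
  rw [abs_of_nonneg (sub_nonneg.2 h1), abs_of_nonneg (sub_nonneg.2 h)] at h2
  have e : γ * a + (a - prox f γ a) / γ - (γ * b + (b - prox f γ b) / γ)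
    = γ * (a - b) + ((a - b) - (prox f γ a - prox f γ b)) / γ := by ring
  have e2 : (γ + 1 / γ) * (a - b) = γ * (a - b) + (a - b) / γ := by ring
  have h3 : 0 ≤ ((a - b) - (prox f γ a - prox f γ b)) / γ := div_nonneg (by linarith) hγ.le
  have h4 : ((a - b) - (prox f γ a - prox f γ b)) / γ ≤ (a - b) / γ :=
    div_le_div_of_nonneg_right (by linarith) hγ.le
  have h5 : 0 ≤ γ * (a - b) := mul_nonneg hγ.le (by linarith)
  rw [e, e2, abs_of_nonneg (by linarith)]
  linarith

/-- A monotone Lipschitz function on the line is cocoercive. Stated for increments, this substitutes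
for a chain rule: f_ε' need not be differentiable. -/
theorem IsEnergyDensity.sq_regDensityDeriv_sub_le (hf : IsEnergyDensity d f) (hγ : 0 < γ)
    {a b : ℝ} (ha : 0 ≤ a) (hb : 0 ≤ b) :
    (regDensityDeriv f γ a - regDensityDeriv f γ b) ^ 2 ≤
      (γ + 1 / γ) * ((regDensityDeriv f γ a - regDensityDeriv f γ b) * (a - b)) := by
  wlog h : b ≤ a generalizing a b
  · have := this hb ha (le_of_not_ge h)
    nlinarith
  have h0 := hf.abs_regDensityDeriv_sub_le hγ ha hb
  have h1 : 0 ≤ regDensityDeriv f γ a - regDensityDeriv f γ b := by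
    rw [hf.regDensityDeriv_eq hγ ha, hf.regDensityDeriv_eq hγ hb]
    have h2 := hf.abs_prox_sub_le hγ a b
    rw [abs_of_nonneg (sub_nonneg.2 h)] at h2
    have h3 := (le_abs_self _).trans h2
    have e : γ * a + (a - prox f γ a) / γ - (γ * b + (b - prox f γ b) / γ)
      = γ * (a - b) + ((a - b) - (prox f γ a - prox f γ b)) / γ := by ring
    have h3 : 0 ≤ ((a - b) - (prox f γ a - prox f γ b)) / γ := div_nonneg (by linarith) hγ.le
    have h5 : 0 ≤ γ * (a - b) := mul_nonneg hγ.le (by linarith)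
    rw [e]; linarith
  rw [abs_of_nonneg h1, abs_of_nonneg (sub_nonneg.2 h)] at h0
  nlinarith

theorem regDensity_zero : regDensity f γ 0 = 0 := by simp [regDensity]

/-- Lower bound for the Moreau–Yosida regularization by a value of `f` at a smaller argument. -/
theorem IsEnergyDensity.le_moreau_sub (hf : IsEnergyDensity d f) (hγ : 0 < γ) {a : ℝ}
    (ha : 0 ≤ a) :
    f (min (prox f γ a) a) ≤ ((moreau f γ a - moreau f γ 0 : ℝ) : EReal) := by
  set p := prox f γ a with hp
  have hpt : f p ≠ ⊤ := (hf.prox_spec hγ a).1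
  have hz : f 0 ≠ ⊤ := by simp [hf.map_zero]
  have hma : moreau f γ a = (f p).toReal + (a - p) ^ 2 / (2 * γ) := hf.moreau_eq hγ a
  rcases le_total p a with h | h
  · rw [min_eq_left h, ← hf.coe_toReal hpt, EReal.coe_le_coe_iff, hma]
    have h0 := hf.moreau_le hγ 0 hz
    rw [hf.map_zero] at h0
    simp only [EReal.toReal_zero, sub_self, zero_add] at h0
    have : 0 ≤ (a - p) ^ 2 / (2 * γ) := by positivity
    norm_num at h0
    linarith
  -- When the proximal point p overshoots a, convexity and f(0) = 0 give f(a) + f(p − a) ≤ f(p),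
  -- while p − a is a competitor for the envelope at 0 with the same quadratic cost (a − p)².
  · rw [min_eq_right h]
    rcases eq_or_lt_of_le ha with ha0 | hapos
    · simp [← ha0, hf.map_zero]
    have hppos : 0 < p := hapos.trans_le h
    have hap : a / p ≤ 1 := by rw [div_le_one hppos]; exact h
    have hap0 : 0 < a / p := by positivity
    obtain ⟨h1, h2⟩ := hf.toReal_convex hz hpt (s := a / p) (t := 1 - a / p) hap0.le
      (by linarith) (by ring)
    obtain ⟨h3, h4⟩ := hf.toReal_convex hz hpt (s := 1 - a / p) (t := a / p)
      (by linarith) hap0.le (by ring)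
    have e1 : a / p * 0 + (1 - a / p) * p = p - a := by field_simp; ring
    have e2 : (1 - a / p) * 0 + a / p * p = a := by field_simp; ring
    rw [e1, hf.map_zero] at h2
    rw [e1] at h1
    rw [e2] at h3
    rw [e2, hf.map_zero] at h4
    simp only [EReal.toReal_zero, mul_zero, zero_add] at h2 h4
    rw [← hf.coe_toReal h3, EReal.coe_le_coe_iff, hma]
    have h5 := hf.moreau_le hγ 0 h1
    have e3 : (0 - (p - a)) ^ 2 / (2 * γ) = (a - p) ^ 2 / (2 * γ) := by ring
    linarith

end NonlocalDiffusion

end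

noncomputable section

namespace NonlocalDiffusion

/-! ### Convolution calculus -/

variable {d : ℕ} {F : Type*} [NormedAddCommGroup F] [NormedSpace ℝ F]

/-- The convolution `x ↦ ∫ q(x - z) K(z) dz`. -/
def conv (q : Space d → ℝ) (K : Space d → F) (x : Space d) : F := ∫ z, q (x - z) • K z

theorem continuous_forall_le_of_ae_le {g : Space d → ℝ} (hg : Continuous g) {C : ℝ}
    (h : ∀ᵐ x, g x ≤ C) (x : Space d) : g x ≤ C := by
  by_contra! hx
  have ho : IsOpen {x | C < g x} := isOpen_lt continuous_const hg
  have h0 : volume {x | C < g x} = 0 := by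
    rw [ae_iff] at h
    simpa only [not_le] using h
  have := ho.measure_eq_zero_iff volume |>.1 h0
  exact (this ▸ hx : x ∈ (∅ : Set (Space d)))

theorem exists_bound_of_memLp_top {F : Type*} [NormedAddCommGroup F] {g : Space d → F} (hg : Continuous g) (h : MemLp g ⊤ volume) :
    ∃ M : ℝ, ∀ x, ‖g x‖ ≤ M := by
  refine ⟨(eLpNorm g ⊤ volume).toReal, continuous_forall_le_of_ae_le hg.norm ?_⟩
  have h1 := ae_le_eLpNormEssSup (f := g) (μ := volume)
  filter_upwards [h1] with x hx
  have h2 : ‖g x‖ = ‖g x‖ₑ.toReal := by simp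
  rw [h2]
  refine ENNReal.toReal_mono h.2.ne ?_
  rwa [eLpNorm_exponent_top]

theorem integrable_comp_sub_prod {ρ : Measure (Space d)} [IsFiniteMeasure ρ] {K : Space d → F}
    (hK : Integrable K) :
    Integrable (fun z : Space d × Space d => K (z.1 - z.2)) (volume.prod ρ) := by
  have h := Integrable.convolution_integrand (𝕜 := ℝ) (ContinuousLinearMap.lsmul ℝ ℝ)
    (integrable_const (1 : ℝ) (μ := ρ)) hK
  simpa using h

theorem integrable_comp_rsub_prod {ρ : Measure (Space d)} [IsFiniteMeasure ρ] {K : Space d → F}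
    (hK : Integrable K) :
    Integrable (fun z : Space d × Space d => K (z.1 - z.2)) (ρ.prod volume) := by
  have h := (integrable_comp_sub_prod (ρ := ρ) hK.comp_neg).swap
  refine h.congr (Eventually.of_forall fun z => ?_)
  simp

section Conv

variable {q : Space d → ℝ} {K : Space d → F} {B : ℝ} {ℓ : ℝ≥0}

theorem integrable_conv (hq : Continuous q) (hB : ∀ x, |q x| ≤ B) (hK : Integrable K)
    (x : Space d) : Integrable fun z => q (x - z) • K z :=
  hK.bdd_smul B (by fun_prop) (Eventually.of_forall fun z => hB _)

theorem norm_conv_le (hB : ∀ x, |q x| ≤ B) (hK : Integrable K) (x : Space d) :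
    ‖conv q K x‖ ≤ B * ∫ z, ‖K z‖ := by
  rw [conv, ← integral_const_mul]
  refine norm_integral_le_of_norm_le (hK.norm.const_mul B) (Eventually.of_forall fun z => ?_)
  rw [norm_smul]
  exact mul_le_mul_of_nonneg_right (hB _) (norm_nonneg _)

theorem conv_sub_left {q' : Space d → ℝ} {B' : ℝ} (hq : Continuous q) (hB : ∀ x, |q x| ≤ B)
    (hq' : Continuous q') (hB' : ∀ x, |q' x| ≤ B') (hK : Integrable K) (x : Space d) :
    conv q K x - conv q' K x = conv (fun y => q y - q' y) K x := by
  simp only [conv]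
  rw [← integral_sub (integrable_conv hq hB hK x) (integrable_conv hq' hB' hK x)]
  simp only [sub_smul]

theorem norm_conv_sub_le {q' : Space d → ℝ} {B' η : ℝ} (hq : Continuous q)
    (hB : ∀ x, |q x| ≤ B) (hq' : Continuous q') (hB' : ∀ x, |q' x| ≤ B')
    (h : ∀ x, |q x - q' x| ≤ η) (hK : Integrable K) (x : Space d) :
    ‖conv q K x - conv q' K x‖ ≤ η * ∫ z, ‖K z‖ := by
  rw [conv_sub_left hq hB hq' hB' hK]
  exact norm_conv_le h hK x

theorem norm_conv_sub_conv_le (hq : LipschitzWith ℓ q) (hB : ∀ x, |q x| ≤ B) (hK : Integrable K)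
    (x y : Space d) : ‖conv q K x - conv q K y‖ ≤ ℓ * (∫ z, ‖K z‖) * ‖x - y‖ := by
  simp only [conv]
  rw [← integral_sub (integrable_conv hq.continuous hB hK x)
    (integrable_conv hq.continuous hB hK y),
    mul_right_comm, ← integral_const_mul]
  refine norm_integral_le_of_norm_le (hK.norm.const_mul _) (Eventually.of_forall fun z => ?_)
  rw [← sub_smul, norm_smul]
  refine mul_le_mul_of_nonneg_right ?_ (norm_nonneg _)
  have := hq.norm_sub_le (x - z) (y - z)
  rwa [sub_sub_sub_cancel_right] at this

variable [CompleteSpace F]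

/-- As q is only Lipschitz, the derivative is put on K. The fundamental theorem of calculus for K
writes the increment as the average over τ ∈ [0,1] of the claimed derivative at x + τv; since q is
Lipschitz that derivative is Lipschitz in x, and the remainder is quadratic. -/
theorem hasFDerivAt_conv (hq : LipschitzWith ℓ q) (hB : ∀ x, |q x| ≤ B) (hK : Integrable K)
    (hKd : ContDiff ℝ 1 K) (hDK : Integrable (fderiv ℝ K)) (x : Space d) :
    HasFDerivAt (conv q K) (conv q (fderiv ℝ K) x) x := by
  have hqc := hq.continuous
  have hDc : Continuous (fderiv ℝ K) := hKd.continuous_fderiv (by norm_num)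
  have hdiff : Differentiable ℝ K := hKd.differentiable (by norm_num)
  have hB0 : 0 ≤ B := (abs_nonneg _).trans (hB 0)
  set N := ∫ z, ‖fderiv ℝ K z‖ with hN
  have hshift : ∀ v, conv q K (x + v) = ∫ z, q (x - z) • K (z + v) := by
    intro v
    rw [conv, ← integral_add_right_eq_self _ v]
    simp only [add_sub_add_right_eq_sub]
  have hint1 : ∀ v, Integrable fun z => q (x - z) • K (z + v) := fun v =>
    (hK.comp_add_right v).bdd_smul B (by fun_prop) (Eventually.of_forall fun z => hB _)
  have hftc : ∀ v z, K (z + v) - K z = ∫ τ in Icc (0 : ℝ) 1, fderiv ℝ K (z + τ • v) v := by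
    intro v z
    rw [integral_Icc_eq_integral_Ioc, ← intervalIntegral.integral_of_le zero_le_one]
    have : ∀ τ ∈ uIcc (0 : ℝ) 1, HasDerivAt (fun τ : ℝ => K (z + τ • v))
        (fderiv ℝ K (z + τ • v) v) τ := by
      intro τ _
      have h1 : HasDerivAt (fun τ : ℝ => z + τ • v) v τ := by
        simpa using ((hasDerivAt_id τ).smul_const v).const_add z
      exact (hdiff _).hasFDerivAt.comp_hasDerivAt τ h1
    rw [intervalIntegral.integral_eq_sub_of_hasDerivAt this]
    · simp
    · exact (Continuous.intervalIntegrable (by fun_prop) _ _)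
  have hmain : ∀ v, conv q K (x + v) - conv q K x
      = ∫ τ in Icc (0 : ℝ) 1, conv q (fderiv ℝ K) (x + τ • v) v := by
    intro v
    have e0 : conv q K x = ∫ z, q (x - z) • K z := rfl
    rw [hshift, e0, ← integral_sub (hint1 v) (integrable_conv hqc hB hK x)]
    simp only [← smul_sub, hftc, ← integral_smul]
    have hmeas : AEStronglyMeasurable
        (fun p : Space d × ℝ => q (x - p.1) • fderiv ℝ K (p.1 + p.2 • v) v)
        (volume.prod (volume.restrict (Icc (0 : ℝ) 1))) :=
      Continuous.aestronglyMeasurable (by fun_prop)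
    rw [integral_integral_swap]
    · refine integral_congr_ae (Eventually.of_forall fun τ => ?_)
      simp only [conv]
      rw [ContinuousLinearMap.integral_apply (integrable_conv hqc hB hDK _)]
      refine Eq.trans ?_ (integral_add_right_eq_self
        (fun z => (q (x + τ • v - z) • fderiv ℝ K z) v) (τ • v))
      simp
    · refine (integrable_prod_iff' hmeas).2 ⟨Eventually.of_forall fun τ => ?_, ?_⟩
      · refine (((hDK.comp_add_right (τ • v)).apply_continuousLinearMap v)).bdd_smul B
          (by fun_prop) (Eventually.of_forall fun z => hB _)
      · refine Integrable.mono' (integrable_const (B * (N * ‖v‖))) ?_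
          (Eventually.of_forall fun τ => ?_)
        · exact hmeas.norm.prod_swap.integral_prod_right'
        · rw [Real.norm_of_nonneg (integral_nonneg fun _ => norm_nonneg _)]
          have e1 : N = ∫ z, ‖fderiv ℝ K (z + τ • v)‖ :=
            (integral_add_right_eq_self (fun z => ‖fderiv ℝ K z‖) (τ • v)).symm
          rw [e1, ← integral_mul_const, ← integral_const_mul]
          refine integral_mono_of_nonneg (Eventually.of_forall fun _ => norm_nonneg _)
            (((hDK.comp_add_right (τ • v)).norm.mul_const _).const_mul _)
            (Eventually.of_forall fun z => ?_)
          simp only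
          rw [norm_smul]
          exact mul_le_mul (hB _) (ContinuousLinearMap.le_opNorm _ _) (norm_nonneg _) hB0
  have hlipD := norm_conv_sub_conv_le hq hB hDK
  have hcontD : Continuous (conv q (fderiv ℝ K)) := by
    refine (LipschitzWith.of_dist_le_mul (K := ℓ * ⟨N, integral_nonneg fun _ => norm_nonneg _⟩)
      fun a b => ?_).continuous
    rw [dist_eq_norm, dist_eq_norm]
    exact hlipD a b
  rw [hasFDerivAt_iff_isLittleO_nhds_zero]
  have hbig : (fun v => conv q K (x + v) - conv q K x - conv q (fderiv ℝ K) x v)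
      =O[𝓝 0] fun v => ‖v‖ ^ 2 := by
    refine Asymptotics.IsBigO.of_bound (ℓ * N) (Eventually.of_forall fun v => ?_)
    have hc : Continuous fun τ : ℝ => conv q (fderiv ℝ K) (x + τ • v) v := by fun_prop
    have e2 : conv q (fderiv ℝ K) x v
        = ∫ τ in Icc (0 : ℝ) 1, conv q (fderiv ℝ K) x v := by simp
    rw [hmain, e2, ← integral_sub (hc.integrableOn_Icc) (by simp)]
    have := norm_setIntegral_le_of_norm_le_const (μ := volume) (s := Icc (0 : ℝ) 1)
      (f := fun τ => conv q (fderiv ℝ K) (x + τ • v) v - conv q (fderiv ℝ K) x v)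
      (C := ℓ * N * ‖v‖ ^ 2) (by simp) (fun τ hτ => ?_)
    · simpa using this
    · rw [← sub_apply]
      refine (ContinuousLinearMap.le_opNorm _ _).trans ?_
      rw [sq, ← mul_assoc]
      refine mul_le_mul_of_nonneg_right ((hlipD _ _).trans ?_) (norm_nonneg _)
      rw [add_sub_cancel_left, norm_smul, Real.norm_of_nonneg hτ.1]
      have h0 : (0:ℝ) ≤ ℓ * N :=
        mul_nonneg ℓ.2 (integral_nonneg fun _ => norm_nonneg _)
      refine mul_le_mul_of_nonneg_left ?_ h0
      exact mul_le_of_le_one_left (norm_nonneg _) hτ.2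
  refine hbig.trans_isLittleO ?_
  have h := Asymptotics.isLittleO_norm_pow_id (E' := Space d) one_lt_two
  exact h

/-- The same derivative moved onto q. By Rademacher q is differentiable almost everywhere, and its
Lipschitz bound dominates the difference quotients under the integral; uniqueness of derivatives
identifies the two formulas. -/
theorem conv_fderiv_apply (hq : LipschitzWith ℓ q) (hB : ∀ x, |q x| ≤ B) (hK : Integrable K)
    (hKd : ContDiff ℝ 1 K) (hDK : Integrable (fderiv ℝ K)) (x v : Space d) :
    conv q (fderiv ℝ K) x v = ∫ z, (fderiv ℝ q (x - z) v) • K z := by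
  have h1 : HasDerivAt (fun s : ℝ => conv q K (x + s • v)) (conv q (fderiv ℝ K) x v) 0 := by
    have h2 : HasDerivAt (fun s : ℝ => x + s • v) v 0 := by
      simpa using ((hasDerivAt_id (0 : ℝ)).smul_const v).const_add x
    have h3 := hasFDerivAt_conv hq hB hK hKd hDK (x + (0 : ℝ) • v)
    rw [zero_smul, add_zero] at h3
    exact HasFDerivAt.comp_hasDerivAt_of_eq 0 h3 h2 (by simp)
  have hmeasD : Measurable fun z => fderiv ℝ q (x - z) v :=
    (measurable_fderiv_apply_const ℝ q v).comp (by fun_prop)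
  have h4 := hasDerivAt_integral_of_dominated_loc_of_lip (μ := volume) (𝕜 := ℝ) (x₀ := (0 : ℝ))
    (F := fun s z => q (x + s • v - z) • K z) (F' := fun z => (fderiv ℝ q (x - z) v) • K z)
    (bound := fun z => ℓ * ‖v‖ * ‖K z‖) (s := univ) univ_mem
    (Eventually.of_forall fun s => (integrable_conv hq.continuous hB hK _).aestronglyMeasurable)
    (integrable_conv hq.continuous hB hK _)
    (hmeasD.aestronglyMeasurable.smul hK.aestronglyMeasurable)
    (Eventually.of_forall fun z => ?_) (hK.norm.const_mul _) ?_
  · exact h1.unique h4.2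
  · refine LipschitzOnWith.of_dist_le_mul fun s _ s' _ => ?_
    have e : ((Real.nnabs (ℓ * ‖v‖ * ‖K z‖) : ℝ≥0) : ℝ) = ℓ * ‖v‖ * ‖K z‖ := by
      rw [Real.coe_nnabs, abs_of_nonneg (by positivity)]
    rw [dist_eq_norm, ← sub_smul, norm_smul, e, Real.dist_eq]
    have h5 := hq.norm_sub_le (x + s • v - z) (x + s' • v - z)
    have e2 : x + s • v - z - (x + s' • v - z) = (s - s') • v := by
      rw [sub_smul]; abel
    rw [e2, norm_smul, Real.norm_eq_abs (s - s')] at h5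
    calc _ ≤ (ℓ * (|s - s'| * ‖v‖)) * ‖K z‖ := mul_le_mul_of_nonneg_right h5 (norm_nonneg _)
      _ = _ := by ring
  · have h6 : ∀ᵐ z : Space d, DifferentiableAt ℝ q (x - z) :=
      (quasiMeasurePreserving_sub_left volume x).ae hq.ae_differentiableAt
    filter_upwards [h6] with z hz
    have h2 : HasDerivAt (fun s : ℝ => x + s • v - z) v 0 := by
      simpa using (((hasDerivAt_id (0 : ℝ)).smul_const v).const_add x).sub_const z
    exact (HasFDerivAt.comp_hasDerivAt_of_eq 0 hz.hasFDerivAt h2 (by simp)).smul_const _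

end Conv

/-! ### Smoothing kernels -/

/-- An even probability density `k ∈ C²` with `k, Dk, D²k` integrable and bounded and with finite
second moment. -/
structure IsKernel (k : Space d → ℝ) : Prop where
  contDiff : ContDiff ℝ 2 k
  nonneg : ∀ x, 0 ≤ k x
  even : ∀ x, k (-x) = k x
  integrable : Integrable k
  integral_eq_one : ∫ x, k x = 1
  integrable_gradient : Integrable (gradient k)
  integrable_fderiv_gradient : Integrable (fderiv ℝ (gradient k))
  bound : ∃ M : ℝ, ∀ x, ‖k x‖ ≤ M ∧ ‖gradient k x‖ ≤ M ∧ ‖fderiv ℝ (gradient k) x‖ ≤ M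
  integrable_sq : Integrable fun x => ‖x‖ ^ 2 * k x

theorem contDiff_gradient {k : Space d → ℝ} (hk : ContDiff ℝ 2 k) : ContDiff ℝ 1 (gradient k) :=
  (InnerProductSpace.toDual ℝ (Space d)).symm.contDiff.comp
    (hk.fderiv_right (m := 1) (by norm_num))

theorem norm_gradient (k : Space d → ℝ) (x : Space d) : ‖gradient k x‖ = ‖fderiv ℝ k x‖ := by
  simp [gradient]

theorem inner_gradient (k : Space d → ℝ) (x v : Space d) :
    ⟪gradient k x, v⟫_ℝ = fderiv ℝ k x v := by
  simp [gradient]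

theorem inner_fderiv_gradient {k : Space d → ℝ} (hk : ContDiff ℝ 2 k) (x v w : Space d) :
    ⟪fderiv ℝ (gradient k) x v, w⟫_ℝ = fderiv ℝ (fderiv ℝ k) x v w := by
  have h1 := ((contDiff_gradient hk).differentiable (by norm_num) x).hasFDerivAt
  have h2 := ((hk.fderiv_right (m := 1) (by norm_num)).differentiable
    (by norm_num) x).hasFDerivAt
  have h3 := h1.inner ℝ (hasFDerivAt_const w x)
  have h4 := h2.clm_apply (hasFDerivAt_const w x)
  simp only [inner_gradient] at h3
  have := congrArg (fun A : Space d →L[ℝ] ℝ => A v) (h3.unique h4)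
  simpa using this

theorem norm_fderiv_gradient_le {k : Space d → ℝ} (hk : ContDiff ℝ 2 k) (x : Space d) :
    ‖fderiv ℝ (gradient k) x‖ ≤ ‖fderiv ℝ (fderiv ℝ k) x‖ := by
  refine ContinuousLinearMap.opNorm_le_bound _
    (norm_nonneg (E := Space d →L[ℝ] Space d →L[ℝ] ℝ) _) fun v => ?_
  set a := fderiv ℝ (gradient k) x v with ha
  rcases eq_or_ne ‖a‖ 0 with h0 | h0
  · rw [h0]; positivity
  have h1 : ‖a‖ * ‖a‖ ≤ ‖fderiv ℝ (fderiv ℝ k) x‖ * ‖v‖ * ‖a‖ := by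
    rw [← real_inner_self_eq_norm_mul_norm, ha, inner_fderiv_gradient hk, ← ha]
    have h2 : ‖fderiv ℝ (fderiv ℝ k) x v a‖ ≤ ‖fderiv ℝ (fderiv ℝ k) x v‖ * ‖a‖ :=
      (fderiv ℝ (fderiv ℝ k) x v).le_opNorm a
    have h3 : ‖fderiv ℝ (fderiv ℝ k) x v‖ ≤ ‖fderiv ℝ (fderiv ℝ k) x‖ * ‖v‖ :=
      ContinuousLinearMap.le_opNorm (E := Space d) (F := Space d →L[ℝ] ℝ) _ v
    exact ((le_abs_self _).trans h2).trans (mul_le_mul_of_nonneg_right h3 (norm_nonneg a))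
  exact le_of_mul_le_mul_right h1 (lt_of_le_of_ne (norm_nonneg _) h0.symm)

theorem rescale_eq (φ : Space d → ℝ) (ε : ℝ) :
    rescale φ ε = (ε ^ d)⁻¹ • fun x => φ (ε⁻¹ • x) := rfl

theorem fderiv_rescale (φ : Space d → ℝ) (ε : ℝ) :
    fderiv ℝ (rescale φ ε) = fun x => ((ε ^ d)⁻¹ * ε⁻¹) • fderiv ℝ φ (ε⁻¹ • x) := by
  rw [rescale_eq, fderiv_const_smul_field]
  funext x
  simp only [Pi.smul_apply]
  rw [fderiv_comp_smul, smul_smul]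

theorem gradient_rescale (φ : Space d → ℝ) (ε : ℝ) :
    gradient (rescale φ ε) = ((ε ^ d)⁻¹ * ε⁻¹) • fun x => gradient φ (ε⁻¹ • x) := by
  funext x
  simp only [gradient, fderiv_rescale, map_smul, Pi.smul_apply]

theorem fderiv_gradient_rescale (φ : Space d → ℝ) (ε : ℝ) :
    fderiv ℝ (gradient (rescale φ ε))
      = fun x => ((ε ^ d)⁻¹ * ε⁻¹ * ε⁻¹) • fderiv ℝ (gradient φ) (ε⁻¹ • x) := by
  rw [gradient_rescale, fderiv_const_smul_field]
  funext x
  simp only [Pi.smul_apply]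
  rw [fderiv_comp_smul, smul_smul]

theorem integral_rescale_mul (φ : Space d → ℝ) {ε : ℝ} (hε : 0 < ε) (g : Space d → ℝ) :
    ∫ x, g (ε⁻¹ • x) * rescale φ ε x = ∫ x, g x * φ x := by
  have h := Measure.integral_comp_inv_smul_of_nonneg (μ := (volume : Measure (Space d)))
    (fun x => g x * φ x) hε.le
  rw [finrank_euclideanSpace, Fintype.card_fin, smul_eq_mul] at h
  calc ∫ x, g (ε⁻¹ • x) * rescale φ ε x = ∫ x, (ε ^ d)⁻¹ * (g (ε⁻¹ • x) * φ (ε⁻¹ • x)) := by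
        congr 1; funext x; simp only [rescale]; ring
    _ = (ε ^ d)⁻¹ * (ε ^ d * ∫ x, g x * φ x) := by rw [integral_const_mul, h]
    _ = _ := by rw [← mul_assoc, inv_mul_cancel₀ (by positivity), one_mul]

/-- Each derivative costs a factor 1/ε. The resulting bounds are not uniform in ε and serve only to
give the drift enough regularity for a flow. -/
theorem IsMollifierProfile.isKernel {φ : Space d → ℝ} {r : ℝ} (hφ : IsMollifierProfile φ r)
    (hφ₂ : Integrable fun x => ‖x‖ ^ 2 * φ x) {ε : ℝ} (hε : 0 < ε) :
    IsKernel (rescale φ ε) := by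
  have hc1 : Continuous (gradient φ) := (contDiff_gradient hφ.contDiff).continuous
  have hc2 : Continuous (fderiv ℝ (gradient φ)) :=
    (contDiff_gradient hφ.contDiff).continuous_fderiv (by norm_num)
  have hc2' : Continuous (fderiv ℝ (fderiv ℝ φ)) :=
    (hφ.contDiff.fderiv_right (m := 1) (by norm_num)).continuous_fderiv (by norm_num)
  have hi1 : Integrable (gradient φ) :=
    (memLp_one_iff_integrable.1 hφ.memLp_fderiv.1).mono hc1.aestronglyMeasurable
      (Eventually.of_forall fun x => (norm_gradient φ x).le)
  have hn2 : Integrable fun x => ‖fderiv ℝ (fderiv ℝ φ) x‖ :=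
    memLp_one_iff_integrable.1 (MemLp.norm (E := Space d →L[ℝ] Space d →L[ℝ] ℝ)
      hφ.memLp_fderiv2.1)
  have hi2 : Integrable (fderiv ℝ (gradient φ)) :=
    hn2.mono' hc2.aestronglyMeasurable
      (Eventually.of_forall fun x => norm_fderiv_gradient_le hφ.contDiff x)
  have hεi : ε⁻¹ ≠ 0 := inv_ne_zero hε.ne'
  refine ⟨?_, fun x => mul_nonneg (by positivity) (hφ.nonneg _), fun x => by
    simp [rescale, hφ.even], ((memLp_one_iff_integrable.1 hφ.memLp.1).comp_smul hεi).const_mul _,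
    ?_, ?_, ?_, ?_, ?_⟩
  · have := hφ.contDiff
    unfold rescale
    fun_prop
  · have := integral_rescale_mul φ hε (fun _ => 1)
    simpa [hφ.integral_eq_one] using this
  · rw [gradient_rescale]
    exact (hi1.comp_smul hεi).smul _
  · rw [fderiv_gradient_rescale]
    exact (hi2.comp_smul hεi).smul ((ε ^ d)⁻¹ * ε⁻¹ * ε⁻¹)
  · obtain ⟨M0, h0⟩ := exists_bound_of_memLp_top hφ.contDiff.continuous hφ.memLp.2
    obtain ⟨M1, h1⟩ := exists_bound_of_memLp_top (hφ.contDiff.continuous_fderiv (by norm_num))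
      hφ.memLp_fderiv.2
    obtain ⟨M2, h2⟩ := exists_bound_of_memLp_top (F := Space d →L[ℝ] Space d →L[ℝ] ℝ) hc2'
      hφ.memLp_fderiv2.2
    refine ⟨max (‖(ε ^ d)⁻¹‖ * M0) (max (‖(ε ^ d)⁻¹ * ε⁻¹‖ * M1)
      (‖(ε ^ d)⁻¹ * ε⁻¹ * ε⁻¹‖ * M2)), fun x => ⟨?_, ?_, ?_⟩⟩
    · refine le_max_of_le_left ?_
      rw [rescale, norm_mul]
      exact mul_le_mul_of_nonneg_left (h0 _) (norm_nonneg _)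
    · refine le_max_of_le_right (le_max_of_le_left ?_)
      rw [gradient_rescale, Pi.smul_apply, norm_smul, norm_gradient]
      exact mul_le_mul_of_nonneg_left (h1 _) (norm_nonneg _)
    · refine le_max_of_le_right (le_max_of_le_right ?_)
      rw [congrFun (fderiv_gradient_rescale φ ε) x, norm_smul]
      exact mul_le_mul_of_nonneg_left ((norm_fderiv_gradient_le hφ.contDiff _).trans (h2 _)) (norm_nonneg _)
  · have h := ((hφ₂.comp_smul hεi).const_mul (ε ^ 2 * (ε ^ d)⁻¹))
    refine h.congr (Eventually.of_forall fun x => ?_)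
    simp only [rescale, norm_smul, norm_inv, Real.norm_of_nonneg hε.le]
    field_simp

theorem integral_sq_mul_rescale (φ : Space d → ℝ) {ε : ℝ} (hε : 0 < ε) :
    ∫ x, ‖x‖ ^ 2 * rescale φ ε x = ε ^ 2 * ∫ x, ‖x‖ ^ 2 * φ x := by
  have h := integral_rescale_mul φ hε (fun x => ε ^ 2 * ‖x‖ ^ 2)
  calc _ = ∫ x, ε ^ 2 * ‖ε⁻¹ • x‖ ^ 2 * rescale φ ε x := by
        congr 1; funext x
        rw [norm_smul, norm_inv, Real.norm_of_nonneg hε.le]; field_simp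
    _ = _ := by rw [h, ← integral_const_mul]; congr 1; funext x; ring

end NonlocalDiffusion

end

noncomputable section

namespace NonlocalDiffusion

/-! ### The smoothed density, the potential and the pressure at one time -/

variable {d : ℕ} {f : ℝ → EReal} {φ : Space d → ℝ} {γ ε M : ℝ} {ρ : Measure (Space d)}

theorem IsKernel.differentiable (hk : IsKernel (rescale φ ε)) :
    Differentiable ℝ (rescale φ ε) := hk.contDiff.differentiable (by norm_num)

theorem IsKernel.continuous (hk : IsKernel (rescale φ ε)) :
    Continuous (rescale φ ε) := hk.contDiff.continuous

theorem IsKernel.continuous_fderiv (hk : IsKernel (rescale φ ε)) :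
    Continuous (fderiv ℝ (rescale φ ε)) := hk.contDiff.continuous_fderiv (by norm_num)

theorem IsKernel.continuous_gradient (hk : IsKernel (rescale φ ε)) :
    Continuous (gradient (rescale φ ε)) := (contDiff_gradient hk.contDiff).continuous

theorem IsKernel.integrable_fderiv (hk : IsKernel (rescale φ ε)) :
    Integrable (fderiv ℝ (rescale φ ε)) :=
  hk.integrable_gradient.mono hk.continuous_fderiv.aestronglyMeasurable
    (Eventually.of_forall fun x => (norm_gradient _ x).ge)

theorem IsKernel.fderiv_neg (hk : IsKernel (rescale φ ε)) (x : Space d) :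
    fderiv ℝ (rescale φ ε) (-x) = -fderiv ℝ (rescale φ ε) x := by
  have h : (fun y => rescale φ ε (-y)) = rescale φ ε := funext hk.even
  have h2 := fderiv_comp_smul (f := rescale φ ε) (x := x) (-1 : ℝ)
  simp only [neg_smul, one_smul] at h2
  rw [h] at h2
  rw [h2, neg_neg]

theorem IsKernel.symm (hk : IsKernel (rescale φ ε)) (x y : Space d) :
    rescale φ ε (x - y) = rescale φ ε (y - x) := by rw [← hk.even, neg_sub]

/-- A uniform bound for a kernel and its first two derivatives. -/
def IsKernelBound (k : Space d → ℝ) (M : ℝ) : Prop :=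
  ∀ x, ‖k x‖ ≤ M ∧ ‖gradient k x‖ ≤ M ∧ ‖fderiv ℝ (gradient k) x‖ ≤ M

theorem IsKernelBound.nonneg {k : Space d → ℝ} (hM : IsKernelBound k M) : 0 ≤ M :=
  (norm_nonneg _).trans (hM 0).1

theorem IsKernelBound.lipschitz (hk : IsKernel (rescale φ ε))
    (hM : IsKernelBound (rescale φ ε) M) : LipschitzWith M.toNNReal (rescale φ ε) := by
  refine lipschitzWith_of_nnnorm_fderiv_le hk.differentiable fun x => ?_
  rw [← NNReal.coe_le_coe, Real.coe_toNNReal _ hM.nonneg, coe_nnnorm, ← norm_gradient]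
  exact (hM x).2.1

section Smoothed

theorem smoothed_nonneg (hk : IsKernel (rescale φ ε)) (x : Space d) : 0 ≤ smoothed φ ε ρ x :=
  integral_nonneg fun _ => hk.nonneg _

theorem integrable_sq_norm_of_secondMoment (h : secondMoment ρ < ⊤) :
    Integrable (fun x => ‖x‖ ^ 2) ρ := by
  refine ⟨Continuous.aestronglyMeasurable (by fun_prop), ?_⟩
  refine lt_of_le_of_lt (lintegral_mono fun x => ?_) h
  simp [enorm_pow]

theorem abs_potential_sub_le (hf : IsEnergyDensity d f) (hγ : 0 < γ)
    (hk : IsKernel (rescale φ ε)) {ρ' : Measure (Space d)} [IsProbabilityMeasure ρ']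
    (x : Space d) :
    |potential f φ γ ε ρ x - potential f φ γ ε ρ' x|
      ≤ (γ + 1 / γ) * |smoothed φ ε ρ x - smoothed φ ε ρ' x| :=
  hf.abs_regDensityDeriv_sub_le hγ (smoothed_nonneg hk x) (smoothed_nonneg hk x)

variable [IsProbabilityMeasure ρ]

theorem integrable_kernel (hk : IsKernel (rescale φ ε)) (hM : IsKernelBound (rescale φ ε) M)
    (x : Space d) : Integrable (fun y => rescale φ ε (x - y)) ρ := by
  have := hk.continuous
  exact Integrable.of_bound (Continuous.aestronglyMeasurable (by fun_prop)) M
    (Eventually.of_forall fun y => (hM _).1)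

theorem smoothed_le (hM : IsKernelBound (rescale φ ε) M) (x : Space d) :
    smoothed φ ε ρ x ≤ M := by
  have := norm_integral_le_of_norm_le_const (μ := ρ) (f := fun y => rescale φ ε (x - y)) (C := M)
    (Eventually.of_forall fun y => (hM _).1)
  rw [probReal_univ, mul_one] at this
  exact (le_abs_self _).trans this

theorem hasFDerivAt_smoothed (hk : IsKernel (rescale φ ε)) (hM : IsKernelBound (rescale φ ε) M)
    (x : Space d) : HasFDerivAt (smoothed φ ε ρ)
      (∫ y, fderiv ℝ (rescale φ ε) (x - y) ∂ρ) x := by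
  have h1 := hk.continuous
  have h2 := hk.continuous_fderiv
  refine hasFDerivAt_integral_of_dominated_of_fderiv_le (s := univ) (bound := fun _ => M)
    (F' := fun x y => fderiv ℝ (rescale φ ε) (x - y)) univ_mem
    (Eventually.of_forall fun x => Continuous.aestronglyMeasurable (by fun_prop))
    (integrable_kernel hk hM x) (Continuous.aestronglyMeasurable (by fun_prop))
    (Eventually.of_forall fun y x _ => ?_) (integrable_const _)
    (Eventually.of_forall fun y x _ => ?_)
  · rw [← norm_gradient]; exact (hM _).2.1
  · exact (hasFDerivAt_comp_sub y).2 (hk.differentiable _).hasFDerivAt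

theorem integrable_fderiv_kernel (hk : IsKernel (rescale φ ε))
    (hM : IsKernelBound (rescale φ ε) M) (x : Space d) :
    Integrable (fun y => fderiv ℝ (rescale φ ε) (x - y)) ρ := by
  have := hk.continuous_fderiv
  exact Integrable.of_bound (Continuous.aestronglyMeasurable (by fun_prop)) M
    (Eventually.of_forall fun y => (norm_gradient _ _).ge.trans (hM _).2.1)

theorem fderiv_smoothed_apply (hk : IsKernel (rescale φ ε)) (hM : IsKernelBound (rescale φ ε) M)
    (x v : Space d) : fderiv ℝ (smoothed φ ε ρ) x v = ∫ y, fderiv ℝ (rescale φ ε) (x - y) v ∂ρ := by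
  rw [(hasFDerivAt_smoothed hk hM x).fderiv,
    ContinuousLinearMap.integral_apply (integrable_fderiv_kernel hk hM x)]

theorem lipschitz_smoothed (hk : IsKernel (rescale φ ε)) (hM : IsKernelBound (rescale φ ε) M) :
    LipschitzWith M.toNNReal (smoothed φ ε ρ) := by
  refine lipschitzWith_of_nnnorm_fderiv_le
    (fun x => (hasFDerivAt_smoothed hk hM x).differentiableAt) fun x => ?_
  rw [← NNReal.coe_le_coe, Real.coe_toNNReal _ hM.nonneg, coe_nnnorm,
    (hasFDerivAt_smoothed hk hM x).fderiv]
  have := norm_integral_le_of_norm_le_const (μ := ρ)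
    (f := fun y => fderiv ℝ (rescale φ ε) (x - y)) (C := M)
    (Eventually.of_forall fun y => (norm_gradient _ _).ge.trans (hM _).2.1)
  rwa [probReal_univ, mul_one] at this

theorem integrable_smoothed (hk : IsKernel (rescale φ ε)) :
    Integrable (smoothed φ ε ρ) :=
  (integrable_comp_sub_prod (ρ := ρ) hk.integrable).integral_prod_left

theorem integral_smoothed (hk : IsKernel (rescale φ ε)) : ∫ x, smoothed φ ε ρ x = 1 := by
  simp only [smoothed]
  rw [integral_integral_swap (integrable_comp_sub_prod (ρ := ρ) hk.integrable)]
  simp [integral_sub_right_eq_self (rescale φ ε), hk.integral_eq_one]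

theorem integrable_sq_smoothed_prod (hk : IsKernel (rescale φ ε)) (h : secondMoment ρ < ⊤) :
    Integrable (fun z : Space d × Space d => ‖z.1‖ ^ 2 * rescale φ ε (z.1 - z.2))
      (volume.prod ρ) ∧
    Integrable (fun z : Space d × Space d => ‖z.2‖ ^ 2 * rescale φ ε (z.1 - z.2))
      (volume.prod ρ) := by
  have hc := hk.continuous
  have h1 : Integrable (fun z : Space d × Space d => ‖z.2‖ ^ 2 * rescale φ ε (z.1 - z.2))
      (volume.prod ρ) := by
    have := Integrable.convolution_integrand (𝕜 := ℝ) (ContinuousLinearMap.lsmul ℝ ℝ)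
      (integrable_sq_norm_of_secondMoment h) hk.integrable
    simpa using this
  have h2 := integrable_comp_sub_prod (ρ := ρ) hk.integrable_sq
  refine ⟨((h1.const_mul 2).add (h2.const_mul 2)).mono'
    (Continuous.aestronglyMeasurable (by fun_prop)) (Eventually.of_forall fun z => ?_), h1⟩
  have h0 := hk.nonneg (z.1 - z.2)
  rw [Real.norm_of_nonneg (by positivity)]
  simp only [Pi.add_apply]
  have h3 : ‖z.1‖ ≤ ‖z.2‖ + ‖z.1 - z.2‖ := by
    have := norm_add_le z.2 (z.1 - z.2)
    rwa [add_sub_cancel] at this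
  have h4 : ‖z.1‖ ^ 2 ≤ 2 * ‖z.2‖ ^ 2 + 2 * ‖z.1 - z.2‖ ^ 2 := by
    have h5 : ‖z.1‖ ^ 2 ≤ (‖z.2‖ + ‖z.1 - z.2‖) ^ 2 := by gcongr
    nlinarith [sq_nonneg (‖z.2‖ - ‖z.1 - z.2‖)]
  calc ‖z.1‖ ^ 2 * rescale φ ε (z.1 - z.2)
      ≤ (2 * ‖z.2‖ ^ 2 + 2 * ‖z.1 - z.2‖ ^ 2) * rescale φ ε (z.1 - z.2) := by gcongr
    _ = _ := by ring

theorem integrable_sq_smoothed (hk : IsKernel (rescale φ ε)) (h : secondMoment ρ < ⊤) :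
    Integrable (fun x => ‖x‖ ^ 2 * smoothed φ ε ρ x) := by
  have := (integrable_sq_smoothed_prod hk h).1.integral_prod_left
  simpa only [integral_const_mul, smoothed] using this

theorem integral_sq_smoothed_le (hk : IsKernel (rescale φ ε)) (h : secondMoment ρ < ⊤) :
    ∫ x, ‖x‖ ^ 2 * smoothed φ ε ρ x
      ≤ 2 * (∫ x, ‖x‖ ^ 2 ∂ρ) + 2 * ∫ x, ‖x‖ ^ 2 * rescale φ ε x := by
  obtain ⟨h1, h2⟩ := integrable_sq_smoothed_prod (ρ := ρ) hk h
  have h3 := integrable_comp_sub_prod (ρ := ρ) hk.integrable_sq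
  have e : ∀ x, ‖x‖ ^ 2 * smoothed φ ε ρ x = ∫ y, ‖x‖ ^ 2 * rescale φ ε (x - y) ∂ρ := fun x => by
    rw [integral_const_mul, smoothed]
  simp only [e]
  rw [integral_integral_swap h1]
  have e2 : ∀ y : Space d, ∫ x, (2 * (‖y‖ ^ 2 * rescale φ ε (x - y))
      + 2 * (‖x - y‖ ^ 2 * rescale φ ε (x - y)))
      = 2 * ‖y‖ ^ 2 + 2 * ∫ x, ‖x‖ ^ 2 * rescale φ ε x := by
    intro y
    rw [integral_add (((hk.integrable.comp_sub_right y).const_mul _).const_mul _)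
      ((hk.integrable_sq.comp_sub_right y).const_mul _), integral_const_mul, integral_const_mul,
      integral_const_mul, integral_sub_right_eq_self (rescale φ ε), hk.integral_eq_one, mul_one,
      integral_sub_right_eq_self (fun x => ‖x‖ ^ 2 * rescale φ ε x)]
  have hsq := integrable_sq_norm_of_secondMoment h
  calc _ ≤ ∫ y, ∫ x, (2 * (‖y‖ ^ 2 * rescale φ ε (x - y))
      + 2 * (‖x - y‖ ^ 2 * rescale φ ε (x - y))) ∂volume ∂ρ := by
        refine integral_mono_ae h1.integral_prod_right
          (((h2.const_mul 2).add (h3.const_mul 2)).integral_prod_right) ?_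
        filter_upwards [h1.prod_left_ae] with y hy
        refine integral_mono hy (((hk.integrable.comp_sub_right y).const_mul _).const_mul _ |>.add
          ((hk.integrable_sq.comp_sub_right y).const_mul _)) fun x => ?_
        have h0 := hk.nonneg (x - y)
        have h4 : ‖x‖ ≤ ‖y‖ + ‖x - y‖ := by
          have := norm_add_le y (x - y)
          rwa [add_sub_cancel] at this
        have h5 : ‖x‖ ^ 2 ≤ 2 * ‖y‖ ^ 2 + 2 * ‖x - y‖ ^ 2 := by
          have h5 : ‖x‖ ^ 2 ≤ (‖y‖ + ‖x - y‖) ^ 2 := by gcongr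
          nlinarith [sq_nonneg (‖y‖ - ‖x - y‖)]
        calc ‖x‖ ^ 2 * rescale φ ε (x - y)
            ≤ (2 * ‖y‖ ^ 2 + 2 * ‖x - y‖ ^ 2) * rescale φ ε (x - y) := by gcongr
          _ = _ := by ring
    _ = _ := by
        simp only [e2]
        rw [integral_add (hsq.const_mul _) (integrable_const _), integral_const_mul]
        simp

/-! ### The potential -/

theorem lipschitz_potential (hf : IsEnergyDensity d f) (hγ : 0 < γ) (hk : IsKernel (rescale φ ε))
    (hM : IsKernelBound (rescale φ ε) M) :
    LipschitzWith (((γ + 1 / γ) * M).toNNReal) (potential f φ γ ε ρ) := by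
  have hM0 := hM.nonneg
  refine LipschitzWith.of_dist_le_mul fun x y => ?_
  rw [Real.dist_eq, Real.coe_toNNReal _ (by positivity)]
  refine (hf.abs_regDensityDeriv_sub_le hγ (smoothed_nonneg hk x) (smoothed_nonneg hk y)).trans ?_
  rw [mul_assoc]
  refine mul_le_mul_of_nonneg_left ?_ (by positivity)
  have := (lipschitz_smoothed (ρ := ρ) hk hM).dist_le_mul x y
  rwa [Real.coe_toNNReal _ hM0, Real.dist_eq] at this

theorem abs_potential_le (hf : IsEnergyDensity d f) (hγ : 0 < γ) (hk : IsKernel (rescale φ ε))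
    (hM : IsKernelBound (rescale φ ε) M) (x : Space d) :
    |potential f φ γ ε ρ x| ≤ |regDensityDeriv f γ 0| + (γ + 1 / γ) * M := by
  have h := hf.abs_regDensityDeriv_sub_le hγ (smoothed_nonneg (ρ := ρ) hk x) le_rfl
  rw [sub_zero, abs_of_nonneg (smoothed_nonneg (ρ := ρ) hk x)] at h
  have h2 := abs_add_le (regDensityDeriv f γ (smoothed φ ε ρ x) - regDensityDeriv f γ 0)
    (regDensityDeriv f γ 0)
  rw [sub_add_cancel] at h2
  have h3 : (γ + 1 / γ) * smoothed φ ε ρ x ≤ (γ + 1 / γ) * M :=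
    mul_le_mul_of_nonneg_left (smoothed_le hM x) (by positivity)
  simp only [potential]
  linarith

/-- Cocoercivity of f_ε' is applied to difference quotients in each coordinate direction and summed.
Where q is not differentiable its gradient is 0 by convention, so nothing is to be shown there. -/
theorem sq_norm_gradient_potential_le (hf : IsEnergyDensity d f) (hγ : 0 < γ)
    (hk : IsKernel (rescale φ ε)) (hM : IsKernelBound (rescale φ ε) M) (x : Space d) :
    ‖gradient (potential f φ γ ε ρ) x‖ ^ 2
      ≤ (γ + 1 / γ) * ⟪gradient (potential f φ γ ε ρ) x, gradient (smoothed φ ε ρ) x⟫_ℝ := by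
  by_cases hd : DifferentiableAt ℝ (potential f φ γ ε ρ) x
  swap
  · have : gradient (potential f φ γ ε ρ) x = 0 := by
      simp [gradient, fderiv_zero_of_not_differentiableAt hd]
    simp [this]
  have hμ := (hasFDerivAt_smoothed (ρ := ρ) hk hM x).differentiableAt
  have key : ∀ v, fderiv ℝ (potential f φ γ ε ρ) x v ^ 2 ≤ (γ + 1 / γ) *
      (fderiv ℝ (potential f φ γ ε ρ) x v * fderiv ℝ (smoothed φ ε ρ) x v) := by
    intro v
    have h0 : HasDerivAt (fun s : ℝ => x + s • v) v 0 := by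
      simpa using ((hasDerivAt_id (0 : ℝ)).smul_const v).const_add x
    have h1 : HasDerivAt (fun s : ℝ => potential f φ γ ε ρ (x + s • v))
        (fderiv ℝ (potential f φ γ ε ρ) x v) 0 :=
      HasFDerivAt.comp_hasDerivAt_of_eq 0 hd.hasFDerivAt h0 (by simp)
    have h2 : HasDerivAt (fun s : ℝ => smoothed φ ε ρ (x + s • v))
        (fderiv ℝ (smoothed φ ε ρ) x v) 0 :=
      HasFDerivAt.comp_hasDerivAt_of_eq 0 hμ.hasFDerivAt h0 (by simp)
    have h1' := h1.tendsto_slope_zero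
    have h2' := h2.tendsto_slope_zero
    refine le_of_tendsto_of_tendsto (h1'.pow 2) ((h1'.mul h2').const_mul (γ + 1 / γ))
      (Eventually.of_forall fun s => ?_)
    simp only [zero_add, zero_smul, add_zero, smul_eq_mul]
    have h3 := hf.sq_regDensityDeriv_sub_le hγ (smoothed_nonneg (ρ := ρ) hk (x + s • v))
      (smoothed_nonneg (ρ := ρ) hk x)
    simp only [potential]
    calc _ = s⁻¹ ^ 2 * (regDensityDeriv f γ (smoothed φ ε ρ (x + s • v))
          - regDensityDeriv f γ (smoothed φ ε ρ x)) ^ 2 := by ring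
      _ ≤ s⁻¹ ^ 2 * ((γ + 1 / γ) * ((regDensityDeriv f γ (smoothed φ ε ρ (x + s • v))
          - regDensityDeriv f γ (smoothed φ ε ρ x))
          * (smoothed φ ε ρ (x + s • v) - smoothed φ ε ρ x))) := by gcongr
      _ = _ := by ring
  have hb := EuclideanSpace.basisFun (Fin d) ℝ
  rw [← real_inner_self_eq_norm_sq, ← hb.sum_inner_mul_inner, ← hb.sum_inner_mul_inner,
    Finset.mul_sum]
  refine Finset.sum_le_sum fun i _ => ?_
  have := key (hb i)
  rw [real_inner_comm (gradient (smoothed φ ε ρ) x) (hb i),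
    real_inner_comm (gradient (potential f φ γ ε ρ) x) (hb i), inner_gradient, inner_gradient]
  linarith

end Smoothed

end NonlocalDiffusion

end

noncomputable section

namespace NonlocalDiffusion

/-! ### The pressure and the dissipation identity -/

section Pressure

variable {d : ℕ} {f : ℝ → EReal} {φ : Space d → ℝ} {γ ε M : ℝ} {ρ : Measure (Space d)}

theorem measurable_gradient (g : Space d → ℝ) : Measurable (gradient g) :=
  (InnerProductSpace.toDual ℝ (Space d)).symm.continuous.measurable.comp (measurable_fderiv ℝ g)

theorem norm_gradient_le_of_lipschitz {g : Space d → ℝ} {ℓ : ℝ≥0} (hg : LipschitzWith ℓ g)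
    (x : Space d) : ‖gradient g x‖ ≤ ℓ := by
  rw [norm_gradient]
  exact norm_fderiv_le_of_lipschitz ℝ hg

theorem pressure_eq_conv : pressure f φ γ ε ρ = conv (potential f φ γ ε ρ) (rescale φ ε) := by
  funext x
  simp only [pressure, conv]
  rw [← integral_sub_left_eq_self _ volume x]
  refine integral_congr_ae (Eventually.of_forall fun z => ?_)
  simp [mul_comm]

theorem conv_gradient_inner {q k : Space d → ℝ} {B : ℝ} (hq : Continuous q)
    (hB : ∀ x, |q x| ≤ B) (hk : Integrable (gradient k)) (hk' : Integrable (fderiv ℝ k))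
    (x v : Space d) : ⟪conv q (gradient k) x, v⟫_ℝ = conv q (fderiv ℝ k) x v := by
  rw [conv, conv, ContinuousLinearMap.integral_apply (integrable_conv hq hB hk' x),
    real_inner_comm, ← integral_inner (integrable_conv hq hB hk x)]
  refine integral_congr_ae (Eventually.of_forall fun z => ?_)
  simp only [smul_apply, inner_smul_right, smul_eq_mul]
  rw [real_inner_comm, inner_gradient]

variable [IsProbabilityMeasure ρ]

theorem hasFDerivAt_pressure (hf : IsEnergyDensity d f) (hγ : 0 < γ)
    (hk : IsKernel (rescale φ ε)) (hM : IsKernelBound (rescale φ ε) M) (x : Space d) :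
    HasFDerivAt (pressure f φ γ ε ρ)
      (conv (potential f φ γ ε ρ) (fderiv ℝ (rescale φ ε)) x) x := by
  rw [pressure_eq_conv]
  exact hasFDerivAt_conv (lipschitz_potential hf hγ hk hM) (abs_potential_le hf hγ hk hM)
    hk.integrable (hk.contDiff.of_le (by norm_num)) hk.integrable_fderiv x

theorem gradient_pressure (hf : IsEnergyDensity d f) (hγ : 0 < γ)
    (hk : IsKernel (rescale φ ε)) (hM : IsKernelBound (rescale φ ε) M) :
    gradient (pressure f φ γ ε ρ) = conv (potential f φ γ ε ρ) (gradient (rescale φ ε)) := by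
  funext x
  refine ext_inner_right ℝ fun v => ?_
  rw [inner_gradient, (hasFDerivAt_pressure hf hγ hk hM x).fderiv,
    conv_gradient_inner (lipschitz_potential hf hγ hk hM).continuous
      (abs_potential_le hf hγ hk hM) hk.integrable_gradient hk.integrable_fderiv]

theorem hasFDerivAt_gradient_pressure (hf : IsEnergyDensity d f) (hγ : 0 < γ)
    (hk : IsKernel (rescale φ ε)) (hM : IsKernelBound (rescale φ ε) M) (x : Space d) :
    HasFDerivAt (gradient (pressure f φ γ ε ρ))
      (conv (potential f φ γ ε ρ) (fderiv ℝ (gradient (rescale φ ε))) x) x := by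
  rw [gradient_pressure hf hγ hk hM]
  exact hasFDerivAt_conv (lipschitz_potential hf hγ hk hM) (abs_potential_le hf hγ hk hM)
    hk.integrable_gradient (contDiff_gradient hk.contDiff) hk.integrable_fderiv_gradient x

/-- The form used in the commutator: ∇q is the almost everywhere gradient of a Lipschitz function,
and the kernel remains undifferentiated. -/
theorem gradient_pressure_eq_integral (hf : IsEnergyDensity d f) (hγ : 0 < γ)
    (hk : IsKernel (rescale φ ε)) (hM : IsKernelBound (rescale φ ε) M) (x : Space d) :
    gradient (pressure f φ γ ε ρ) x
      = ∫ y, rescale φ ε (x - y) • gradient (potential f φ γ ε ρ) y := by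
  have hql := lipschitz_potential (ρ := ρ) hf hγ hk hM
  have hi : Integrable fun y => rescale φ ε (x - y) • gradient (potential f φ γ ε ρ) y := by
    refine ((hk.integrable.comp_sub_left x).norm.mul_const
      (((γ + 1 / γ) * M).toNNReal : ℝ)).mono'
      (((hk.integrable.comp_sub_left x).aestronglyMeasurable).smul
        (measurable_gradient _).aestronglyMeasurable) (Eventually.of_forall fun y => ?_)
    rw [norm_smul]
    exact mul_le_mul_of_nonneg_left (norm_gradient_le_of_lipschitz hql _) (norm_nonneg _)
  refine ext_inner_right ℝ fun v => ?_
  rw [inner_gradient, (hasFDerivAt_pressure hf hγ hk hM x).fderiv,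
    conv_fderiv_apply hql (abs_potential_le hf hγ hk hM)
    hk.integrable (hk.contDiff.of_le (by norm_num)) hk.integrable_fderiv x, real_inner_comm,
    ← integral_inner hi, ← integral_sub_left_eq_self _ volume x]
  refine integral_congr_ae (Eventually.of_forall fun z => ?_)
  simp only [sub_sub_cancel, inner_smul_right, smul_eq_mul]
  rw [real_inner_comm, inner_gradient, mul_comm]

theorem gradient_smoothed (hk : IsKernel (rescale φ ε)) (hM : IsKernelBound (rescale φ ε) M)
    (x : Space d) : gradient (smoothed φ ε ρ) x = ∫ y, gradient (rescale φ ε) (x - y) ∂ρ := by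
  have hc := hk.continuous_gradient
  have hi : Integrable (fun y => gradient (rescale φ ε) (x - y)) ρ :=
    Integrable.of_bound (Continuous.aestronglyMeasurable (by fun_prop)) M
      (Eventually.of_forall fun y => (hM _).2.1)
  refine ext_inner_right ℝ fun v => ?_
  rw [inner_gradient, fderiv_smoothed_apply hk hM, real_inner_comm, ← integral_inner hi]
  refine integral_congr_ae (Eventually.of_forall fun z => ?_)
  simp only
  rw [real_inner_comm, inner_gradient]

theorem IsKernel.gradient_neg (hk : IsKernel (rescale φ ε)) (x : Space d) :
    gradient (rescale φ ε) (-x) = -gradient (rescale φ ε) x := by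
  simp only [gradient, hk.fderiv_neg, map_neg]

/-- Of the two derivatives in Δp, one stays on the kernel and the other is moved back to q, which
being Lipschitz can bear one. -/
theorem divOf_hessian_pressure (hf : IsEnergyDensity d f) (hγ : 0 < γ)
    (hk : IsKernel (rescale φ ε)) (hM : IsKernelBound (rescale φ ε) M) (x : Space d) :
    divOf (conv (potential f φ γ ε ρ) (fderiv ℝ (gradient (rescale φ ε))) x)
      = ∫ y, ⟪gradient (potential f φ γ ε ρ) y, gradient (rescale φ ε) (x - y)⟫_ℝ := by
  have hql := lipschitz_potential (ρ := ρ) hf hγ hk hM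
  set b := EuclideanSpace.basisFun (Fin d) ℝ
  have hi : ∀ v, Integrable fun z => (fderiv ℝ (potential f φ γ ε ρ) (x - z) v) •
      gradient (rescale φ ε) z := by
    intro v
    refine hk.integrable_gradient.bdd_smul (((γ + 1 / γ) * M).toNNReal * ‖v‖)
      (((measurable_fderiv_apply_const ℝ (potential f φ γ ε ρ) v).comp
        (measurable_const.sub measurable_id)).aestronglyMeasurable)
      (Eventually.of_forall fun z => ?_)
    refine (ContinuousLinearMap.le_opNorm _ _).trans ?_
    exact mul_le_mul_of_nonneg_right (norm_fderiv_le_of_lipschitz ℝ hql) (norm_nonneg _)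
  rw [divOf, LinearMap.trace_eq_sum_inner _ b]
  have h1 : ∀ i, ⟪b i, ((conv (potential f φ γ ε ρ) (fderiv ℝ (gradient (rescale φ ε))) x :
      Space d →L[ℝ] Space d) : Space d →ₗ[ℝ] Space d) (b i)⟫_ℝ = ∫ z, ⟪gradient (potential f φ γ ε ρ) (x - z), b i⟫_ℝ *
        ⟪b i, gradient (rescale φ ε) z⟫_ℝ := by
    intro i
    rw [ContinuousLinearMap.coe_coe, conv_fderiv_apply hql (abs_potential_le hf hγ hk hM)
      hk.integrable_gradient (contDiff_gradient hk.contDiff) hk.integrable_fderiv_gradient,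
      ← integral_inner (hi _)]
    refine integral_congr_ae (Eventually.of_forall fun z => ?_)
    simp only [inner_smul_right, inner_gradient]
  simp only [h1]
  rw [← integral_finsetSum, ← integral_sub_left_eq_self _ volume x]
  · refine integral_congr_ae (Eventually.of_forall fun z => ?_)
    simp only [sub_sub_cancel]
    rw [b.sum_inner_mul_inner]
  · intro i _
    refine ((hi (b i)).const_inner (b i)).congr (Eventually.of_forall fun z => ?_)
    simp only [inner_smul_right, inner_gradient]

/-- The dissipation identity `∫ Δp dρ = -∫ ∇q · ∇μ`. -/
theorem integral_divOf_hessian_pressure (hf : IsEnergyDensity d f) (hγ : 0 < γ)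
    (hk : IsKernel (rescale φ ε)) (hM : IsKernelBound (rescale φ ε) M) :
    ∫ x, divOf (conv (potential f φ γ ε ρ) (fderiv ℝ (gradient (rescale φ ε))) x) ∂ρ
      = -∫ y, ⟪gradient (potential f φ γ ε ρ) y, gradient (smoothed φ ε ρ) y⟫_ℝ := by
  have hql := lipschitz_potential (ρ := ρ) hf hγ hk hM
  have hc := hk.continuous_gradient
  have hi : Integrable (fun z : Space d × Space d => ⟪gradient (potential f φ γ ε ρ) z.2,
      gradient (rescale φ ε) (z.1 - z.2)⟫_ℝ) (ρ.prod volume) := by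
    refine ((integrable_comp_rsub_prod (ρ := ρ) hk.integrable_gradient).norm.const_mul
      (((γ + 1 / γ) * M).toNNReal : ℝ)).mono' ?_ (Eventually.of_forall fun z => ?_)
    · refine AEStronglyMeasurable.inner ?_ (Continuous.aestronglyMeasurable (by fun_prop))
      exact ((measurable_gradient _).comp measurable_snd).aestronglyMeasurable
    · refine (norm_inner_le_norm _ _).trans ?_
      exact mul_le_mul_of_nonneg_right (norm_gradient_le_of_lipschitz hql _) (norm_nonneg _)
  simp only [divOf_hessian_pressure hf hγ hk hM]
  rw [integral_integral_swap hi, ← integral_neg]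
  refine integral_congr_ae (Eventually.of_forall fun y => ?_)
  simp only
  have hi2 : Integrable (fun x => gradient (rescale φ ε) (x - y)) ρ :=
    Integrable.of_bound (Continuous.aestronglyMeasurable (by fun_prop)) M
      (Eventually.of_forall fun y => (hM _).2.1)
  rw [integral_inner hi2, gradient_smoothed hk hM, ← inner_neg_right, ← integral_neg]
  congr 2
  funext x
  -- The gradient of an even kernel is odd: this is the source of the minus sign.
  rw [← hk.gradient_neg, neg_sub]

/-! ### The regularized energy -/

/-- The regularized density vanishes at least linearly at 0, so that its composition with μ ∈ L¹ ∩
L^∞ is integrable. -/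
theorem IsEnergyDensity.abs_regDensity_le (hf : IsEnergyDensity d f) (hγ : 0 < γ) {a : ℝ}
    (ha : 0 ≤ a) :
    |regDensity f γ a| ≤ (|regDensityDeriv f γ 0| + (γ + 1 / γ) * a) * a := by
  have h := (convex_Icc (0 : ℝ) a).norm_image_sub_le_of_norm_hasDerivWithin_le
    (f := regDensity f γ) (f' := regDensityDeriv f γ)
    (C := |regDensityDeriv f γ 0| + (γ + 1 / γ) * a) (x := 0) (y := a)
    (fun x hx => (hf.hasDerivAt_regDensity' hγ hx.1).hasDerivWithinAt) (fun x hx => ?_)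
    (by simp [ha]) (by simp [ha])
  · simpa [regDensity_zero, abs_of_nonneg ha] using h
  · have h1 := hf.abs_regDensityDeriv_sub_le hγ hx.1 le_rfl
    rw [sub_zero, abs_of_nonneg hx.1] at h1
    have h2 := abs_add_le (regDensityDeriv f γ x - regDensityDeriv f γ 0) (regDensityDeriv f γ 0)
    rw [sub_add_cancel] at h2
    have h3 : (γ + 1 / γ) * x ≤ (γ + 1 / γ) * a :=
      mul_le_mul_of_nonneg_left hx.2 (by positivity)
    rw [Real.norm_eq_abs]
    linarith

theorem IsEnergyDensity.continuous_regDensity (hf : IsEnergyDensity d f) (hγ : 0 < γ) :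
    Continuous (regDensity f γ) :=
  continuous_iff_continuousAt.2 fun a => (hf.hasDerivAt_regDensity hγ a).continuousAt

theorem continuous_smoothed (hk : IsKernel (rescale φ ε)) (hM : IsKernelBound (rescale φ ε) M) :
    Continuous (smoothed φ ε ρ) := (lipschitz_smoothed hk hM).continuous

theorem integrable_regDensity_smoothed (hf : IsEnergyDensity d f) (hγ : 0 < γ)
    (hk : IsKernel (rescale φ ε)) (hM : IsKernelBound (rescale φ ε) M) :
    Integrable fun x => regDensity f γ (smoothed φ ε ρ x) := by
  refine ((integrable_smoothed (ρ := ρ) hk).const_mul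
    (|regDensityDeriv f γ 0| + (γ + 1 / γ) * M)).mono'
    ((hf.continuous_regDensity hγ).comp (continuous_smoothed hk hM)).aestronglyMeasurable
    (Eventually.of_forall fun x => ?_)
  have h0 := smoothed_nonneg (ρ := ρ) hk x
  refine (hf.abs_regDensity_le hγ h0).trans (mul_le_mul_of_nonneg_right ?_ h0)
  have := mul_le_mul_of_nonneg_left (smoothed_le (ρ := ρ) hM x) (show 0 ≤ γ + 1 / γ by positivity)
  linarith

theorem integrable_smoothed_sq (hk : IsKernel (rescale φ ε))
    (hM : IsKernelBound (rescale φ ε) M) : Integrable fun x => smoothed φ ε ρ x ^ 2 := by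
  refine ((integrable_smoothed (ρ := ρ) hk).const_mul M).mono'
    ((continuous_smoothed hk hM).pow 2).aestronglyMeasurable (Eventually.of_forall fun x => ?_)
  have h0 := smoothed_nonneg (ρ := ρ) hk x
  rw [Real.norm_of_nonneg (by positivity), sq]
  exact mul_le_mul_of_nonneg_right (smoothed_le hM x) h0

/-! ### Coercivity of the regularized energy -/

theorem eIntegral_le_integral {h : Space d → EReal} {G : Space d → ℝ} (hG : Integrable G)
    (hle : ∀ᵐ x, h x ≤ (G x : EReal)) : eIntegral h ≤ ((∫ x, G x : ℝ) : EReal) := by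
  have h1 : ∫⁻ x, (h x).toENNReal ≤ ∫⁻ x, ENNReal.ofReal (G x) :=
    lintegral_mono_ae (hle.mono fun x hx => EReal.toENNReal_le_toENNReal hx)
  have h2 : ∫⁻ x, ENNReal.ofReal (-(G x)) ≤ ∫⁻ x, (-(h x)).toENNReal := by
    refine lintegral_mono_ae (hle.mono fun x hx => ?_)
    have := EReal.toENNReal_le_toENNReal (EReal.neg_le_neg_iff.2 hx)
    rwa [← EReal.coe_neg, EReal.real_coe_toENNReal] at this
  have h3 : ∫⁻ x, ENNReal.ofReal (G x) ≠ ⊤ := hG.lintegral_lt_top.ne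
  have h4 : ∫⁻ x, ENNReal.ofReal (-(G x)) ≠ ⊤ := hG.neg.lintegral_lt_top.ne
  refine (EReal.sub_le_sub (EReal.coe_ennreal_le_coe_ennreal_iff.2 h1)
    (EReal.coe_ennreal_le_coe_ennreal_iff.2 h2)).trans ?_
  rw [integral_eq_lintegral_pos_part_sub_lintegral_neg_part hG, EReal.coe_sub,
    EReal.coe_ennreal_toReal h3, EReal.coe_ennreal_toReal h4]

theorem eIntegral_congr_ae {h g : Space d → EReal} (hle : ∀ᵐ x, h x = g x) :
    eIntegral h = eIntegral g := by
  simp only [eIntegral]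
  rw [lintegral_congr_ae (g := fun x => (g x).toENNReal) (hle.mono fun x hx => by simp only [hx]),
    lintegral_congr_ae (f := fun x => (-(h x)).toENNReal) (g := fun x => (-(g x)).toENNReal)
      (hle.mono fun x hx => by simp only [hx])]

/-- A nondecreasing concave H with H(0) = 0 satisfies H(s) ≤ H(1)(1 + s): by monotonicity for s ≤ 1,
and by concavity on [0, s] for s ≥ 1. The coercivity hypothesis thus becomes linear in the moment
and can enter a Gronwall argument. -/
theorem IsEnergyDensity.exists_linear_coercive (hf : IsEnergyDensity d f) :
    ∃ C : ℝ, 0 ≤ C ∧ ∀ u : Space d → ℝ, Measurable u → (∀ x, 0 ≤ u x) → Integrable u →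
      Integrable (fun x => ‖x‖ ^ 2 * u x) →
      ((-(C * (1 + ∫ x, (1 + ‖x‖ ^ 2) * u x) : ℝ)) : EReal) ≤ internalEnergy f u := by
  obtain ⟨H, hc, hm, h0, hp, hcoer⟩ := hf.coercive
  have hlin : ∀ s, 0 ≤ s → H s ≤ H 1 * (1 + s) := by
    intro s hs
    have h1 := hp 1 zero_le_one
    rcases le_total s 1 with h | h
    · have := hm hs (mem_Ici.2 zero_le_one) h
      nlinarith
    · have hs0 : 0 < s := by linarith
      have hinv : s⁻¹ ≤ 1 := inv_le_one_of_one_le₀ h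
      have := hc.2 (mem_Ici.2 le_rfl) (mem_Ici.2 hs) (show 0 ≤ 1 - s⁻¹ by linarith)
        (show 0 ≤ s⁻¹ by positivity) (by ring)
      simp only [smul_eq_mul, h0, mul_zero, zero_add] at this
      rw [inv_mul_cancel₀ hs0.ne', inv_mul_le_iff₀ hs0] at this
      nlinarith
  refine ⟨H 1, hp 1 zero_le_one, fun u hu hu0 hui hu2 => ?_⟩
  have hmu : Measurable fun x => ENNReal.ofReal (u x) := hu.ennreal_ofReal
  have hfin : IsFiniteMeasure (toMeasure u) := by
    constructor
    rw [toMeasure, withDensity_apply _ MeasurableSet.univ, Measure.restrict_univ]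
    exact hui.lintegral_lt_top
  have hsm : secondMoment (toMeasure u) < ⊤ := by
    rw [secondMoment, toMeasure, lintegral_withDensity_eq_lintegral_mul _ hmu
      (by fun_prop)]
    refine lt_of_le_of_lt (lintegral_mono fun x => ?_) hu2.lintegral_lt_top
    simp only [Pi.mul_apply]
    rw [mul_comm (‖x‖ ^ 2), ENNReal.ofReal_mul (hu0 x), ENNReal.ofReal_pow (norm_nonneg _),
      ofReal_norm]
  have h1 := hcoer (toMeasure u) hfin (withDensity_absolutelyContinuous _ _) hsm
  have hd : ∀ᵐ x, density (toMeasure u) x = u x := by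
    filter_upwards [Measure.rnDeriv_withDensity volume hmu] with x hx
    rw [density, toMeasure, hx, ENNReal.toReal_ofReal (hu0 x)]
  have h2 : internalEnergy f (density (toMeasure u)) = internalEnergy f u :=
    eIntegral_congr_ae (hd.mono fun x hx => by rw [hx])
  have h3 : ∫ x, (1 + ‖x‖ ^ 2) ∂(toMeasure u) = ∫ x, (1 + ‖x‖ ^ 2) * u x := by
    rw [toMeasure, integral_withDensity_eq_integral_toReal_smul hmu
      (Eventually.of_forall fun x => ENNReal.ofReal_lt_top)]
    refine integral_congr_ae (Eventually.of_forall fun x => ?_)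
    simp only [smul_eq_mul]
    rw [ENNReal.toReal_ofReal (hu0 x), mul_comm]
  rw [h2, h3] at h1
  refine le_trans (EReal.coe_le_coe_iff.2 (neg_le_neg (hlin _ ?_))) h1
  exact integral_nonneg fun x => mul_nonneg (by positivity) (hu0 x)

/-- After removal of the quadratic part of f_ε, the Moreau part dominates f evaluated at a density u
≤ μ, and coercivity applies to u. The moments of u are at most those of μ, hence at most twice those
of ρ and of the kernel; this doubling explains the constant. It depends on f alone and not on γ or
ε. -/
theorem exists_regEnergy_lower_bound (hf : IsEnergyDensity d f) :
    ∃ C : ℝ, 0 ≤ C ∧ ∀ (φ : Space d → ℝ) (γ ε M : ℝ) (ρ : Measure (Space d)),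
      IsProbabilityMeasure ρ → 0 < γ → IsKernel (rescale φ ε) →
      IsKernelBound (rescale φ ε) M → secondMoment ρ < ⊤ →
      γ / 2 * (∫ x, smoothed φ ε ρ x ^ 2) ≤ regEnergy f φ γ ε ρ
        + C * (1 + (∫ x, ‖x‖ ^ 2 ∂ρ) + ∫ x, ‖x‖ ^ 2 * rescale φ ε x) := by
  obtain ⟨C, hC, hco⟩ := hf.exists_linear_coercive
  refine ⟨2 * C, by positivity, fun φ γ ε M ρ hρ hγ hk hM h2 => ?_⟩
  set μ := smoothed φ ε ρ with hμ
  have hμ0 : ∀ x, 0 ≤ μ x := smoothed_nonneg hk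
  have hμc : Continuous μ := continuous_smoothed hk hM
  set u : Space d → ℝ := fun x => min (prox f γ (μ x)) (μ x) with hu
  have hum : Measurable u :=
    ((hf.prox_mono hγ).measurable.comp hμc.measurable).min hμc.measurable
  have hu0 : ∀ x, 0 ≤ u x := fun x => le_min (hf.prox_nonneg hγ _) (hμ0 x)
  have hule : ∀ x, u x ≤ μ x := fun x => min_le_right _ _
  have hμi : Integrable μ := integrable_smoothed hk
  have hμ2 : Integrable fun x => ‖x‖ ^ 2 * μ x := integrable_sq_smoothed hk h2
  have hui : Integrable u := hμi.mono' hum.aestronglyMeasurable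
    (Eventually.of_forall fun x => by rw [Real.norm_of_nonneg (hu0 x)]; exact hule x)
  have hu2 : Integrable fun x => ‖x‖ ^ 2 * u x := hμ2.mono'
    (Measurable.aestronglyMeasurable (by fun_prop)) (Eventually.of_forall fun x => by
      rw [Real.norm_of_nonneg (mul_nonneg (by positivity) (hu0 x))]
      exact mul_le_mul_of_nonneg_left (hule x) (by positivity))
  have h1 := hco u hum hu0 hui hu2
  have hsplit : ∀ x, regDensity f γ (μ x) - γ / 2 * μ x ^ 2 = moreau f γ (μ x) - moreau f γ 0 := by
    intro x; rw [regDensity]; ring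
  have hR := integrable_regDensity_smoothed (ρ := ρ) hf hγ hk hM
  have hS := (integrable_smoothed_sq (ρ := ρ) hk hM).const_mul (γ / 2)
  have hG : Integrable fun x => moreau f γ (μ x) - moreau f γ 0 :=
    (hR.sub hS).congr (Eventually.of_forall fun x => hsplit x)
  have h3 : internalEnergy f u ≤ ((∫ x, (moreau f γ (μ x) - moreau f γ 0) : ℝ) : EReal) :=
    eIntegral_le_integral hG (Eventually.of_forall fun x => hf.le_moreau_sub hγ (hμ0 x))
  have h4 := EReal.coe_le_coe_iff.1 (h1.trans h3)
  have h5 : ∫ x, (moreau f γ (μ x) - moreau f γ 0)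
      = regEnergy f φ γ ε ρ - γ / 2 * ∫ x, μ x ^ 2 := by
    rw [regEnergy, ← integral_const_mul, ← integral_sub hR hS]
    exact integral_congr_ae (Eventually.of_forall fun x => (hsplit x).symm)
  have h6 : ∫ x, (1 + ‖x‖ ^ 2) * u x
      ≤ 1 + (2 * (∫ x, ‖x‖ ^ 2 ∂ρ) + 2 * ∫ x, ‖x‖ ^ 2 * rescale φ ε x) := by
    calc ∫ x, (1 + ‖x‖ ^ 2) * u x ≤ ∫ x, (μ x + ‖x‖ ^ 2 * μ x) := by
          refine integral_mono ((hui.add hu2).congr (Eventually.of_forall fun x => ?_))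
            (hμi.add hμ2) fun x => ?_
          · simp only [Pi.add_apply]; ring
          · have := mul_le_mul_of_nonneg_left (hule x) (show (0:ℝ) ≤ 1 + ‖x‖ ^ 2 by positivity)
            simp only
            linarith
      _ ≤ _ := by
          rw [integral_add hμi hμ2, integral_smoothed hk]
          gcongr
          exact integral_sq_smoothed_le hk h2
  have h7 : C * (1 + ∫ x, (1 + ‖x‖ ^ 2) * u x) ≤ C * (1 + (1 + (2 * (∫ x, ‖x‖ ^ 2 ∂ρ)
      + 2 * ∫ x, ‖x‖ ^ 2 * rescale φ ε x))) := by gcongr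
  rw [h5] at h4
  linarith

end Pressure

end NonlocalDiffusion

end

noncomputable section

namespace NonlocalDiffusion

/-! ### Flows of bounded vector fields with bounded Lipschitz derivative -/

section Flow

variable {d : ℕ} {u : ℝ → Space d → Space d} {A : ℝ → Space d → Space d →L[ℝ] Space d}
  {M L K T : ℝ} {X : ℝ → Space d → Space d}

/-- A bounded vector field `u` with bounded Lipschitz space derivative `A`, both uniformly continuous
in time. -/
structure IsRegularField (u : ℝ → Space d → Space d) (A : ℝ → Space d → Space d →L[ℝ] Space d)
    (M L K : ℝ) : Prop where
  norm_le : ∀ t x, ‖u t x‖ ≤ M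
  hasFDerivAt : ∀ t x, HasFDerivAt (u t) (A t x) x
  fderiv_le : ∀ t x, ‖A t x‖ ≤ L
  fderiv_lip : ∀ t x y, ‖A t x - A t y‖ ≤ K * ‖x - y‖
  nonneg : 0 ≤ K
  time : ∀ η, 0 < η → ∃ τ, 0 < τ ∧ ∀ s t, |s - t| ≤ τ → ∀ x,
    ‖u s x - u t x‖ ≤ η ∧ ‖A s x - A t x‖ ≤ η

namespace IsRegularField

theorem M_nonneg (hu : IsRegularField u A M L K) : 0 ≤ M :=
  (norm_nonneg _).trans (hu.norm_le 0 0)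

theorem L_nonneg (hu : IsRegularField u A M L K) : 0 ≤ L :=
  (norm_nonneg _).trans (hu.fderiv_le 0 0)

theorem norm_sub_le (hu : IsRegularField u A M L K) (t : ℝ) (x y : Space d) :
    ‖u t x - u t y‖ ≤ L * ‖x - y‖ :=
  convex_univ.norm_image_sub_le_of_norm_hasFDerivWithin_le
    (fun z _ => (hu.hasFDerivAt t z).hasFDerivWithinAt) (fun z _ => hu.fderiv_le t z)
    (mem_univ y) (mem_univ x)

theorem uniform_time_continuous_of_norm {F : Type*} [NormedAddCommGroup F]
    {w : ℝ → Space d → F} {C : ℝ} (hC : 0 ≤ C)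
    (hx : ∀ t x y, ‖w t x - w t y‖ ≤ C * ‖x - y‖)
    (ht : ∀ η, 0 < η → ∃ τ, 0 < τ ∧ ∀ s t, |s - t| ≤ τ → ∀ x, ‖w s x - w t x‖ ≤ η) :
    Continuous fun z : ℝ × Space d => w z.1 z.2 := by
  rw [Metric.continuous_iff]
  rintro ⟨t, x⟩ η hη
  obtain ⟨τ, hτ, h⟩ := ht (η / 2) (by positivity)
  refine ⟨min τ (η / (2 * (C + 1))), by positivity, ?_⟩
  rintro ⟨s, y⟩ hz
  rw [Prod.dist_eq, max_lt_iff, Real.dist_eq, dist_eq_norm] at hz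
  simp only at hz
  obtain ⟨h1, h2⟩ := hz
  have h3 := h s t (h1.le.trans (min_le_left _ _)) y
  have h4 := hx t y x
  have h5 : C * ‖y - x‖ < η / 2 := by
    have h6 := h2.trans_le (min_le_right _ _)
    rw [lt_div_iff₀ (by positivity)] at h6
    nlinarith [norm_nonneg (y - x)]
  rw [dist_eq_norm]
  calc ‖w s y - w t x‖ = ‖(w s y - w t y) + (w t y - w t x)‖ := by rw [sub_add_sub_cancel]
    _ ≤ ‖w s y - w t y‖ + ‖w t y - w t x‖ := norm_add_le _ _
    _ < η := by linarith

theorem continuous_uncurry (hu : IsRegularField u A M L K) :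
    Continuous fun z : ℝ × Space d => u z.1 z.2 :=
  uniform_time_continuous_of_norm hu.L_nonneg hu.norm_sub_le fun η hη => by
    obtain ⟨τ, hτ, h⟩ := hu.time η hη
    exact ⟨τ, hτ, fun s t hst x => (h s t hst x).1⟩

theorem continuous_fderiv_uncurry (hu : IsRegularField u A M L K) :
    Continuous fun z : ℝ × Space d => A z.1 z.2 :=
  uniform_time_continuous_of_norm hu.nonneg hu.fderiv_lip fun η hη => by
    obtain ⟨τ, hτ, h⟩ := hu.time η hη
    exact ⟨τ, hτ, fun s t hst x => (h s t hst x).2⟩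

end IsRegularField

/-- Projection of times onto `[0,T]`. -/
def clamp (T t : ℝ) : ℝ := max 0 (min T t)

theorem clamp_mem (hT : 0 ≤ T) (t : ℝ) : clamp T t ∈ Icc 0 T :=
  ⟨le_max_left _ _, max_le hT (min_le_left _ _)⟩

theorem clamp_of_mem {t : ℝ} (ht : t ∈ Icc 0 T) : clamp T t = t := by
  rw [clamp, min_eq_right ht.2, max_eq_right ht.1]

theorem abs_clamp_sub_le (s t : ℝ) : |clamp T s - clamp T t| ≤ |s - t| := by
  rw [clamp, clamp, max_comm 0, max_comm 0]
  refine (abs_max_sub_max_le_abs _ _ _).trans ?_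
  rw [min_comm T, min_comm T]
  exact abs_min_sub_min_le_max s T t T |>.trans (by simp)

/-- `X` is the flow of `u` on `[0,T]`, constant in time outside this interval. -/
structure IsFlow (u : ℝ → Space d → Space d) (T : ℝ) (X : ℝ → Space d → Space d) : Prop where
  init : ∀ x, X 0 x = x
  deriv : ∀ x, ∀ t ∈ Icc 0 T, HasDerivWithinAt (fun s => X s x) (u t (X t x)) (Icc 0 T) t
  clamp : ∀ t x, X t x = X (clamp T t) x

/-- A field bounded by M keeps trajectories within distance MT of their starting point, so a single
application of Picard–Lindelöf on a ball of that radius covers the whole of [0,T]. -/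
theorem IsRegularField.exists_flow (hu : IsRegularField u A M L K) (hT : 0 ≤ T) :
    ∃ X, IsFlow u T X := by
  have h : ∀ x : Space d, ∃ α : ℝ → Space d, α 0 = x ∧
      ∀ t ∈ Icc 0 T, HasDerivWithinAt α (u t (α t)) (Icc 0 T) t := by
    intro x
    have hM := hu.M_nonneg
    have hp : IsPicardLindelof u (tmin := 0) (tmax := T) ⟨0, le_rfl, hT⟩ x (M * T).toNNReal 0
        M.toNNReal L.toNNReal := by
      refine ⟨fun t _ => ?_, fun y _ => ?_, fun t _ y _ => ?_, ?_⟩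
      · refine LipschitzWith.lipschitzOnWith (LipschitzWith.of_dist_le_mul fun a b => ?_)
        rw [dist_eq_norm, dist_eq_norm, Real.coe_toNNReal _ hu.L_nonneg]
        exact hu.norm_sub_le t a b
      · exact (hu.continuous_uncurry.comp (by fun_prop : Continuous fun t : ℝ => (t, y))).continuousOn
      · rw [Real.coe_toNNReal _ hM]; exact hu.norm_le t y
      · rw [Real.coe_toNNReal _ hM, Real.coe_toNNReal _ (by positivity)]
        simp [hT]
    exact hp.exists_eq_forall_mem_Icc_hasDerivWithinAt₀
  choose α h0 hα using h
  refine ⟨fun t x => α x (NonlocalDiffusion.clamp T t), ⟨fun x => ?_, fun x t ht => ?_,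
    fun t x => ?_⟩⟩
  · rw [clamp_of_mem ⟨le_rfl, hT⟩, h0]
  · rw [clamp_of_mem ht]
    exact (hα x t ht).congr (fun s hs => by rw [clamp_of_mem hs]) (by rw [clamp_of_mem ht])
  · rw [clamp_of_mem (clamp_mem hT t)]

namespace IsFlow

theorem norm_sub_le (hX : IsFlow u T X) (hu : IsRegularField u A M L K) {s t : ℝ}
    (hs : s ∈ Icc 0 T) (ht : t ∈ Icc 0 T) (x : Space d) : ‖X t x - X s x‖ ≤ M * |t - s| :=
  (convex_Icc 0 T).norm_image_sub_le_of_norm_hasDerivWithin_le (hX.deriv x)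
    (fun _ _ => hu.norm_le _ _) hs ht

theorem norm_sub_le' (hX : IsFlow u T X) (hu : IsRegularField u A M L K) (hT : 0 ≤ T) (s t : ℝ)
    (x : Space d) : ‖X t x - X s x‖ ≤ M * |t - s| := by
  rw [hX.clamp t, hX.clamp s]
  exact (hX.norm_sub_le hu (clamp_mem hT s) (clamp_mem hT t) x).trans
    (mul_le_mul_of_nonneg_left (abs_clamp_sub_le _ _) hu.M_nonneg)

/-- Subtracting the straight line with the initial velocity leaves a curve whose speed is at most η
(change of the field in time) plus LMh (change along the trajectory). -/
theorem step_error (hX : IsFlow u T X) (hu : IsRegularField u A M L K) {s h η : ℝ} (hs : 0 ≤ s)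
    (hh : 0 ≤ h) (hsh : s + h ≤ T) (hη : ∀ t, |t - s| ≤ h → ∀ x, ‖u t x - u s x‖ ≤ η)
    (x : Space d) : ‖X (s + h) x - X s x - h • u s (X s x)‖ ≤ h * (η + L * M * h) := by
  have hsub : Icc s (s + h) ⊆ Icc 0 T := Icc_subset_Icc hs hsh
  have hd : ∀ t ∈ Icc s (s + h), HasDerivWithinAt (fun t => X t x - t • u s (X s x))
      (u t (X t x) - u s (X s x)) (Icc s (s + h)) t := by
    intro t ht
    have := ((hX.deriv x t (hsub ht)).mono hsub).sub
      ((hasDerivWithinAt_id t (Icc s (s + h))).smul_const (u s (X s x)))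
    rw [one_smul] at this
    exact this
  have hL := hu.L_nonneg
  have hM := hu.M_nonneg
  have := (convex_Icc s (s + h)).norm_image_sub_le_of_norm_hasDerivWithin_le hd
    (C := η + L * M * h) (fun t ht => ?_) (left_mem_Icc.2 (by linarith))
    (right_mem_Icc.2 (by linarith))
  · rw [add_sub_cancel_left, Real.norm_of_nonneg hh] at this
    calc _ = ‖X (s + h) x - (s + h) • u s (X s x) - (X s x - s • u s (X s x))‖ := by
          congr 1; rw [add_smul]; abel
      _ ≤ _ := by rw [mul_comm h]; exact this
  · have h1 : |t - s| ≤ h := by rw [abs_of_nonneg (by linarith [ht.1])]; linarith [ht.2]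
    have h2 := hη t h1 (X t x)
    have h3 := hu.norm_sub_le s (X t x) (X s x)
    have h4 := hX.norm_sub_le hu (hsub (left_mem_Icc.2 (by linarith))) (hsub ht) x
    have h5 : L * ‖X t x - X s x‖ ≤ L * (M * h) := by gcongr; exact h4.trans (by gcongr)
    calc _ = ‖(u t (X t x) - u s (X t x)) + (u s (X t x) - u s (X s x))‖ := by
          rw [sub_add_sub_cancel]
      _ ≤ _ := norm_add_le _ _
      _ ≤ _ := by linarith

end IsFlow

/-- The `k`-th iterate of the explicit Euler scheme with step `h`. -/
def euler (u : ℝ → Space d → Space d) (h : ℝ) : ℕ → Space d → Space d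
  | 0, x => x
  | k + 1, x => euler u h k x + h • u (k * h) (euler u h k x)

/-! ### Convergence of the Euler scheme and two-sided Lipschitz bounds -/

theorem one_add_pow_le_exp {a : ℝ} (ha : 0 ≤ a) (k : ℕ) : (1 + a) ^ k ≤ Real.exp (k * a) := by
  rw [Real.exp_nat_mul]
  gcongr
  rw [add_comm]
  exact Real.add_one_le_exp a

/-- Discrete Gronwall: every step adds the local error h(η + LMh) and amplifies the previous error
by at most 1 + hL. -/
theorem IsFlow.euler_error (hX : IsFlow u T X) (hu : IsRegularField u A M L K) {h η : ℝ}
    (hh : 0 ≤ h) (hη0 : 0 ≤ η) (hη : ∀ s t, |s - t| ≤ h → ∀ x, ‖u s x - u t x‖ ≤ η) (k : ℕ)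
    (hk : k * h ≤ T) (x : Space d) :
    ‖euler u h k x - X (k * h) x‖ ≤ T * (η + L * M * h) * Real.exp (T * L) := by
  have hL := hu.L_nonneg
  have hM := hu.M_nonneg
  have key : ∀ k : ℕ, k * h ≤ T →
      ‖euler u h k x - X (k * h) x‖ ≤ k * h * (η + L * M * h) * (1 + h * L) ^ k := by
    intro k
    induction k with
    | zero => intro _; simp [euler, hX.init]
    | succ k ih =>
      intro hk
      push_cast at hk
      have hk' : (k : ℝ) * h ≤ T := by linarith
      have ih := ih hk'
      have hkh : 0 ≤ (k : ℝ) * h := by positivity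
      have h1 := hX.step_error hu hkh hh (by linarith)
        (fun t ht y => hη t (k * h) ht y) x
      have h2 := hu.norm_sub_le (k * h) (euler u h k x) (X (k * h) x)
      have e : ((k + 1 : ℕ) : ℝ) * h = k * h + h := by push_cast; ring
      rw [e, euler]
      set Y := euler u h k x
      set Z := X (k * h) x
      have e2 : Y + h • u (k * h) Y - X (k * h + h) x
        = (Y - Z) + h • (u (k * h) Y - u (k * h) Z) - (X (k * h + h) x - Z - h • u (k * h) Z) := by
        rw [smul_sub]; abel
      have h3 : ‖Y + h • u (k * h) Y - X (k * h + h) x‖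
          ≤ (1 + h * L) * ‖Y - Z‖ + h * (η + L * M * h) := by
        rw [e2]
        refine (_root_.norm_sub_le _ _).trans (add_le_add ((norm_add_le _ _).trans ?_) h1)
        rw [norm_smul, Real.norm_of_nonneg hh]
        nlinarith
      have h4 : (1 : ℝ) ≤ (1 + h * L) ^ (k + 1) := one_le_pow₀ (by nlinarith)
      have h5 : 0 ≤ h * (η + L * M * h) := by positivity
      have h6 : (1 + h * L) * ‖Y - Z‖ ≤ (1 + h * L) * (k * h * (η + L * M * h) * (1 + h * L) ^ k) :=
        mul_le_mul_of_nonneg_left ih (by positivity)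
      calc _ ≤ _ := h3
        _ ≤ (1 + h * L) * (k * h * (η + L * M * h) * (1 + h * L) ^ k)
            + h * (η + L * M * h) * (1 + h * L) ^ (k + 1) := by nlinarith
        _ = _ := by ring
  refine (key k hk).trans ?_
  have hT : 0 ≤ T := le_trans (by positivity) hk
  have h1 := one_add_pow_le_exp (show 0 ≤ h * L by positivity) k
  have h2 : Real.exp (k * (h * L)) ≤ Real.exp (T * L) := by
    apply Real.exp_le_exp.2
    rw [← mul_assoc]
    gcongr
  gcongr
  exact h1.trans h2

theorem IsRegularField.euler_lipschitz (hu : IsRegularField u A M L K) {h : ℝ} (hh : 0 ≤ h)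
    (k : ℕ) (x y : Space d) :
    ‖euler u h k x - euler u h k y‖ ≤ (1 + h * L) ^ k * ‖x - y‖ := by
  have hL := hu.L_nonneg
  induction k with
  | zero => simp [euler]
  | succ k ih =>
    have h1 := hu.norm_sub_le (k * h) (euler u h k x) (euler u h k y)
    simp only [euler]
    set Y := euler u h k x
    set Z := euler u h k y
    calc ‖Y + h • u (k * h) Y - (Z + h • u (k * h) Z)‖
        = ‖(Y - Z) + h • (u (k * h) Y - u (k * h) Z)‖ := by rw [smul_sub]; congr 1; abel
      _ ≤ ‖Y - Z‖ + h * ‖u (k * h) Y - u (k * h) Z‖ := by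
          refine (norm_add_le _ _).trans ?_
          rw [norm_smul, Real.norm_of_nonneg hh]
      _ ≤ (1 + h * L) * ‖Y - Z‖ := by nlinarith
      _ ≤ (1 + h * L) * ((1 + h * L) ^ k * ‖x - y‖) := by gcongr
      _ = _ := by ring

/-- One step shrinks distances at most by the factor 1 − hL. It makes the Euler maps injective for
small h, and in the limit bounds the flow from below by exp(−tL). -/
theorem IsRegularField.euler_antilipschitz (hu : IsRegularField u A M L K) {h : ℝ} (hh : 0 ≤ h)
    (hhL : h * L ≤ 1) (k : ℕ) (x y : Space d) :
    (1 - h * L) ^ k * ‖x - y‖ ≤ ‖euler u h k x - euler u h k y‖ := by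
  have hL := hu.L_nonneg
  induction k with
  | zero => simp [euler]
  | succ k ih =>
    have h1 := hu.norm_sub_le (k * h) (euler u h k x) (euler u h k y)
    simp only [euler]
    set Y := euler u h k x
    set Z := euler u h k y
    have h2 : ‖Y - Z‖ ≤ ‖Y + h • u (k * h) Y - (Z + h • u (k * h) Z)‖
        + h * ‖u (k * h) Y - u (k * h) Z‖ := by
      have e : Y - Z = (Y + h • u (k * h) Y - (Z + h • u (k * h) Z))
        - h • (u (k * h) Y - u (k * h) Z) := by rw [smul_sub]; abel
      have h3 := _root_.norm_sub_le (Y + h • u (k * h) Y - (Z + h • u (k * h) Z))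
        (h • (u (k * h) Y - u (k * h) Z))
      rw [← e, norm_smul, Real.norm_of_nonneg hh] at h3
      exact h3
    calc (1 - h * L) ^ (k + 1) * ‖x - y‖ = (1 - h * L) * ((1 - h * L) ^ k * ‖x - y‖) := by ring
      _ ≤ (1 - h * L) * ‖Y - Z‖ := mul_le_mul_of_nonneg_left ih (by linarith)
      _ ≤ _ := by nlinarith

/-- The Euler scheme with `n` steps on `[0,t]` converges to the flow. -/
theorem IsFlow.tendsto_euler (hX : IsFlow u T X) (hu : IsRegularField u A M L K) {t : ℝ}
    (ht : t ∈ Icc 0 T) {e : ℝ} (he : 0 < e) : ∀ᶠ n : ℕ in atTop, 0 < n ∧ ∀ k ≤ n, ∀ x,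
      ‖euler u (t / n) k x - X (k * (t / n)) x‖ ≤ e := by
  have hL := hu.L_nonneg
  have hM := hu.M_nonneg
  have hT : 0 ≤ T := ht.1.trans ht.2
  set D := T * Real.exp (T * L) + 1 with hD
  have hD0 : 0 < D := by positivity
  obtain ⟨τ, hτ, hmod⟩ := hu.time (e / (2 * D)) (by positivity)
  have hlim : Tendsto (fun n : ℕ => t / (n : ℝ)) atTop (𝓝 0) :=
    tendsto_const_div_atTop_nhds_zero_nat t
  have h1 := hlim.eventually (Iio_mem_nhds hτ)
  have h2 : ∀ᶠ n : ℕ in atTop, L * M * (t / n) < e / (2 * D) := by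
    have := (hlim.const_mul (L * M))
    rw [mul_zero] at this
    exact this.eventually (Iio_mem_nhds (by positivity))
  filter_upwards [h1, h2, eventually_gt_atTop 0] with n hn1 hn2 hn3
  refine ⟨hn3, fun k hk x => ?_⟩
  have hn0 : (0 : ℝ) < n := by exact_mod_cast hn3
  have hh : 0 ≤ t / n := div_nonneg ht.1 hn0.le
  have hkT : (k : ℝ) * (t / n) ≤ T := by
    calc (k : ℝ) * (t / n) ≤ n * (t / n) := by gcongr
      _ = t := by field_simp
      _ ≤ T := ht.2
  refine (hX.euler_error hu hh (η := e / (2 * D)) (by positivity)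
    (fun s s' hss y => (hmod s s' (hss.trans hn1.le) y).1) k hkT x).trans ?_
  calc T * (e / (2 * D) + L * M * (t / n)) * Real.exp (T * L)
      ≤ T * (e / (2 * D) + e / (2 * D)) * Real.exp (T * L) := by gcongr
    _ = (T * Real.exp (T * L)) * (e / D) := by field_simp; ring
    _ ≤ D * (e / D) := by gcongr; linarith
    _ = e := by field_simp

theorem IsFlow.tendsto_euler_end (hX : IsFlow u T X) (hu : IsRegularField u A M L K) {t : ℝ}
    (ht : t ∈ Icc 0 T) (x : Space d) :
    Tendsto (fun n : ℕ => euler u (t / n) n x) atTop (𝓝 (X t x)) := by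
  rw [Metric.tendsto_atTop']
  intro e he
  obtain ⟨N, hN⟩ := eventually_atTop.1 (hX.tendsto_euler hu ht (half_pos he))
  refine ⟨N, fun n hn => ?_⟩
  obtain ⟨h0, h1⟩ := hN n hn.le
  have h2 := h1 n le_rfl x
  have hn0 : (n : ℝ) ≠ 0 := by exact_mod_cast h0.ne'
  rw [mul_div_cancel₀ _ hn0] at h2
  rw [dist_eq_norm]
  linarith

theorem IsFlow.lipschitz (hX : IsFlow u T X) (hu : IsRegularField u A M L K) {t : ℝ}
    (ht : t ∈ Icc 0 T) (x y : Space d) : ‖X t x - X t y‖ ≤ Real.exp (t * L) * ‖x - y‖ := by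
  have hL := hu.L_nonneg
  refine le_of_tendsto ((hX.tendsto_euler_end hu ht x).sub (hX.tendsto_euler_end hu ht y)).norm ?_
  filter_upwards [eventually_gt_atTop 0] with n hn
  have hn0 : (0 : ℝ) < n := by exact_mod_cast hn
  have hh : 0 ≤ t / n := div_nonneg ht.1 hn0.le
  refine (hu.euler_lipschitz hh n x y).trans ?_
  gcongr
  refine (one_add_pow_le_exp (by positivity) n).trans (le_of_eq ?_)
  congr 1
  field_simp

theorem IsFlow.antilipschitz (hX : IsFlow u T X) (hu : IsRegularField u A M L K) {t : ℝ}
    (ht : t ∈ Icc 0 T) (x y : Space d) : Real.exp (-(t * L)) * ‖x - y‖ ≤ ‖X t x - X t y‖ := by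
  have hL := hu.L_nonneg
  have h1 := ((hX.tendsto_euler_end hu ht x).sub (hX.tendsto_euler_end hu ht y)).norm
  have h2 := (Real.tendsto_one_add_div_pow_exp (-(t * L))).mul_const ‖x - y‖
  refine le_of_tendsto_of_tendsto h2 h1 ?_
  obtain ⟨N, hN⟩ := exists_nat_gt (t * L)
  filter_upwards [eventually_gt_atTop 0, eventually_ge_atTop N] with n hn hn2
  have hn0 : (0 : ℝ) < n := by exact_mod_cast hn
  have hh : 0 ≤ t / n := div_nonneg ht.1 hn0.le
  have hle : t / n * L ≤ 1 := by
    rw [div_mul_eq_mul_div, div_le_one hn0]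
    exact hN.le.trans (by exact_mod_cast hn2)
  have := hu.euler_antilipschitz hh hle n x y
  rwa [show 1 + -(t * L) / n = 1 - t / n * L by ring]

theorem IsFlow.continuous_uncurry (hX : IsFlow u T X) (hu : IsRegularField u A M L K)
    (hT : 0 ≤ T) : Continuous fun z : ℝ × Space d => X z.1 z.2 := by
  have hL := hu.L_nonneg
  have hM := hu.M_nonneg
  refine IsRegularField.uniform_time_continuous_of_norm (C := Real.exp (T * L)) (by positivity)
    (fun t x y => ?_) fun η hη => ⟨η / (M + 1), by positivity, fun s t hst x => ?_⟩
  · rw [hX.clamp t x, hX.clamp t y]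
    have ht := clamp_mem hT t
    refine (hX.lipschitz hu ht x y).trans ?_
    gcongr
    exact ht.2
  · refine (hX.norm_sub_le' hu hT t s x).trans ?_
    calc M * |s - t| ≤ (M + 1) * (η / (M + 1)) := by gcongr; linarith
      _ = η := by field_simp

theorem IsFlow.continuous (hX : IsFlow u T X) (hu : IsRegularField u A M L K) (hT : 0 ≤ T)
    (t : ℝ) : Continuous (X t) :=
  (hX.continuous_uncurry hu hT).comp (by fun_prop : Continuous fun x : Space d => (t, x))

/-- A null set has null preimage under the flow. -/
theorem IsFlow.volume_preimage_eq_zero (hX : IsFlow u T X) (hu : IsRegularField u A M L K)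
    {t : ℝ} (ht : t ∈ Icc 0 T) {s : Set (Space d)} (hs : volume s = 0) :
    volume (X t ⁻¹' s) = 0 := by
  -- An anti-Lipschitz map pulls back sets of zero d-dimensional Hausdorff measure to such sets, and
  -- this measure is a Haar measure, so it has the null sets of Lebesgue measure. No Jacobian of the
  -- flow is needed.
  have hanti : AntilipschitzWith (Real.exp (t * L)).toNNReal (X t) := by
    refine AntilipschitzWith.of_le_mul_dist fun x y => ?_
    rw [dist_eq_norm, dist_eq_norm, Real.coe_toNNReal _ (Real.exp_pos _).le]
    have h := hX.antilipschitz hu ht x y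
    rw [Real.exp_neg, inv_mul_le_iff₀ (Real.exp_pos _)] at h
    exact h
  have h1 := hanti.hausdorffMeasure_preimage_le (d := d) (Nat.cast_nonneg d) s
  have h2 : (volume : Measure (Space d)) ≪ Measure.hausdorffMeasure d := by
    have := isAddHaarMeasure_hausdorffMeasure (E := Space d)
    rw [finrank_euclideanSpace, Fintype.card_fin] at this
    exact Measure.absolutelyContinuous_isAddHaarMeasure _ _
  have h3 : Measure.hausdorffMeasure (d : ℝ) s = 0 := by
    have := isAddHaarMeasure_hausdorffMeasure (E := Space d)
    rw [finrank_euclideanSpace, Fintype.card_fin] at this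
    exact (Measure.absolutelyContinuous_isAddHaarMeasure _ volume : _ ≪ volume) hs
  rw [h3, mul_zero, nonpos_iff_eq_zero] at h1
  exact h2 h1

end Flow

end NonlocalDiffusion

end

noncomputable section

namespace NonlocalDiffusion

/-! ### Representation of weak solutions of the continuity equation by the flow -/

section Representation

variable {d : ℕ} {u : ℝ → Space d → Space d} {A : ℝ → Space d → Space d →L[ℝ] Space d}
  {M L K T : ℝ} {X : ℝ → Space d → Space d} {ρ : ℝ → Measure (Space d)}

/-- A curve of probability measures, uniformly continuous in time against Lipschitz functions,
solving the continuity equation with velocity `u` on `[0,T]`. -/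
structure IsWeakCurve (u : ℝ → Space d → Space d) (T : ℝ) (ρ : ℝ → Measure (Space d)) : Prop where
  prob : ∀ t, IsProbabilityMeasure (ρ t)
  weak : ∀ ψ : Space d → ℝ, ContDiff ℝ 1 ψ → (∃ B, ∀ x, |ψ x| ≤ B) →
    (∃ B, ∀ x, ‖fderiv ℝ ψ x‖ ≤ B) → ∀ s t, 0 ≤ s → s ≤ t → t ≤ T →
    ∫ x, ψ x ∂ρ t - ∫ x, ψ x ∂ρ s = ∫ τ in s..t, ∫ x, fderiv ℝ ψ x (u τ x) ∂ρ τ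
  time : ∀ η, 0 < η → ∃ τ, 0 < τ ∧ ∀ s t, |s - t| ≤ τ → ∀ (g : Space d → ℝ) (l : ℝ≥0),
    LipschitzWith l g → (∃ B, ∀ x, |g x| ≤ B) → |∫ x, g x ∂ρ s - ∫ x, g x ∂ρ t| ≤ l * η

/-- Bounded test functions with derivative bounded by `a` and `a`-Lipschitz. -/
structure IsTest (a : ℝ) (ψ : Space d → ℝ) : Prop where
  contDiff : ContDiff ℝ 1 ψ
  bdd : ∃ B, ∀ x, |ψ x| ≤ B
  fderiv_le : ∀ x, ‖fderiv ℝ ψ x‖ ≤ a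
  fderiv_lip : ∀ x y, ‖fderiv ℝ ψ x - fderiv ℝ ψ y‖ ≤ a * ‖x - y‖

namespace IsTest

variable {a : ℝ} {ψ : Space d → ℝ}

theorem nonneg (h : IsTest a ψ) : 0 ≤ a := (norm_nonneg _).trans (h.fderiv_le 0)

theorem differentiable (h : IsTest a ψ) : Differentiable ℝ ψ :=
  h.contDiff.differentiable (by norm_num)

theorem continuous_fderiv (h : IsTest a ψ) : Continuous (fderiv ℝ ψ) :=
  h.contDiff.continuous_fderiv (by norm_num)

theorem lipschitz (h : IsTest a ψ) : LipschitzWith a.toNNReal ψ := by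
  refine lipschitzWith_of_nnnorm_fderiv_le h.differentiable fun x => ?_
  rw [← NNReal.coe_le_coe, Real.coe_toNNReal _ h.nonneg]
  exact h.fderiv_le x

theorem taylor (h : IsTest a ψ) (x v : Space d) :
    |ψ (x + v) - ψ x - fderiv ℝ ψ x v| ≤ a * ‖v‖ ^ 2 := by
  have h1 := (convex_segment x (x + v)).norm_image_sub_le_of_norm_hasFDerivWithin_le'
    (f := ψ) (f' := fderiv ℝ ψ) (φ := fderiv ℝ ψ x) (C := a * ‖v‖)
    (fun y _ => (h.differentiable y).hasFDerivAt.hasFDerivWithinAt) (fun y hy => ?_)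
    (left_mem_segment ℝ _ _) (right_mem_segment ℝ _ _)
  · rw [add_sub_cancel_left, Real.norm_eq_abs] at h1
    calc _ ≤ _ := h1
      _ = _ := by ring
  · refine (h.fderiv_lip y x).trans (mul_le_mul_of_nonneg_left ?_ h.nonneg)
    have := norm_sub_le_of_mem_segment hy
    simpa using this

/-- Test functions are stable under one Euler step, and their constant grows only by a factor 1 +
O(η), which survives iteration. The rate collects (1 + ηL)² ≤ 1 + η(2L + L²), valid for η ≤ 1, and
ηK from the variation of the derivative of the step. -/
theorem comp_step (h : IsTest a ψ) (hu : IsRegularField u A M L K) {s η : ℝ} (hη : 0 ≤ η)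
    (hη1 : η ≤ 1) :
    IsTest (a * (1 + η * (2 * L + L ^ 2 + K))) (fun x => ψ (x + η • u s x)) := by
  have hL := hu.L_nonneg
  have hK := hu.nonneg
  have ha := h.nonneg
  set S : Space d → Space d := fun x => x + η • u s x with hS
  set D : Space d → Space d →L[ℝ] Space d := fun x => ContinuousLinearMap.id ℝ _ + η • A s x
    with hD
  have hSd : ∀ x, HasFDerivAt S (D x) x := fun x =>
    (hasFDerivAt_id x).add ((hu.hasFDerivAt s x).const_smul η)
  have hDn : ∀ x, ‖D x‖ ≤ 1 + η * L := fun x => by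
    refine (norm_add_le _ _).trans (add_le_add ContinuousLinearMap.norm_id_le ?_)
    rw [norm_smul, Real.norm_of_nonneg hη]
    exact mul_le_mul_of_nonneg_left (hu.fderiv_le s x) hη
  have hcd : ∀ x, HasFDerivAt (fun x => ψ (S x)) ((fderiv ℝ ψ (S x)) ∘L (D x)) x := fun x =>
    (h.differentiable (S x)).hasFDerivAt.comp x (hSd x)
  have hfd : ∀ x, fderiv ℝ (fun x => ψ (S x)) x = (fderiv ℝ ψ (S x)) ∘L (D x) :=
    fun x => (hcd x).fderiv
  have hAc : Continuous (A s) :=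
    hu.continuous_fderiv_uncurry.comp (by fun_prop : Continuous fun x : Space d => (s, x))
  have hDc : Continuous D := continuous_const.add (hAc.const_smul η)
  have hSc : Continuous S := continuous_iff_continuousAt.2 fun x => (hSd x).continuousAt
  have hSl : ∀ x y, ‖S x - S y‖ ≤ (1 + η * L) * ‖x - y‖ := fun x y => by
    have e : S x - S y = (x - y) + η • (u s x - u s y) := by
      simp only [hS]; rw [smul_sub]; abel
    rw [e]
    refine (norm_add_le _ _).trans ?_
    rw [norm_smul, Real.norm_of_nonneg hη]
    have := mul_le_mul_of_nonneg_left (hu.norm_sub_le s x y) hη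
    linarith
  have hηL : η ^ 2 * L ^ 2 ≤ η * L ^ 2 := by
    have : η ^ 2 ≤ η := by nlinarith
    exact mul_le_mul_of_nonneg_right this (by positivity)
  refine ⟨?_, ?_, fun x => ?_, fun x y => ?_⟩
  · refine contDiff_one_iff_fderiv.2 ⟨fun x => (hcd x).differentiableAt, ?_⟩
    have : fderiv ℝ (fun x => ψ (S x)) = fun x => (fderiv ℝ ψ (S x)) ∘L (D x) := funext hfd
    rw [this]
    exact (h.continuous_fderiv.comp hSc).clm_comp hDc
  · obtain ⟨B, hB⟩ := h.bdd
    exact ⟨B, fun x => hB _⟩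
  · rw [hfd]
    refine (ContinuousLinearMap.opNorm_comp_le _ _).trans ?_
    refine (mul_le_mul (h.fderiv_le _) (hDn x) (norm_nonneg _) ha).trans ?_
    refine mul_le_mul_of_nonneg_left ?_ ha
    nlinarith [sq_nonneg L, mul_nonneg hη hL, mul_nonneg hη hK, mul_nonneg hη (sq_nonneg L)]
  · rw [hfd, hfd]
    have e : (fderiv ℝ ψ (S x)) ∘L (D x) - (fderiv ℝ ψ (S y)) ∘L (D y)
      = (fderiv ℝ ψ (S x) - fderiv ℝ ψ (S y)) ∘L (D x)
        + (fderiv ℝ ψ (S y)) ∘L (η • (A s x - A s y)) := by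
      ext v
      simp [hD, smul_sub]
      ring
    rw [e]
    have h1 : ‖(fderiv ℝ ψ (S x) - fderiv ℝ ψ (S y)) ∘L (D x)‖
        ≤ (a * ((1 + η * L) * ‖x - y‖)) * (1 + η * L) := by
      refine (ContinuousLinearMap.opNorm_comp_le _ _).trans ?_
      refine mul_le_mul ((h.fderiv_lip _ _).trans ?_) (hDn x) (norm_nonneg _) (by positivity)
      exact mul_le_mul_of_nonneg_left (hSl x y) ha
    have h2 : ‖(fderiv ℝ ψ (S y)) ∘L (η • (A s x - A s y))‖ ≤ a * (η * (K * ‖x - y‖)) := by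
      refine (ContinuousLinearMap.opNorm_comp_le _ _).trans ?_
      rw [norm_smul, Real.norm_of_nonneg hη]
      exact mul_le_mul (h.fderiv_le _) (mul_le_mul_of_nonneg_left (hu.fderiv_lip s x y) hη)
        (by positivity) ha
    refine (norm_add_le _ _).trans ((add_le_add h1 h2).trans ?_)
    have h3 : 0 ≤ a * ‖x - y‖ := by positivity
    calc _ = (a * ‖x - y‖) * (1 + 2 * (η * L) + η ^ 2 * L ^ 2 + η * K) := by ring
      _ ≤ (a * ‖x - y‖) * (1 + η * (2 * L + L ^ 2 + K)) := by
          refine mul_le_mul_of_nonneg_left ?_ h3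
          linarith
      _ = _ := by ring

end IsTest

theorem IsRegularField.continuous_field (hu : IsRegularField u A M L K) (t : ℝ) :
    Continuous (u t) :=
  hu.continuous_uncurry.comp (by fun_prop : Continuous fun x : Space d => (t, x))

theorem IsRegularField.continuous_euler (hu : IsRegularField u A M L K) (h : ℝ) (n : ℕ) :
    Continuous (euler u h n) := by
  induction n with
  | zero => exact continuous_id
  | succ n ih =>
    have h1 : Continuous fun x => u (n * h) (euler u h n x) := (hu.continuous_field _).comp ih
    exact ih.add (h1.const_smul h)

/-- The pairing of the derivative of a test function with the flux is almost constant in time. -/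
theorem pairing_close (hρ : ∀ t, IsProbabilityMeasure (ρ t)) (hu : IsRegularField u A M L K)
    {a η h : ℝ} {ψ : Space d → ℝ} (hψ : IsTest a ψ)
    (h1 : ∀ s t, |s - t| ≤ h → ∀ x, ‖u s x - u t x‖ ≤ η)
    (h2 : ∀ s t, |s - t| ≤ h → ∀ (g : Space d → ℝ) (l : ℝ≥0),
      LipschitzWith l g → (∃ B, ∀ x, |g x| ≤ B) → |∫ x, g x ∂ρ s - ∫ x, g x ∂ρ t| ≤ l * η)
    {s t : ℝ} (hst : |s - t| ≤ h) :
    |(∫ x, fderiv ℝ ψ x (u s x) ∂ρ s) - ∫ x, fderiv ℝ ψ x (u t x) ∂ρ t|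
      ≤ a * ((1 + M + L) * η) := by
  have ha := hψ.nonneg
  have hL := hu.L_nonneg
  have hM := hu.M_nonneg
  have hc : ∀ t, Continuous fun x => fderiv ℝ ψ x (u t x) := fun t =>
    hψ.continuous_fderiv.clm_apply (hu.continuous_field t)
  have hb : ∀ t x, |fderiv ℝ ψ x (u t x)| ≤ a * M := fun t x =>
    (ContinuousLinearMap.le_opNorm _ _).trans
      (mul_le_mul (hψ.fderiv_le x) (hu.norm_le t x) (norm_nonneg _) ha)
  have hi : ∀ t s, Integrable (fun x => fderiv ℝ ψ x (u t x)) (ρ s) := fun t s =>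
    Integrable.of_bound (hc t).aestronglyMeasurable (a * M) (Eventually.of_forall (hb t))
  have e1 : |(∫ x, fderiv ℝ ψ x (u s x) ∂ρ s) - ∫ x, fderiv ℝ ψ x (u t x) ∂ρ s| ≤ a * η := by
    rw [← integral_sub (hi s s) (hi t s)]
    have := norm_integral_le_of_norm_le_const (μ := ρ s) (C := a * η)
      (f := fun x => fderiv ℝ ψ x (u s x) - fderiv ℝ ψ x (u t x))
      (Eventually.of_forall fun x => by
        rw [← map_sub]
        exact (ContinuousLinearMap.le_opNorm _ _).trans
          (mul_le_mul (hψ.fderiv_le x) (h1 s t hst x) (norm_nonneg _) ha))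
    simpa using this
  have hlip : LipschitzWith (a * (M + L)).toNNReal fun x => fderiv ℝ ψ x (u t x) := by
    refine LipschitzWith.of_dist_le_mul fun x y => ?_
    rw [Real.coe_toNNReal _ (by positivity), dist_eq_norm, dist_eq_norm]
    have e : fderiv ℝ ψ x (u t x) - fderiv ℝ ψ y (u t y)
        = (fderiv ℝ ψ x - fderiv ℝ ψ y) (u t x) + fderiv ℝ ψ y (u t x - u t y) := by
      simp
    rw [e]
    have e3 := (ContinuousLinearMap.le_opNorm (fderiv ℝ ψ x - fderiv ℝ ψ y) (u t x)).trans
      (mul_le_mul (hψ.fderiv_lip x y) (hu.norm_le t x) (norm_nonneg _) (by positivity))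
    have e4 := (ContinuousLinearMap.le_opNorm (fderiv ℝ ψ y) (u t x - u t y)).trans
      (mul_le_mul (hψ.fderiv_le y) (hu.norm_sub_le t x y) (norm_nonneg _) ha)
    refine (norm_add_le _ _).trans ((add_le_add e3 e4).trans (le_of_eq ?_))
    ring
  have e2 := h2 s t hst _ _ hlip ⟨_, hb t⟩
  rw [Real.coe_toNNReal _ (by positivity)] at e2
  calc _ ≤ _ := abs_sub_le _ (∫ x, fderiv ℝ ψ x (u t x) ∂ρ s) _
    _ ≤ a * η + a * (M + L) * η := add_le_add e1 e2
    _ = _ := by ring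

/-- Both integrals equal ∫ ψ dρ_s + h ∫ Dψ·u dρ_s up to an error that is small relative to h: the
first by the weak equation with the flux frozen at time s, the second by Taylor's formula for ψ. -/
theorem IsWeakCurve.one_step (hρ : IsWeakCurve u T ρ) (hu : IsRegularField u A M L K)
    {a η h : ℝ} {ψ : Space d → ℝ} (hψ : IsTest a ψ) (hh : 0 ≤ h)
    (h1 : ∀ s t, |s - t| ≤ h → ∀ x, ‖u s x - u t x‖ ≤ η)
    (h2 : ∀ s t, |s - t| ≤ h → ∀ (g : Space d → ℝ) (l : ℝ≥0),
      LipschitzWith l g → (∃ B, ∀ x, |g x| ≤ B) → |∫ x, g x ∂ρ s - ∫ x, g x ∂ρ t| ≤ l * η)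
    {s : ℝ} (hs : 0 ≤ s) (hsT : s + h ≤ T) :
    |∫ x, ψ x ∂ρ (s + h) - ∫ x, ψ (x + h • u s x) ∂ρ s|
      ≤ h * (a * ((1 + M + L) * η + M ^ 2 * h)) := by
  have := hρ.prob
  have ha := hψ.nonneg
  have hL := hu.L_nonneg
  have hM := hu.M_nonneg
  set F : ℝ → ℝ := fun τ => ∫ x, fderiv ℝ ψ x (u τ x) ∂ρ τ with hF
  have hFc : Continuous F := by
    rw [Metric.continuous_iff]
    intro t e he
    set e' := e / (2 * (a * (1 + M + L) + 1)) with he'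
    have he'0 : 0 < e' := by positivity
    obtain ⟨τ₁, hτ₁, k1⟩ := hu.time e' he'0
    obtain ⟨τ₂, hτ₂, k2⟩ := hρ.time e' he'0
    refine ⟨min τ₁ τ₂, by positivity, fun s hs => ?_⟩
    rw [Real.dist_eq] at hs ⊢
    have := pairing_close hρ.prob hu (h := min τ₁ τ₂) hψ
      (fun s t hst x => (k1 s t (hst.trans (min_le_left _ _)) x).1)
      (fun s t hst => k2 s t (hst.trans (min_le_right _ _))) hs.le
    refine this.trans_lt ?_
    calc a * ((1 + M + L) * e') = (a * (1 + M + L)) * e' := by ring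
      _ ≤ (a * (1 + M + L) + 1) * e' := by gcongr; linarith
      _ = e / 2 := by rw [he']; field_simp
      _ < e := by linarith
  have e1 := hρ.weak ψ hψ.contDiff hψ.bdd ⟨a, hψ.fderiv_le⟩ s (s + h) hs (by linarith) hsT
  have e2 : |(∫ τ in s..(s + h), F τ) - h * F s| ≤ a * ((1 + M + L) * η) * h := by
    have e3 : h * F s = ∫ τ in s..(s + h), F s := by simp
    rw [e3, ← intervalIntegral.integral_sub (hFc.intervalIntegrable _ _) (by simp)]
    have := intervalIntegral.norm_integral_le_of_norm_le_const (a := s) (b := s + h)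
      (f := fun τ => F τ - F s) (C := a * ((1 + M + L) * η)) (fun τ hτ => ?_)
    · simpa [abs_of_nonneg hh] using this
    · rw [uIoc_of_le (by linarith)] at hτ
      exact pairing_close hρ.prob hu hψ h1 h2 (by rw [abs_of_nonneg] <;> linarith [hτ.1, hτ.2])
  obtain ⟨B, hB⟩ := hψ.bdd
  have hSc : Continuous fun x => ψ (x + h • u s x) :=
    hψ.contDiff.continuous.comp (continuous_id.add ((hu.continuous_field s).const_smul h))
  have hi1 : Integrable (fun x => ψ (x + h • u s x)) (ρ s) :=
    Integrable.of_bound hSc.aestronglyMeasurable B (Eventually.of_forall fun x => hB _)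
  have hi2 : Integrable ψ (ρ s) :=
    Integrable.of_bound hψ.contDiff.continuous.aestronglyMeasurable B
      (Eventually.of_forall fun x => hB _)
  have hi3 : Integrable (fun x => fderiv ℝ ψ x (u s x)) (ρ s) :=
    Integrable.of_bound (hψ.continuous_fderiv.clm_apply
      (hu.continuous_field s)).aestronglyMeasurable (a * M)
      (Eventually.of_forall fun x => (ContinuousLinearMap.le_opNorm _ _).trans
        (mul_le_mul (hψ.fderiv_le x) (hu.norm_le s x) (norm_nonneg _) ha))
  have e4 : |(∫ x, ψ (x + h • u s x) ∂ρ s) - (∫ x, ψ x ∂ρ s) - h * F s| ≤ a * (M ^ 2 * h) * h := by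
    have hi12 : Integrable (fun x => ψ (x + h • u s x) - ψ x) (ρ s) := hi1.sub hi2
    rw [hF, ← integral_const_mul, ← integral_sub hi1 hi2, ← integral_sub hi12 (hi3.const_mul h)]
    have := norm_integral_le_of_norm_le_const (μ := ρ s) (C := a * (M ^ 2 * h) * h)
      (f := fun x => ψ (x + h • u s x) - ψ x - h * fderiv ℝ ψ x (u s x))
      (Eventually.of_forall fun x => ?_)
    · simpa using this
    · have h5 := hψ.taylor x (h • u s x)
      rw [map_smul, smul_eq_mul, norm_smul, Real.norm_of_nonneg hh] at h5
      refine h5.trans ?_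
      calc a * (h * ‖u s x‖) ^ 2 ≤ a * (h * M) ^ 2 := by gcongr; exact hu.norm_le s x
        _ = _ := by ring
  have e5 : ∫ x, ψ x ∂ρ (s + h) - ∫ x, ψ (x + h • u s x) ∂ρ s
      = ((∫ τ in s..(s + h), F τ) - h * F s)
        - ((∫ x, ψ (x + h • u s x) ∂ρ s) - (∫ x, ψ x ∂ρ s) - h * F s) := by
    rw [← e1]; ring
  rw [e5]
  refine (abs_sub _ _).trans ((add_le_add e2 e4).trans (le_of_eq ?_))
  ring

/-- Duality replaces any stability theory for measures: the last Euler step is absorbed into the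
test function, and the one-step errors add up. -/
theorem IsWeakCurve.euler_close (hρ : IsWeakCurve u T ρ) (hu : IsRegularField u A M L K)
    {η h : ℝ} (hh : 0 ≤ h) (hh1 : h ≤ 1) (hη : 0 ≤ η)
    (h1 : ∀ s t, |s - t| ≤ h → ∀ x, ‖u s x - u t x‖ ≤ η)
    (h2 : ∀ s t, |s - t| ≤ h → ∀ (g : Space d → ℝ) (l : ℝ≥0),
      LipschitzWith l g → (∃ B, ∀ x, |g x| ≤ B) → |∫ x, g x ∂ρ s - ∫ x, g x ∂ρ t| ≤ l * η)
    (k : ℕ) (hk : k * h ≤ T) {a : ℝ} {ψ : Space d → ℝ} (hψ : IsTest a ψ) :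
    |∫ x, ψ x ∂ρ (k * h) - ∫ x, ψ (euler u h k x) ∂ρ 0|
      ≤ k * h * (a * ((1 + M + L) * η + M ^ 2 * h)) * (1 + h * (2 * L + L ^ 2 + K)) ^ k := by
  have hL := hu.L_nonneg
  have hM := hu.M_nonneg
  have hK := hu.nonneg
  -- The induction hypothesis is needed for ψ composed with an Euler step, which has a larger
  -- constant.
  induction k generalizing a ψ with
  | zero => simp [euler]
  | succ k ih =>
    push_cast at hk
    have hkh : 0 ≤ (k : ℝ) * h := by positivity
    have ha := hψ.nonneg
    have e1 := hρ.one_step hu hψ hh h1 h2 hkh (by linarith)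
    have e2 := ih (by linarith) (hψ.comp_step hu (s := k * h) hh hh1)
    have e : ((k + 1 : ℕ) : ℝ) * h = k * h + h := by push_cast; ring
    rw [e]
    set Λ := 2 * L + L ^ 2 + K
    set p := (1 + M + L) * η + M ^ 2 * h
    have hp : 0 ≤ p := by positivity
    have hΛ : 0 ≤ Λ := by positivity
    have h4 : (1 : ℝ) ≤ (1 + h * Λ) ^ (k + 1) := one_le_pow₀ (by nlinarith)
    have h5 : 0 ≤ h * (a * p) := by positivity
    simp only [euler]
    calc _ ≤ _ := abs_sub_le _ (∫ x, ψ (x + h • u (k * h) x) ∂ρ (k * h)) _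
      _ ≤ h * (a * p) + k * h * (a * (1 + h * Λ) * p) * (1 + h * Λ) ^ k := add_le_add e1 e2
      _ ≤ h * (a * p) * (1 + h * Λ) ^ (k + 1)
          + k * h * (a * (1 + h * Λ) * p) * (1 + h * Λ) ^ k :=
        add_le_add (le_mul_of_one_le_right h5 h4) le_rfl
      _ = _ := by ring

/-- The integrals of ψ along the Euler maps converge to both sides: to the right by convergence of
the scheme and domination, to the left by the estimate for weak curves. -/
theorem IsWeakCurve.integral_eq (hρ : IsWeakCurve u T ρ) (hu : IsRegularField u A M L K)
    (hX : IsFlow u T X) {t : ℝ} (ht : t ∈ Icc 0 T) {a : ℝ} {ψ : Space d → ℝ} (hψ : IsTest a ψ) :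
    ∫ x, ψ x ∂ρ t = ∫ x, ψ (X t x) ∂ρ 0 := by
  have := hρ.prob
  have hL := hu.L_nonneg
  have hM := hu.M_nonneg
  have hK := hu.nonneg
  have ha := hψ.nonneg
  have hT : 0 ≤ T := ht.1.trans ht.2
  set Λ := 2 * L + L ^ 2 + K with hΛ
  have hΛ0 : 0 ≤ Λ := by positivity
  have hcont := hu.continuous_euler
  obtain ⟨B, hB⟩ := hψ.bdd
  have hlim1 : Tendsto (fun n : ℕ => ∫ x, ψ (euler u (t / n) n x) ∂ρ 0) atTop
      (𝓝 (∫ x, ψ (X t x) ∂ρ 0)) := by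
    refine tendsto_integral_of_dominated_convergence (fun _ => B) (fun n =>
      (hψ.contDiff.continuous.comp (hcont _ n)).aestronglyMeasurable) (integrable_const _)
      (fun n => Eventually.of_forall fun x => hB _) (Eventually.of_forall fun x => ?_)
    exact (hψ.contDiff.continuous.tendsto _).comp (hX.tendsto_euler_end hu ht x)
  have hlim2 : Tendsto (fun n : ℕ => ∫ x, ψ (euler u (t / n) n x) ∂ρ 0) atTop
      (𝓝 (∫ x, ψ x ∂ρ t)) := by
    rw [Metric.tendsto_atTop']
    intro e he
    set D := T * a * (1 + M + L) * Real.exp (T * Λ) + T * a * M ^ 2 * Real.exp (T * Λ) + 1 with hD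
    have hD0 : 0 < D := by positivity
    set η := e / (2 * D) with hη
    have hη0 : 0 < η := by positivity
    obtain ⟨τ₁, hτ₁, k1⟩ := hu.time η hη0
    obtain ⟨τ₂, hτ₂, k2⟩ := hρ.time η hη0
    have hl : Tendsto (fun n : ℕ => t / (n : ℝ)) atTop (𝓝 0) :=
      tendsto_const_div_atTop_nhds_zero_nat t
    have hev := ((hl.eventually (Iio_mem_nhds hτ₁)).and (hl.eventually (Iio_mem_nhds hτ₂))).and
      (((hl.eventually (Iio_mem_nhds hη0)).and (hl.eventually (Iio_mem_nhds one_pos))).and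
      (eventually_gt_atTop 0))
    obtain ⟨N, hN⟩ := eventually_atTop.1 hev
    refine ⟨N, fun n hn => ?_⟩
    obtain ⟨⟨g1, g2⟩, ⟨g3, g4⟩, g5⟩ := hN n hn.le
    have hn0 : (0 : ℝ) < n := by exact_mod_cast g5
    have hh : 0 ≤ t / n := div_nonneg ht.1 hn0.le
    have hnt : (n : ℝ) * (t / n) = t := by field_simp
    have := hρ.euler_close hu hh g4.le hη0.le
      (fun s s' hss x => (k1 s s' (hss.trans g1.le) x).1)
      (fun s s' hss => k2 s s' (hss.trans g2.le)) n (by rw [hnt]; exact ht.2) hψ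
    rw [hnt] at this
    rw [Real.dist_eq, abs_sub_comm]
    refine this.trans_lt ?_
    have hpow : (1 + t / n * Λ) ^ n ≤ Real.exp (T * Λ) := by
      refine (one_add_pow_le_exp (by positivity) n).trans (Real.exp_le_exp.2 ?_)
      rw [← mul_assoc, hnt]
      exact mul_le_mul_of_nonneg_right ht.2 hΛ0
    calc t * (a * ((1 + M + L) * η + M ^ 2 * (t / n))) * (1 + t / n * Λ) ^ n
        ≤ T * (a * ((1 + M + L) * η + M ^ 2 * η)) * Real.exp (T * Λ) := by
          gcongr
          exact ht.2
      _ = (T * a * (1 + M + L) * Real.exp (T * Λ) + T * a * M ^ 2 * Real.exp (T * Λ)) * η := by ring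
      _ ≤ D * η := by gcongr; linarith
      _ = e / 2 := by rw [hη]; field_simp
      _ < e := by linarith
  exact tendsto_nhds_unique hlim2 hlim1

/-- The real and imaginary parts of a character are test functions, so characteristic functions will
identify the transported measure. -/
theorem isTest_cos (ξ : Space d) : IsTest (‖ξ‖ + ‖ξ‖ ^ 2) (fun x => Real.cos ⟪x, ξ⟫_ℝ) ∧
    IsTest (‖ξ‖ + ‖ξ‖ ^ 2) (fun x => Real.sin ⟪x, ξ⟫_ℝ) := by
  have hd : ∀ x : Space d, HasFDerivAt (fun x => ⟪x, ξ⟫_ℝ) (innerSL ℝ ξ) x := fun x => by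
    have := (innerSL ℝ ξ).hasFDerivAt (x := x)
    refine this.congr_of_eventuallyEq (Eventually.of_forall fun y => ?_)
    simp [real_inner_comm]
  have hlip : ∀ x y : Space d, |⟪x, ξ⟫_ℝ - ⟪y, ξ⟫_ℝ| ≤ ‖ξ‖ * ‖x - y‖ := fun x y => by
    rw [← inner_sub_left, mul_comm]; exact abs_real_inner_le_norm _ _
  have hc : ∀ x : Space d, fderiv ℝ (fun x : Space d => Real.cos ⟪x, ξ⟫_ℝ) x
      = -Real.sin ⟪x, ξ⟫_ℝ • innerSL ℝ ξ := fun x => (hd x).cos.fderiv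
  have hs : ∀ x : Space d, fderiv ℝ (fun x : Space d => Real.sin ⟪x, ξ⟫_ℝ) x
      = Real.cos ⟪x, ξ⟫_ℝ • innerSL ℝ ξ := fun x => (hd x).sin.fderiv
  have hsl : ∀ a b : ℝ, |Real.sin a - Real.sin b| ≤ |a - b| := fun a b => by
    have := Real.lipschitzWith_sin.dist_le_mul a b
    simpa [Real.dist_eq] using this
  have hcl : ∀ a b : ℝ, |Real.cos a - Real.cos b| ≤ |a - b| := fun a b => by
    have := Real.lipschitzWith_cos.dist_le_mul a b
    simpa [Real.dist_eq] using this
  have hn := norm_nonneg ξ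
  refine ⟨⟨Real.contDiff_cos.comp (contDiff_id.inner ℝ contDiff_const),
    ⟨1, fun x => Real.abs_cos_le_one _⟩, fun x => ?_, fun x y => ?_⟩,
    ⟨Real.contDiff_sin.comp (contDiff_id.inner ℝ contDiff_const),
    ⟨1, fun x => Real.abs_sin_le_one _⟩, fun x => ?_, fun x y => ?_⟩⟩
  · rw [hc, norm_smul, innerSL_apply_norm, norm_neg, Real.norm_eq_abs]
    nlinarith [Real.abs_sin_le_one ⟪x, ξ⟫_ℝ]
  · rw [hc, hc, ← sub_smul, norm_smul, innerSL_apply_norm, Real.norm_eq_abs, neg_sub_neg,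
      abs_sub_comm]
    have := (hsl _ _).trans (hlip x y)
    nlinarith [norm_nonneg (x - y)]
  · rw [hs, norm_smul, innerSL_apply_norm, Real.norm_eq_abs]
    nlinarith [Real.abs_cos_le_one ⟪x, ξ⟫_ℝ]
  · rw [hs, hs, ← sub_smul, norm_smul, innerSL_apply_norm, Real.norm_eq_abs]
    have := (hcl _ _).trans (hlip x y)
    nlinarith [norm_nonneg (x - y)]

/-- A weak solution is the push-forward of its initial value under the flow. -/
theorem IsWeakCurve.eq_map (hρ : IsWeakCurve u T ρ) (hu : IsRegularField u A M L K)
    (hX : IsFlow u T X) {t : ℝ} (ht : t ∈ Icc 0 T) : ρ t = (ρ 0).map (X t) := by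
  have := hρ.prob
  have hXc := hX.continuous hu (ht.1.trans ht.2) t
  have : IsProbabilityMeasure ((ρ 0).map (X t)) :=
    Measure.isProbabilityMeasure_map hXc.measurable.aemeasurable
  refine Measure.ext_of_charFun (funext fun ξ => ?_)
  have key : ∀ ν : Measure (Space d), IsProbabilityMeasure ν → charFun ν ξ
      = ((∫ x, Real.cos ⟪x, ξ⟫_ℝ ∂ν : ℝ) : ℂ) + (∫ x, Real.sin ⟪x, ξ⟫_ℝ ∂ν : ℝ) * Complex.I := by
    intro ν _
    have hc : Integrable (fun x : Space d => Real.cos ⟪x, ξ⟫_ℝ) ν :=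
      Integrable.of_bound (C := 1)
        (Real.continuous_cos.comp (continuous_id.inner continuous_const)).aestronglyMeasurable
        (Eventually.of_forall fun x => Real.abs_cos_le_one _)
    have hs : Integrable (fun x : Space d => Real.sin ⟪x, ξ⟫_ℝ) ν :=
      Integrable.of_bound (C := 1)
        (Real.continuous_sin.comp (continuous_id.inner continuous_const)).aestronglyMeasurable
        (Eventually.of_forall fun x => Real.abs_sin_le_one _)
    rw [charFun_apply, ← integral_complex_ofReal, ← integral_complex_ofReal, ← integral_mul_const,
      ← integral_add]
    · refine integral_congr_ae (Eventually.of_forall fun x => ?_)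
      simp only
      rw [Complex.exp_mul_I]
      push_cast
      rfl
    · exact hc.ofReal
    · exact hs.ofReal.mul_const _
  rw [key _ inferInstance, key _ inferInstance, hρ.integral_eq hu hX ht (isTest_cos ξ).1,
    hρ.integral_eq hu hX ht (isTest_cos ξ).2,
    integral_map hXc.measurable.aemeasurable (Continuous.aestronglyMeasurable (by fun_prop)),
    integral_map hXc.measurable.aemeasurable (Continuous.aestronglyMeasurable (by fun_prop))]

end Representation

end NonlocalDiffusion

end

noncomputable section

namespace NonlocalDiffusion

/-! ### Entropy along the flow -/

section Entropy

variable {d : ℕ} {u : ℝ → Space d → Space d} {A : ℝ → Space d → Space d →L[ℝ] Space d}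
  {M L K T : ℝ} {X : ℝ → Space d → Space d}

/-- The divergence as a continuous linear map. -/
def divOfL (d : ℕ) : (Space d →L[ℝ] Space d) →L[ℝ] ℝ :=
  LinearMap.toContinuousLinearMap ((LinearMap.trace ℝ (Space d)).comp (ContinuousLinearMap.coeLM ℝ))

theorem divOfL_apply (B : Space d →L[ℝ] Space d) : divOfL d B = divOf B := rfl

/-- Jacobi's formula at the identity. The determinant is a polynomial in the matrix entries, hence
differentiable, and its directional derivative is read off from det(1 + tN) = 1 + t tr N + O(t²). -/
theorem hasFDerivAt_det_one :
    HasFDerivAt (fun B : Space d →L[ℝ] Space d => B.det) (divOfL d) 1 := by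
  set b := (EuclideanSpace.basisFun (Fin d) ℝ).toBasis
  have hdet : ∀ B : Space d →L[ℝ] Space d, B.det = (LinearMap.toMatrix b b B).det := fun B =>
    (LinearMap.det_toMatrix b _).symm
  have hd : Differentiable ℝ fun B : Space d →L[ℝ] Space d => B.det := by
    simp only [hdet, Matrix.det_apply]
    have he : ∀ σ : Equiv.Perm (Fin d), ∀ i : Fin d, Differentiable ℝ
        fun B : Space d →L[ℝ] Space d => LinearMap.toMatrix b b (B : Space d →ₗ[ℝ] Space d) (σ i) i := by
      intro σ i
      simp only [LinearMap.toMatrix_apply]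
      exact ((LinearMap.toContinuousLinearMap (b.coord (σ i))).comp
        (ContinuousLinearMap.apply ℝ (Space d) (b i))).differentiable
    refine Differentiable.fun_sum fun σ _ => Differentiable.const_smul ?_ _
    fun_prop
  have h1 := (hd 1).hasFDerivAt
  convert h1 using 1
  refine ContinuousLinearMap.ext fun B => ?_
  have h2 : HasDerivAt (fun t : ℝ => (1 + t • B).det)
      (fderiv ℝ (fun B : Space d →L[ℝ] Space d => B.det) 1 B) 0 := by
    have h3 : HasDerivAt (fun t : ℝ => (1 : Space d →L[ℝ] Space d) + t • B) B 0 := by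
      simpa using ((hasDerivAt_id (0 : ℝ)).smul_const B).const_add (1 : Space d →L[ℝ] Space d)
    have h4 : HasFDerivAt (fun B : Space d →L[ℝ] Space d => B.det)
      (fderiv ℝ (fun B : Space d →L[ℝ] Space d => B.det) 1) (1 + (0 : ℝ) • B) := by
      have h5 : (1 : Space d →L[ℝ] Space d) + (0 : ℝ) • B = 1 := by ext; simp
      rw [h5]
      exact h1
    exact h4.comp_hasDerivAt (0 : ℝ) h3
  refine HasDerivAt.unique ?_ h2
  set N := LinearMap.toMatrix b b B
  have h5 : (fun t : ℝ => (1 + t • B).det) = fun t => 1 + N.trace * t +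
      (Matrix.det (1 + (Polynomial.X : Polynomial ℝ) • N.map Polynomial.C)).divX.divX.eval t
        * t ^ 2 := by
    funext t
    rw [hdet, ← Matrix.det_one_add_smul]
    congr 1
    simp [N, LinearMap.toMatrix_one]
  rw [h5, divOfL_apply, divOf, LinearMap.trace_eq_matrix_trace ℝ b]
  set P := (Matrix.det (1 + (Polynomial.X : Polynomial ℝ) • N.map Polynomial.C)).divX.divX
  have h6 := (((hasDerivAt_id (0 : ℝ)).const_mul N.trace).const_add 1).add
    ((P.hasDerivAt 0).mul ((hasDerivAt_id (0 : ℝ)).pow 2))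
  have h7 : HasDerivAt (fun t => 1 + N.trace * t + P.eval t * t ^ 2) (N.trace * 1 +
    (P.derivative.eval 0 * (0 : ℝ) ^ 2 + P.eval 0 * ((2 : ℕ) * (0 : ℝ) ^ (2 - 1) * 1))) 0 := h6
  simpa using h7

/-- First-order expansion of log det at the identity. The error is a small multiple of ‖B‖, so over
n steps with B = O(t/n) the errors still sum to something small. -/
theorem exists_le_log_det {η : ℝ} (hη : 0 < η) : ∃ r₀, 0 < r₀ ∧ ∀ B : Space d →L[ℝ] Space d,
    ‖B‖ ≤ r₀ → 0 < (1 + B).det ∧ divOf B - η * ‖B‖ ≤ Real.log (1 + B).det := by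
  have h1 : HasFDerivAt (fun B : Space d →L[ℝ] Space d => Real.log (1 + B).det) (divOfL d) 0 := by
    have h2 : HasFDerivAt (fun B : Space d →L[ℝ] Space d => 1 + B) (ContinuousLinearMap.id ℝ _) 0 :=
      (hasFDerivAt_id _).const_add _
    have h3 : HasFDerivAt (fun B : Space d →L[ℝ] Space d => B.det) (divOfL d) (1 + 0) := by
      simpa using hasFDerivAt_det_one (d := d)
    have h4 := (h3.comp (0 : Space d →L[ℝ] Space d) h2).log (by simp [ContinuousLinearMap.det])
    simpa [ContinuousLinearMap.det] using h4
  have h5 := h1.isLittleO.def hη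
  have h6 : ∀ᶠ B : Space d →L[ℝ] Space d in 𝓝 0, 0 < (1 + B).det := by
    have hc : Continuous fun B : Space d →L[ℝ] Space d => (1 + B).det :=
      ContinuousLinearMap.continuous_det.comp (continuous_const.add continuous_id)
    refine hc.continuousAt.eventually (Ioi_mem_nhds ?_)
    simp [ContinuousLinearMap.det]
  obtain ⟨r, hr, h⟩ := Metric.eventually_nhds_iff.1 (h5.and h6)
  refine ⟨r / 2, half_pos hr, fun B hB => ?_⟩
  obtain ⟨h7, h8⟩ := h (y := B) (by rw [dist_zero_right]; linarith)
  refine ⟨h8, ?_⟩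
  simp only [add_zero, sub_zero, divOfL_apply] at h7
  have h9 : (1 : Space d →L[ℝ] Space d).det = 1 := by simp [ContinuousLinearMap.det]
  rw [h9, Real.log_one, sub_zero, Real.norm_eq_abs] at h7
  linarith [(abs_le.1 h7).1]

/-- The derivative of the Euler scheme. -/
def eulerFDeriv (u : ℝ → Space d → Space d) (A : ℝ → Space d → Space d →L[ℝ] Space d) (h : ℝ) :
    ℕ → Space d → Space d →L[ℝ] Space d
  | 0, _ => 1
  | k + 1, x => (1 + h • A (k * h) (euler u h k x)).comp (eulerFDeriv u A h k x)

theorem IsRegularField.hasFDerivAt_euler (hu : IsRegularField u A M L K) (h : ℝ) (k : ℕ)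
    (x : Space d) : HasFDerivAt (euler u h k) (eulerFDeriv u A h k x) x := by
  induction k with
  | zero => exact hasFDerivAt_id x
  | succ k ih =>
    have h1 := ((hasFDerivAt_id (euler u h k x)).add
      ((hu.hasFDerivAt (k * h) (euler u h k x)).const_smul h)).comp x ih
    exact h1

/-- The Jacobian of an Euler map is a product of one-step Jacobians, whose logarithms add up to a
Riemann sum of the divergence. Working with the Euler maps avoids differentiating the flow in space.
-/
theorem IsRegularField.le_log_det_euler (hu : IsRegularField u A M L K) {h η r₀ : ℝ} (hh : 0 ≤ h)
    (hη : 0 ≤ η) (hr : h * L ≤ r₀) (hdet : ∀ B : Space d →L[ℝ] Space d,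
      ‖B‖ ≤ r₀ → 0 < (1 + B).det ∧ divOf B - η * ‖B‖ ≤ Real.log (1 + B).det) (k : ℕ) (x : Space d) :
    0 < (eulerFDeriv u A h k x).det ∧
      (∑ j ∈ Finset.range k, h * divOf (A (j * h) (euler u h j x))) - k * (h * (η * L))
        ≤ Real.log (eulerFDeriv u A h k x).det := by
  induction k with
  | zero => simp [eulerFDeriv, ContinuousLinearMap.det]
  | succ k ih =>
    obtain ⟨h1, h2⟩ := ih
    have hB : ‖h • A (k * h) (euler u h k x)‖ ≤ h * L := by
      rw [norm_smul, Real.norm_of_nonneg hh]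
      exact mul_le_mul_of_nonneg_left (hu.fderiv_le _ _) hh
    obtain ⟨h3, h4⟩ := hdet _ (hB.trans hr)
    have h5 : (eulerFDeriv u A h (k + 1) x).det = (1 + h • A (k * h) (euler u h k x)).det *
        (eulerFDeriv u A h k x).det := by
      simp only [eulerFDeriv, ContinuousLinearMap.det, ContinuousLinearMap.toLinearMap_comp,
        LinearMap.det_comp]
    rw [h5, Real.log_mul h3.ne' h1.ne', Finset.sum_range_succ]
    refine ⟨mul_pos h3 h1, ?_⟩
    have h6 : divOf (h • A (k * h) (euler u h k x)) = h * divOf (A (k * h) (euler u h k x)) := by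
      simp only [← divOfL_apply, map_smul, smul_eq_mul]
    rw [h6] at h4
    have h7 := mul_le_mul_of_nonneg_left hB hη
    push_cast
    nlinarith

/-! ### Gibbs' inequality with a Gaussian reference density -/

theorem mul_log_sub_log_le {a b : ℝ} (ha : 0 ≤ a) (hb : 0 < b) :
    a * (Real.log b - Real.log a) ≤ b - a := by
  rcases ha.eq_or_lt with rfl | ha
  · simpa using hb.le
  · rw [← Real.log_div hb.ne' ha.ne']
    have := mul_le_mul_of_nonneg_left (Real.log_le_sub_one_of_pos (div_pos hb ha)) ha.le
    calc _ ≤ _ := this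
      _ = b - a := by field_simp

theorem integral_gaussian : ∫ x : Space d, Real.exp (-Real.pi * ‖x‖ ^ 2) = 1 := by
  rw [GaussianFourier.integral_rexp_neg_mul_sq_norm Real.pi_pos, div_self Real.pi_ne_zero,
    Real.one_rpow]

theorem integrable_gaussian : Integrable fun x : Space d => Real.exp (-Real.pi * ‖x‖ ^ 2) :=
  .of_integral_ne_zero (by rw [integral_gaussian]; exact one_ne_zero)

/-- Gaussian change of variables for an injective map. -/
theorem integrable_gaussian_comp {Y : Space d → Space d} {D : Space d → Space d →L[ℝ] Space d}
    (hY : ∀ x, HasFDerivAt Y (D x) x) (hinj : Function.Injective Y) (hD : ∀ x, 0 < (D x).det) :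
    Integrable (fun x => Real.exp (-Real.pi * ‖Y x‖ ^ 2) * (D x).det) ∧
      ∫ x, Real.exp (-Real.pi * ‖Y x‖ ^ 2) * (D x).det ≤ 1 := by
  have h1 := (integrableOn_image_iff_integrableOn_abs_det_fderiv_smul volume MeasurableSet.univ
    (fun x _ => (hY x).hasFDerivWithinAt) hinj.injOn
    (fun x : Space d => Real.exp (-Real.pi * ‖x‖ ^ 2))).1 integrable_gaussian.integrableOn
  have h2 := integral_image_eq_integral_abs_det_fderiv_smul volume MeasurableSet.univ
    (fun x _ => (hY x).hasFDerivWithinAt) hinj.injOn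
    (fun x : Space d => Real.exp (-Real.pi * ‖x‖ ^ 2))
  have h3 : (fun x => |(D x).det| • Real.exp (-Real.pi * ‖Y x‖ ^ 2)) =
      fun x => Real.exp (-Real.pi * ‖Y x‖ ^ 2) * (D x).det := by
    funext x
    rw [abs_of_pos (hD x), smul_eq_mul, mul_comm]
  rw [h3, integrableOn_univ] at h1
  rw [h3, setIntegral_univ] at h2
  refine ⟨h1, ?_⟩
  rw [← h2, ← integral_gaussian (d := d)]
  exact setIntegral_le_integral integrable_gaussian (Eventually.of_forall fun x => (Real.exp_pos _).le)

/-- Gibbs' inequality for a change of variables of a Gaussian. -/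
theorem integral_gibbs {w : Space d → ℝ} (hw : Continuous w) (hwc : HasCompactSupport w)
    (hw0 : ∀ x, 0 ≤ w x) (hw1 : ∫ x, w x = 1) {Y : Space d → Space d}
    {D : Space d → Space d →L[ℝ] Space d}
    (hY : ∀ x, HasFDerivAt Y (D x) x) (hinj : Function.Injective Y) (hD : ∀ x, 0 < (D x).det)
    {l : Space d → ℝ} (hl : Continuous l) (hlD : ∀ x, l x ≤ Real.log (D x).det) :
    ∫ x, w x * l x ≤ (∫ x, w x * Real.log (w x)) + Real.pi * ∫ x, w x * ‖Y x‖ ^ 2 := by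
  obtain ⟨h1, h2⟩ := integrable_gaussian_comp hY hinj hD
  have hYc : Continuous Y := continuous_iff_continuousAt.2 fun x => (hY x).continuousAt
  have hi : ∀ g : Space d → ℝ, Continuous g → Integrable fun x => w x * g x := fun g hg =>
    (hw.mul hg).integrable_of_hasCompactSupport hwc.mul_right
  have hwi : Integrable w := hw.integrable_of_hasCompactSupport hwc
  have hent : Integrable fun x => w x * Real.log (w x) := by
    refine (Real.continuous_mul_log.comp hw).integrable_of_hasCompactSupport ?_
    exact hwc.comp_left (g := fun a => a * Real.log a) (by simp)
  have hY2 := hi (fun x => ‖Y x‖ ^ 2) (by fun_prop)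
  -- Pointwise this is a log(b/a) ≤ b − a with a = w and b = exp(−π|Y|²) det DY. The right-hand
  -- integral is at most 0, because b has mass at most 1 and w has mass 1.
  have h3 : ∫ x, (w x * l x - Real.pi * (w x * ‖Y x‖ ^ 2) - w x * Real.log (w x)) ≤
      ∫ x, (Real.exp (-Real.pi * ‖Y x‖ ^ 2) * (D x).det - w x) := by
    refine integral_mono (((hi l hl).sub (hY2.const_mul _)).sub hent) (h1.sub hwi) fun x => ?_
    have h4 := mul_log_sub_log_le (hw0 x) (mul_pos (Real.exp_pos (-Real.pi * ‖Y x‖ ^ 2)) (hD x))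
    rw [Real.log_mul (Real.exp_pos _).ne' (hD x).ne', Real.log_exp] at h4
    have h5 := mul_le_mul_of_nonneg_left (hlD x) (hw0 x)
    simp only
    nlinarith
  have h6 : Integrable fun x => w x * l x - Real.pi * (w x * ‖Y x‖ ^ 2) :=
    (hi l hl).sub (hY2.const_mul _)
  rw [integral_sub h1 hwi, hw1, integral_sub h6 hent,
    integral_sub (hi l hl) (hY2.const_mul _), integral_const_mul] at h3
  linarith

/-- Gibbs' inequality with the identity map: the entropy is bounded below by the second moment. This
is needed because well-prepared data bound only a sum of which the entropy is one term. -/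
theorem integral_entropy_lower {w : Space d → ℝ} (hw : Continuous w) (hwc : HasCompactSupport w)
    (hw0 : ∀ x, 0 ≤ w x) (hw1 : ∫ x, w x = 1) :
    0 ≤ (∫ x, w x * Real.log (w x)) + Real.pi * ∫ x, w x * ‖x‖ ^ 2 := by
  have := integral_gibbs hw hwc hw0 hw1 (Y := id) (D := fun _ => 1) (fun x => hasFDerivAt_id x)
    Function.injective_id (fun x => by simp [ContinuousLinearMap.det]) (l := fun _ => 0)
    continuous_const (fun x => by simp [ContinuousLinearMap.det])
  simpa using this

theorem IsRegularField.continuous_divOf (hu : IsRegularField u A M L K) :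
    Continuous fun z : ℝ × Space d => divOf (A z.1 z.2) :=
  (divOfL d).continuous.comp hu.continuous_fderiv_uncurry

theorem IsRegularField.euler_entropy (hu : IsRegularField u A M L K) {w : Space d → ℝ}
    (hw : Continuous w) (hwc : HasCompactSupport w)
    (hw0 : ∀ x, 0 ≤ w x) (hw1 : ∫ x, w x = 1) {η : ℝ} (hη : 0 < η) :
    ∃ r₀, 0 < r₀ ∧ ∀ h, 0 ≤ h → h ≤ r₀ → ∀ n : ℕ,
    ∫ x, w x * (∑ j ∈ Finset.range n, h * divOf (A (j * h) (euler u h j x))) ≤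
      (∫ x, w x * Real.log (w x)) + Real.pi * (∫ x, w x * ‖euler u h n x‖ ^ 2)
        + n * (h * η) := by
  have hL := hu.L_nonneg
  obtain ⟨r₀, hr₀, hdet⟩ := exists_le_log_det (d := d) (η := η / (L + 1)) (by positivity)
  -- The bound by r₀ validates the expansion of the logarithm, and 1/2 keeps 1 − hL positive so that
  -- the Euler map is injective; L + 1 avoids a division by zero.
  refine ⟨min r₀ (1 / 2) / (L + 1), by positivity, fun h hh hhr n => ?_⟩
  have h1 : h * L ≤ min r₀ (1 / 2) := by
    rw [le_div_iff₀ (by positivity)] at hhr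
    nlinarith
  have hkey := hu.le_log_det_euler hh (by positivity) (h1.trans (min_le_left _ _)) hdet n
  have hec : ∀ k, Continuous (euler u h k) := hu.continuous_euler h
  have hlc : Continuous fun x => ∑ j ∈ Finset.range n, h * divOf (A (j * h) (euler u h j x)) := by
    refine continuous_finsetSum _ fun j _ => continuous_const.mul ?_
    exact hu.continuous_divOf.comp (continuous_const.prodMk (hec j))
  have hinj : Function.Injective (euler u h n) := by
    intro x y hxy
    have h2 := hu.euler_antilipschitz hh (h1.trans ((min_le_right _ _).trans (by norm_num))) n x y
    rw [hxy, sub_self, norm_zero] at h2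
    have h3 : 0 < (1 - h * L) ^ n := pow_pos (by linarith [h1.trans (min_le_right r₀ (1 / 2))]) n
    have h4 : ‖x - y‖ ≤ 0 := by
      by_contra! h
      nlinarith [mul_pos h3 h]
    exact sub_eq_zero.1 (norm_le_zero_iff.1 h4)
  have h5 := integral_gibbs hw hwc hw0 hw1 (hu.hasFDerivAt_euler h n) hinj (fun x => (hkey x).1)
    (hlc.sub continuous_const) (fun x => (hkey x).2)
  have hwi : Integrable w := hw.integrable_of_hasCompactSupport hwc
  have h8 : ∫ x, w x * ((∑ j ∈ Finset.range n, h * divOf (A (j * h) (euler u h j x))) -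
      n * (h * (η / (L + 1) * L))) = (∫ x, w x * (∑ j ∈ Finset.range n,
      h * divOf (A (j * h) (euler u h j x)))) - n * (h * (η / (L + 1) * L)) := by
    simp_rw [mul_sub (w _)]
    have h9 : Integrable fun x => w x * (∑ j ∈ Finset.range n,
        h * divOf (A (j * h) (euler u h j x))) :=
      (hw.mul hlc).integrable_of_hasCompactSupport hwc.mul_right
    rw [integral_sub h9 (hwi.mul_const _), integral_mul_const, hw1, one_mul]
  simp only [Pi.sub_apply] at h5
  rw [h8] at h5
  have h6 : η / (L + 1) * L ≤ η := by
    rw [div_mul_eq_mul_div, div_le_iff₀ (by positivity)]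
    nlinarith
  have h7 : (n : ℝ) * (h * (η / (L + 1) * L)) ≤ n * (h * η) := by gcongr
  linarith

/-- A Riemann sum comparison, uniform in x: on each short interval the time modulus of the
derivative, its Lipschitz bound in space and the Euler error together move the divergence by at most
e. -/
theorem IsFlow.sum_euler_divOf (hX : IsFlow u T X) (hu : IsRegularField u A M L K) {t : ℝ}
    (ht : t ∈ Icc 0 T) {e : ℝ} (he : 0 < e) : ∀ᶠ n : ℕ in atTop, ∀ x,
      ∫ s in (0 : ℝ)..t, divOf (A s (X s x)) ≤
        (∑ j ∈ Finset.range n, t / n * divOf (A (j * (t / n)) (euler u (t / n) j x))) + t * e := by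
  have hT : 0 ≤ T := ht.1.trans ht.2
  have hM := hu.M_nonneg
  have hK := hu.nonneg
  set N := ‖divOfL d‖ with hN
  have hN0 : 0 ≤ N := norm_nonneg (divOfL d)
  set c := e / (2 * (N + 1)) with hc
  have hc0 : 0 < c := by positivity
  obtain ⟨τ, hτ, hmod⟩ := hu.time c hc0
  set b := c / (2 * (K + 1)) with hb
  have hb0 : 0 < b := by positivity
  have hlim : Tendsto (fun n : ℕ => t / (n : ℝ)) atTop (𝓝 0) :=
    tendsto_const_div_atTop_nhds_zero_nat t
  have hlim2 : Tendsto (fun n : ℕ => M * (t / (n : ℝ))) atTop (𝓝 0) := by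
    simpa using hlim.const_mul M
  filter_upwards [hX.tendsto_euler hu ht hb0, hlim.eventually (Iio_mem_nhds hτ),
    hlim2.eventually (Iio_mem_nhds hb0)] with n h1 h2 h3 x
  obtain ⟨hn, h1⟩ := h1
  have hn0 : (0 : ℝ) < n := by exact_mod_cast hn
  set h := t / (n : ℝ) with hh
  have hh0 : 0 ≤ h := div_nonneg ht.1 hn0.le
  have hnh : (n : ℝ) * h = t := by rw [hh]; field_simp
  have hcont : Continuous fun s => divOf (A s (X s x)) :=
    hu.continuous_divOf.comp (continuous_id.prodMk
      ((hX.continuous_uncurry hu hT).comp (continuous_id.prodMk continuous_const)))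
  have h4 := intervalIntegral.sum_integral_adjacent_intervals (n := n) (a := fun j : ℕ => j * h)
    (μ := volume) (f := fun s => divOf (A s (X s x))) fun j _ => hcont.intervalIntegrable _ _
  simp only [Nat.cast_zero, zero_mul, hnh] at h4
  rw [← h4]
  have h5 : t * e = ∑ j ∈ Finset.range n, h * e := by
    rw [Finset.sum_const, Finset.card_range, nsmul_eq_mul, ← mul_assoc, hnh]
  rw [h5, ← Finset.sum_add_distrib]
  refine Finset.sum_le_sum fun j hj => ?_
  have hjn : j < n := Finset.mem_range.1 hj
  have hjh : (j : ℝ) * h ≤ (j + 1 : ℕ) * h := by gcongr; simp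
  have h6 : ∫ s in (j * h : ℝ)..((j + 1 : ℕ) * h), divOf (A s (X s x)) ≤
      ∫ s in (j * h : ℝ)..((j + 1 : ℕ) * h), (divOf (A (j * h) (euler u h j x)) + e) := by
    refine intervalIntegral.integral_mono_on hjh (hcont.intervalIntegrable _ _)
      intervalIntegrable_const fun s hs => ?_
    have hst : |s - j * h| ≤ h := by
      rw [abs_of_nonneg (by linarith [hs.1])]
      have := hs.2
      push_cast at this
      linarith
    have hj0 : 0 ≤ (j : ℝ) * h := by positivity
    have hsT : s ≤ T := by
      refine hs.2.trans (le_trans ?_ (hnh.le.trans ht.2))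
      gcongr
      exact_mod_cast hjn
    have e1 : ‖X s x - X (j * h) x‖ ≤ b :=
      ((hX.norm_sub_le' hu hT _ _ x).trans (mul_le_mul_of_nonneg_left hst hM)).trans h3.le
    have e2 := h1 j hjn.le x
    have e3 : ‖X s x - euler u h j x‖ ≤ 2 * b := by
      calc ‖X s x - euler u h j x‖
          = ‖(X s x - X (j * h) x) - (euler u h j x - X (j * h) x)‖ := by
            rw [sub_sub_sub_cancel_right]
        _ ≤ _ := _root_.norm_sub_le _ _
        _ ≤ 2 * b := by linarith
    have e4 : ‖A s (X s x) - A (j * h) (euler u h j x)‖ ≤ 2 * c := by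
      calc ‖A s (X s x) - A (j * h) (euler u h j x)‖
          = ‖(A s (X s x) - A s (euler u h j x))
            + (A s (euler u h j x) - A (j * h) (euler u h j x))‖ := by rw [sub_add_sub_cancel]
        _ ≤ K * (2 * b) + c := (norm_add_le _ _).trans (add_le_add
            ((hu.fderiv_lip s _ _).trans (mul_le_mul_of_nonneg_left e3 hK))
            (hmod s (j * h) (hst.trans h2.le) _).2)
        _ ≤ (K + 1) * (2 * b) + c := by nlinarith
        _ = 2 * c := by rw [hb]; field_simp; ring
    have e5 := (divOfL d).le_opNorm (A s (X s x) - A (j * h) (euler u h j x))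
    rw [map_sub, divOfL_apply, divOfL_apply, Real.norm_eq_abs] at e5
    have e6 : N * ‖A s (X s x) - A (j * h) (euler u h j x)‖ ≤ e := by
      calc N * ‖A s (X s x) - A (j * h) (euler u h j x)‖ ≤ (N + 1) * (2 * c) := by
            gcongr; linarith
        _ = e := by rw [hc]; field_simp
    linarith [(abs_le.1 (e5.trans e6)).2]
  rw [intervalIntegral.integral_const, smul_eq_mul] at h6
  refine h6.trans (le_of_eq ?_)
  push_cast
  ring

/-- The divergence of the velocity along the flow is controlled by the initial entropy and the final
second moment. -/
theorem IsFlow.integral_divOf_le (hX : IsFlow u T X) (hu : IsRegularField u A M L K)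
    {w : Space d → ℝ} (hw : Continuous w) (hwc : HasCompactSupport w)
    (hw0 : ∀ x, 0 ≤ w x) (hw1 : ∫ x, w x = 1) {t : ℝ} (ht : t ∈ Icc 0 T) :
    ∫ x, w x * ∫ s in (0 : ℝ)..t, divOf (A s (X s x)) ≤
      (∫ x, w x * Real.log (w x)) + Real.pi * ∫ x, w x * ‖X t x‖ ^ 2 := by
  have hT : 0 ≤ T := ht.1.trans ht.2
  have hwi : Integrable w := hw.integrable_of_hasCompactSupport hwc
  have hi : ∀ g : Space d → ℝ, Continuous g → Integrable fun x => w x * g x := fun g hg =>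
    (hw.mul hg).integrable_of_hasCompactSupport hwc.mul_right
  have hXc := hX.continuous hu hT t
  have hXX := hX.continuous_uncurry hu hT
  have hcd : Continuous fun x => ∫ s in (0 : ℝ)..t, divOf (A s (X s x)) := by
    refine intervalIntegral.continuous_parametric_intervalIntegral_of_continuous' ?_ 0 t
    exact hu.continuous_divOf.comp (continuous_snd.prodMk
      (hXX.comp (continuous_snd.prodMk continuous_fst)))
  set S := ∫ x, w x * Real.log (w x)
  set Q := ∫ x, w x * ‖X t x‖ ^ 2 with hQ
  set B := ∫ x, w x * ∫ s in (0 : ℝ)..t, divOf (A s (X s x)) with hB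
  -- The term in Q comes from (|X| + e)² ≤ (1 + e)|X|² + 2e for e ≤ 1. One factor te is the error of
  -- the Riemann sum, the other that of the logarithms of determinants.
  have key : ∀ e : ℝ, 0 < e → e ≤ 1 → B ≤ S + Real.pi * (Q * (1 + e) + 2 * e) + 2 * (t * e) := by
    intro e he he1
    obtain ⟨r₀, hr₀, hE⟩ := hu.euler_entropy hw hwc hw0 hw1 he
    have hlim : Tendsto (fun n : ℕ => t / (n : ℝ)) atTop (𝓝 0) :=
      tendsto_const_div_atTop_nhds_zero_nat t
    obtain ⟨n, h1, ⟨hn, h2⟩, h3⟩ := ((hX.sum_euler_divOf hu ht he).and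
      ((hX.tendsto_euler hu ht he).and (hlim.eventually (Iio_mem_nhds hr₀)))).exists
    have hn0 : (0 : ℝ) < n := by exact_mod_cast hn
    have hh0 : 0 ≤ t / n := div_nonneg ht.1 hn0.le
    have h4 := hE _ hh0 h3.le n
    have hnh : (n : ℝ) * (t / n) = t := by field_simp
    rw [← mul_assoc, hnh] at h4
    have hec : ∀ k, Continuous (euler u (t / n) k) := hu.continuous_euler _
    have h5 : B ≤ ∫ x, w x * ((∑ j ∈ Finset.range n,
        t / n * divOf (A (j * (t / n)) (euler u (t / n) j x))) + t * e) := by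
      have hlc : Continuous fun x => (∑ j ∈ Finset.range n,
        t / n * divOf (A (j * (t / n)) (euler u (t / n) j x))) + t * e := by
        refine (continuous_finsetSum _ fun j _ => continuous_const.mul ?_).add continuous_const
        exact hu.continuous_divOf.comp (continuous_const.prodMk (hec j))
      exact integral_mono (hi _ hcd) (hi _ hlc) fun x =>
        mul_le_mul_of_nonneg_left (h1 x) (hw0 x)
    have h6 : ∫ x, w x * ((∑ j ∈ Finset.range n,
        t / n * divOf (A (j * (t / n)) (euler u (t / n) j x))) + t * e) =
        (∫ x, w x * (∑ j ∈ Finset.range n,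
        t / n * divOf (A (j * (t / n)) (euler u (t / n) j x)))) + t * e := by
      simp_rw [mul_add (w _)]
      rw [integral_add (hi _ ?_) (hwi.mul_const _), integral_mul_const, hw1, one_mul]
      refine continuous_finsetSum _ fun j _ => continuous_const.mul ?_
      exact hu.continuous_divOf.comp (continuous_const.prodMk (hec j))
    have h7 : ∫ x, w x * ‖euler u (t / n) n x‖ ^ 2 ≤ Q * (1 + e) + 2 * e := by
      calc ∫ x, w x * ‖euler u (t / n) n x‖ ^ 2
          ≤ ∫ x, (w x * ‖X t x‖ ^ 2 * (1 + e) + w x * (2 * e)) := by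
            refine integral_mono (hi _ (by have := hec n; fun_prop))
              (((hi _ (by fun_prop)).mul_const _).add (hwi.mul_const _)) fun x => ?_
            have e1 := h2 n le_rfl x
            rw [hnh] at e1
            have e2 : ‖euler u (t / n) n x‖ ≤ ‖X t x‖ + e := by
              have := norm_sub_norm_le (euler u (t / n) n x) (X t x)
              linarith
            have e3 : ‖euler u (t / n) n x‖ ^ 2 ≤ (‖X t x‖ + e) ^ 2 := by gcongr
            have e4 : (‖X t x‖ + e) ^ 2 ≤ ‖X t x‖ ^ 2 * (1 + e) + 2 * e := by
              nlinarith [mul_nonneg he.le (sq_nonneg (‖X t x‖ - 1))]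
            calc w x * ‖euler u (t / n) n x‖ ^ 2
                ≤ w x * (‖X t x‖ ^ 2 * (1 + e) + 2 * e) :=
                  mul_le_mul_of_nonneg_left (e3.trans e4) (hw0 x)
              _ = _ := by ring
        _ = _ := by
            rw [integral_add ((hi _ (by fun_prop)).mul_const _) (hwi.mul_const _),
              integral_mul_const, integral_mul_const, hw1, one_mul]
    have h8 := mul_le_mul_of_nonneg_left h7 Real.pi_pos.le
    linarith
  have hl : Tendsto (fun e : ℝ => S + Real.pi * (Q * (1 + e) + 2 * e) + 2 * (t * e)) (𝓝[>] 0)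
      (𝓝 (S + Real.pi * Q)) := by
    have : Continuous fun e : ℝ => S + Real.pi * (Q * (1 + e) + 2 * e) + 2 * (t * e) := by fun_prop
    have h := (this.tendsto 0).mono_left (nhdsWithin_le_nhds (s := Ioi 0))
    simpa using h
  refine ge_of_tendsto hl ?_
  filter_upwards [Ioc_mem_nhdsGT zero_lt_one] with e he
  exact key e he.1 he.2

end Entropy

end NonlocalDiffusion

end

noncomputable section

namespace NonlocalDiffusion

/-! ### Wasserstein distance and Lipschitz functions -/

section Wasserstein

variable {d : ℕ} {ρ ν : Measure (Space d)}

theorem exists_coupling_lt {c : ℝ≥0∞} (h : W2 ρ ν < c) : ∃ π : Measure (Space d × Space d),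
    π.map Prod.fst = ρ ∧ π.map Prod.snd = ν ∧ ∫⁻ z, ‖z.1 - z.2‖ₑ ^ 2 ∂π < c ^ 2 := by
  rw [W2, one_div] at h
  have h2 : (c ^ 2) ^ (2 : ℝ)⁻¹ = c := by
    rw [← ENNReal.rpow_natCast, ← ENNReal.rpow_mul]; norm_num
  rw [← h2, ENNReal.rpow_lt_rpow_iff (by norm_num), iInf_lt_iff] at h
  obtain ⟨⟨π, h3, h4⟩, h5⟩ := h
  exact ⟨π, h3, h4, h5⟩

/-- The easy half of Kantorovich duality: integrate the Lipschitz bound against a nearly optimal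
plan and pass from the first to the second moment of the displacement. Near optimality suffices, so
no existence of optimal plans is used. -/
theorem abs_integral_sub_le_of_W2 [IsProbabilityMeasure ρ] {c : ℝ} (hc : 0 ≤ c)
    (h : W2 ρ ν ≤ ENNReal.ofReal c) {g : Space d → ℝ} {l : ℝ≥0} (hg : LipschitzWith l g)
    (hb : ∃ B, ∀ x, |g x| ≤ B) : |∫ x, g x ∂ρ - ∫ x, g x ∂ν| ≤ l * c := by
  obtain ⟨B, hB⟩ := hb
  have key : ∀ e, 0 < e → |∫ x, g x ∂ρ - ∫ x, g x ∂ν| ≤ l * (c + e) := by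
    intro e he
    obtain ⟨π, h1, h2, h3⟩ := exists_coupling_lt (h.trans_lt
      ((ENNReal.ofReal_lt_ofReal_iff (by positivity)).2 (by linarith : c < c + e)))
    have hπ : IsProbabilityMeasure π := by
      refine ⟨?_⟩
      have h4 : π.map Prod.fst univ = 1 := by rw [h1]; exact measure_univ
      rwa [Measure.map_apply measurable_fst MeasurableSet.univ, preimage_univ] at h4
    have hgm : StronglyMeasurable g := hg.continuous.stronglyMeasurable
    have hgi : ∀ p : Space d × Space d → Space d, Measurable p → Integrable (fun z => g (p z)) π :=
      fun p hp => Integrable.of_bound (hgm.comp_measurable hp).aestronglyMeasurable B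
        (Eventually.of_forall fun z => hB _)
    rw [← h1, ← h2, integral_map measurable_fst.aemeasurable hgm.aestronglyMeasurable,
      integral_map measurable_snd.aemeasurable hgm.aestronglyMeasurable,
      ← integral_sub (hgi _ measurable_fst) (hgi _ measurable_snd)]
    have hce : 0 ≤ c + e := by positivity
    have h5 : eLpNorm (fun z : Space d × Space d => z.1 - z.2) 2 π ≤ ENNReal.ofReal (c + e) := by
      rw [eLpNorm_eq_lintegral_rpow_enorm_toReal (by norm_num) (by norm_num)]
      simp only [ENNReal.toReal_ofNat, ENNReal.rpow_ofNat]
      rw [one_div, ENNReal.rpow_inv_le_iff (by norm_num), ENNReal.rpow_ofNat]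
      exact h3.le
    have hm : AEStronglyMeasurable (fun z : Space d × Space d => z.1 - z.2) π :=
      Continuous.aestronglyMeasurable (by fun_prop)
    have h6 : eLpNorm (fun z : Space d × Space d => z.1 - z.2) 1 π ≤ ENNReal.ofReal (c + e) :=
      (eLpNorm_le_eLpNorm_of_exponent_le (by norm_num) hm).trans h5
    have h7 : Integrable (fun z : Space d × Space d => z.1 - z.2) π :=
      memLp_one_iff_integrable.1 ⟨hm, h6.trans_lt ENNReal.ofReal_lt_top⟩
    have h8 : ∫ z, ‖z.1 - z.2‖ ∂π ≤ c + e := by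
      rw [← ENNReal.ofReal_le_ofReal_iff hce, ofReal_integral_norm_eq_lintegral_enorm h7]
      rwa [eLpNorm_one_eq_lintegral_enorm] at h6
    calc |∫ z, (g z.1 - g z.2) ∂π| ≤ ∫ z, |g z.1 - g z.2| ∂π := abs_integral_le_integral_abs
      _ ≤ ∫ z, l * ‖z.1 - z.2‖ ∂π := by
          refine integral_mono ((hgi _ measurable_fst).sub (hgi _ measurable_snd)).abs
            (h7.norm.const_mul _) fun z => ?_
          have := hg.dist_le_mul z.1 z.2
          rwa [Real.dist_eq, dist_eq_norm] at this
      _ = l * ∫ z, ‖z.1 - z.2‖ ∂π := integral_const_mul _ _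
      _ ≤ l * (c + e) := by gcongr
  have hl : Tendsto (fun e : ℝ => (l : ℝ) * (c + e)) (𝓝[>] 0) (𝓝 (l * c)) := by
    have : Continuous fun e : ℝ => (l : ℝ) * (c + e) := by fun_prop
    have h := (this.tendsto 0).mono_left (nhdsWithin_le_nhds (s := Ioi 0))
    simpa using h
  exact ge_of_tendsto hl (eventually_mem_nhdsWithin.mono fun e he => key e he)

theorem secondMoment_le_of_W2 {c : ℝ≥0∞} (h : W2 ρ ν < c) :
    secondMoment ρ ≤ 2 * c ^ 2 + 2 * secondMoment ν := by
  obtain ⟨π, h1, h2, h3⟩ := exists_coupling_lt h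
  have hm : Measurable fun x : Space d => ‖x‖ₑ ^ 2 := by fun_prop
  rw [secondMoment, secondMoment, ← h1, ← h2, lintegral_map hm measurable_fst,
    lintegral_map hm measurable_snd]
  calc ∫⁻ z, ‖z.1‖ₑ ^ 2 ∂π ≤ ∫⁻ z, (2 * ‖z.1 - z.2‖ₑ ^ 2 + 2 * ‖z.2‖ₑ ^ 2) ∂π := by
        refine lintegral_mono fun z => ?_
        simp only [← ofReal_norm]
        rw [← ENNReal.ofReal_pow (norm_nonneg _), ← ENNReal.ofReal_pow (norm_nonneg _),
          ← ENNReal.ofReal_pow (norm_nonneg _)]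
        have h4 : ‖z.1‖ ≤ ‖z.1 - z.2‖ + ‖z.2‖ := by
          simpa using norm_add_le (z.1 - z.2) z.2
        have h5 : ‖z.1‖ ^ 2 ≤ 2 * ‖z.1 - z.2‖ ^ 2 + 2 * ‖z.2‖ ^ 2 := by
          nlinarith [norm_nonneg z.1, sq_nonneg (‖z.1 - z.2‖ - ‖z.2‖)]
        have h6 := ENNReal.ofReal_le_ofReal h5
        rwa [ENNReal.ofReal_add (by positivity) (by positivity), ENNReal.ofReal_mul (by norm_num),
          ENNReal.ofReal_mul (by norm_num), ENNReal.ofReal_ofNat] at h6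
    _ = 2 * ∫⁻ z, ‖z.1 - z.2‖ₑ ^ 2 ∂π + 2 * ∫⁻ z, ‖z.2‖ₑ ^ 2 ∂π := by
        rw [lintegral_add_right _ (by fun_prop), lintegral_const_mul _ (by fun_prop),
          lintegral_const_mul _ (by fun_prop)]
    _ ≤ _ := by gcongr

/-- Uniform continuity in time of an absolutely continuous curve against Lipschitz functions. -/
theorem IsAC2.time {ρ : ℝ → Measure (Space d)} (hρ : IsAC2 ρ) {T : ℝ} (hT : 0 < T) {η : ℝ}
    (hη : 0 < η) : ∃ τ, 0 < τ ∧ ∀ s t, |s - t| ≤ τ → ∀ (g : Space d → ℝ) (l : ℝ≥0),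
    LipschitzWith l g → (∃ B, ∀ x, |g x| ≤ B) →
    |∫ x, g x ∂ρ (clamp T s) - ∫ x, g x ∂ρ (clamp T t)| ≤ l * η := by
  obtain ⟨hp, m, hm, hW⟩ := hρ
  have hmi : IntegrableOn m (Icc 0 T) := (hm T hT).integrable (by norm_num)
  have hmii : ∀ a b, a ∈ Icc 0 T → b ∈ Icc 0 T → IntervalIntegrable m volume a b := fun a b ha hb =>
    (hmi.mono_set (uIcc_subset_Icc ha hb)).intervalIntegrable
  have hc : ContinuousOn (fun t => ∫ τ in (0 : ℝ)..t, m τ) (Icc 0 T) := by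
    have := intervalIntegral.continuousOn_primitive_interval (μ := volume) (f := m) (a := 0) (b := T)
      (by rwa [uIcc_of_le hT.le])
    rwa [uIcc_of_le hT.le] at this
  have huc := isCompact_Icc.uniformContinuousOn_of_continuous hc
  rw [Metric.uniformContinuousOn_iff] at huc
  obtain ⟨τ, hτ, h⟩ := huc η hη
  have key : ∀ s t, s ∈ Icc 0 T → t ∈ Icc 0 T → s ≤ t → |s - t| < τ →
      ∀ (g : Space d → ℝ) (l : ℝ≥0), LipschitzWith l g → (∃ B, ∀ x, |g x| ≤ B) →
      |∫ x, g x ∂ρ t - ∫ x, g x ∂ρ s| ≤ l * η := by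
    intro s t hs ht hst hd g l hg hb
    have := (hp t ht.1).1
    refine abs_integral_sub_le_of_W2 hη.le ((hW s t hs.1 hst).trans
      (ENNReal.ofReal_le_ofReal ?_)) hg hb
    have h1 := h t ht s hs (by rw [dist_comm, Real.dist_eq]; exact hd)
    rw [Real.dist_eq, intervalIntegral.integral_interval_sub_left
      (hmii _ _ ⟨le_rfl, hT.le⟩ ht) (hmii _ _ ⟨le_rfl, hT.le⟩ hs)] at h1
    exact (le_abs_self _).trans h1.le
  refine ⟨τ / 2, half_pos hτ, fun s t hst g l hg hb => ?_⟩
  have h1 : |clamp T s - clamp T t| < τ := (abs_clamp_sub_le s t).trans_lt (by linarith)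
  rcases le_total (clamp T s) (clamp T t) with h2 | h2
  · rw [abs_sub_comm]
    exact key _ _ (clamp_mem hT.le _) (clamp_mem hT.le _) h2 h1 g l hg hb
  · exact key _ _ (clamp_mem hT.le _) (clamp_mem hT.le _) h2 (by rwa [abs_sub_comm]) g l hg hb

end Wasserstein

/-! ### From space-time test functions to bounded test functions in space -/

section TestFunctions

variable {d : ℕ}

/-- A compactly supported `C¹` function is a uniform `C¹` limit of test functions. -/
theorem exists_smooth_near {g : Space d → ℝ} (hg : ContDiff ℝ 1 g) (hgc : HasCompactSupport g)
    {e : ℝ} (he : 0 < e) : ∃ χ : Space d → ℝ, ContDiff ℝ ∞ χ ∧ HasCompactSupport χ ∧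
      (∀ x, |χ x - g x| ≤ e) ∧ ∀ x, ‖fderiv ℝ χ x - fderiv ℝ g x‖ ≤ e := by
  have hg' : Continuous (fderiv ℝ g) := hg.continuous_fderiv (by norm_num)
  have hu1 := Metric.uniformContinuous_iff.1 (hgc.uniformContinuous_of_continuous hg.continuous) e he
  have hu2 := Metric.uniformContinuous_iff.1
    ((hgc.fderiv ℝ).uniformContinuous_of_continuous hg') e he
  obtain ⟨r₁, hr₁, h1⟩ := hu1
  obtain ⟨r₂, hr₂, h2⟩ := hu2
  let φ : ContDiffBump (0 : Space d) :=
    ⟨min r₁ r₂ / 2, min r₁ r₂, by positivity, half_lt_self (by positivity)⟩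
  have hφ : ContDiff ℝ ∞ (φ.normed volume) := φ.contDiff_normed
  have hφc : HasCompactSupport (φ.normed volume) := φ.hasCompactSupport_normed
  refine ⟨convolution (φ.normed volume) g (ContinuousLinearMap.lsmul ℝ ℝ) volume, ?_, ?_, ?_, ?_⟩
  · exact hφc.contDiff_convolution_left _ hφ hg.continuous.locallyIntegrable
  · exact hφc.convolution _ hgc
  · intro x
    have := φ.dist_normed_convolution_le (μ := volume) (g := g) (x₀ := x) (ε := e)
      hg.continuous.aestronglyMeasurable (fun y hy => (h1
        (lt_of_lt_of_le (Metric.mem_ball.1 hy) (min_le_left _ _))).le)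
    rwa [Real.dist_eq] at this
  · intro x
    have h3 := hgc.hasFDerivAt_convolution_right (ContinuousLinearMap.lsmul ℝ ℝ) (μ := volume)
      (hφ.continuous.locallyIntegrable (μ := volume)) hg x
    rw [h3.fderiv, ← dist_eq_norm]
    have h4 := φ.dist_normed_convolution_le (μ := volume) (g := fderiv ℝ g) (x₀ := x) (ε := e)
      hg'.aestronglyMeasurable (fun y hy => (h2
        (lt_of_lt_of_le (Metric.mem_ball.1 hy) (min_le_right _ _))).le)
    have h5 : (ContinuousLinearMap.lsmul ℝ ℝ : ℝ →L[ℝ] ℝ →L[ℝ] ℝ).precompR (Space d) =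
        (ContinuousLinearMap.lsmul ℝ ℝ : ℝ →L[ℝ] (Space d →L[ℝ] ℝ) →L[ℝ] (Space d →L[ℝ] ℝ)) := by
      ext
      simp
    rw [h5]
    exact h4

/-- A bounded `C¹` function with bounded derivative is a bounded pointwise `C¹` limit of test
functions. -/
theorem exists_smooth_approx {ψ : Space d → ℝ} (hψ : ContDiff ℝ 1 ψ) (hB : ∃ B, ∀ x, |ψ x| ≤ B)
    (hB' : ∃ B, ∀ x, ‖fderiv ℝ ψ x‖ ≤ B) : ∃ (χ : ℕ → Space d → ℝ) (C : ℝ),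
      (∀ n, ContDiff ℝ ∞ (χ n) ∧ HasCompactSupport (χ n)) ∧
      (∀ n x, |χ n x| ≤ C) ∧ (∀ n x, ‖fderiv ℝ (χ n) x‖ ≤ C) ∧
      (∀ x, Tendsto (fun n => χ n x) atTop (𝓝 (ψ x))) ∧
      ∀ x, Tendsto (fun n => fderiv ℝ (χ n) x) atTop (𝓝 (fderiv ℝ ψ x)) := by
  obtain ⟨B, hB⟩ := hB
  obtain ⟨B', hB'⟩ := hB'
  let b : ContDiffBump (0 : Space d) := ⟨1, 2, by norm_num, by norm_num⟩
  have hb : ContDiff ℝ ∞ b := b.contDiff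
  have hbc : HasCompactSupport b := b.hasCompactSupport
  obtain ⟨D, hD⟩ := (hbc.fderiv ℝ).exists_bound_of_continuous (hb.continuous_fderiv (by simp))
  have hB0 : 0 ≤ B := (abs_nonneg _).trans (hB 0)
  have hB0' : 0 ≤ B' := (norm_nonneg _).trans (hB' 0)
  have hD0 : 0 ≤ D := (norm_nonneg _).trans (hD 0)
  set c : ℕ → ℝ := fun n => ((n : ℝ) + 1)⁻¹ with hc
  have hc0 : ∀ n, 0 < c n := fun n => by positivity
  have hc1 : ∀ n, c n ≤ 1 := fun n => inv_le_one_of_one_le₀ (by simp)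
  have hclim : Tendsto c atTop (𝓝 0) := by
    simpa [hc, one_div] using tendsto_one_div_add_atTop_nhds_zero_nat (𝕜 := ℝ)
  set g : ℕ → Space d → ℝ := fun n x => b (c n • x) * ψ x with hg
  have hgd : ∀ n, ContDiff ℝ 1 (g n) := fun n =>
    ((hb.of_le (by simp)).comp (contDiff_const_smul (c n))).mul hψ
  have hgc : ∀ n, HasCompactSupport (g n) := fun n =>
    (hbc.comp_smul (hc0 n).ne').mul_right
  have hgf : ∀ n x, ‖fderiv ℝ (g n) x‖ ≤ B' + D * B := by
    intro n x
    have h1 : HasFDerivAt (fun x => b (c n • x)) ((fderiv ℝ b (c n • x)).comp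
        (c n • ContinuousLinearMap.id ℝ (Space d))) x :=
      ((hb.differentiable (by simp) _).hasFDerivAt).comp x ((hasFDerivAt_id x).const_smul (c n))
    have h2 := h1.mul (hψ.differentiable (by norm_num) x).hasFDerivAt
    rw [show fderiv ℝ (g n) x = _ from h2.fderiv]
    refine (norm_add_le _ _).trans (add_le_add ?_ ?_)
    · rw [norm_smul, Real.norm_of_nonneg b.nonneg]
      exact (mul_le_mul b.le_one (hB' x) (norm_nonneg _) zero_le_one).trans (by simp)
    · rw [norm_smul, Real.norm_eq_abs, mul_comm]
      refine mul_le_mul ?_ (hB x) (abs_nonneg _) hD0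
      refine (ContinuousLinearMap.opNorm_comp_le _ _).trans ?_
      rw [norm_smul, Real.norm_of_nonneg (hc0 n).le]
      calc ‖fderiv ℝ b (c n • x)‖ * (c n * ‖ContinuousLinearMap.id ℝ (Space d)‖) ≤ D * (1 * 1) := by
            gcongr
            · exact hD _
            · exact hc1 n
            · exact ContinuousLinearMap.norm_id_le
        _ = D := by ring
  have hev : ∀ x, ∀ᶠ n in atTop, g n =ᶠ[𝓝 x] ψ := by
    intro x
    have h1 : Tendsto (fun n => c n * (‖x‖ + 1)) atTop (𝓝 0) := by
      simpa using hclim.mul_const (‖x‖ + 1)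
    filter_upwards [h1.eventually (Iio_mem_nhds one_pos)] with n hn
    filter_upwards [Metric.ball_mem_nhds x one_pos] with y hy
    have h2 : b (c n • y) = 1 := by
      refine b.one_of_mem_closedBall ?_
      rw [mem_closedBall_zero_iff, norm_smul, Real.norm_of_nonneg (hc0 n).le]
      have h3 : ‖y‖ ≤ ‖x‖ + 1 := by
        have := norm_sub_norm_le y x
        rw [mem_ball_iff_norm] at hy
        linarith
      exact (mul_le_mul_of_nonneg_left h3 (hc0 n).le).trans hn.le
    simp only [hg, h2, one_mul]
  choose χ hχ1 hχ2 hχ3 hχ4 using fun n => exists_smooth_near (hgd n) (hgc n) (hc0 n)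
  refine ⟨χ, B + (B' + D * B) + 1, fun n => ⟨hχ1 n, hχ2 n⟩, fun n x => ?_, fun n x => ?_,
    fun x => ?_, fun x => ?_⟩
  · have h1 : |g n x| ≤ B := by
      rw [hg, abs_mul, abs_of_nonneg b.nonneg]
      exact (mul_le_mul b.le_one (hB x) (abs_nonneg _) zero_le_one).trans (by simp)
    have h2 := abs_sub_abs_le_abs_sub (χ n x) (g n x)
    have h3 := hχ3 n x
    have h4 := hc1 n
    have h5 : 0 ≤ D * B := by positivity
    linarith
  · have h2 := norm_sub_norm_le (fderiv ℝ (χ n) x) (fderiv ℝ (g n) x)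
    have h3 := hχ4 n x
    have h4 := hc1 n
    have h5 := hgf n x
    linarith
  · have h1 : Tendsto (fun n => χ n x - g n x) atTop (𝓝 0) :=
      squeeze_zero_norm (fun n => hχ3 n x) hclim
    have h2 : Tendsto (fun n => g n x) atTop (𝓝 (ψ x)) :=
      tendsto_const_nhds.congr' ((hev x).mono fun n hn => hn.eq_of_nhds.symm)
    simpa using h1.add h2
  · have h1 : Tendsto (fun n => fderiv ℝ (χ n) x - fderiv ℝ (g n) x) atTop (𝓝 0) :=
      squeeze_zero_norm (fun n => hχ4 n x) hclim
    have h2 : Tendsto (fun n => fderiv ℝ (g n) x) atTop (𝓝 (fderiv ℝ ψ x)) :=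
      tendsto_const_nhds.congr' ((hev x).mono fun n hn => hn.fderiv_eq.symm)
    simpa using h1.add h2

/-! ### Localization of the weak equation in time -/

theorem continuous_of_modulus {F : ℝ → ℝ} {c : ℝ} (h : ∀ η, 0 < η → ∃ τ, 0 < τ ∧ ∀ s t,
    |s - t| ≤ τ → |F s - F t| ≤ c * η) : Continuous F := by
  rw [Metric.continuous_iff]
  intro t e he
  obtain ⟨τ, hτ, h⟩ := h (e / (2 * (|c| + 1))) (by positivity)
  refine ⟨τ, hτ, fun s hs => ?_⟩
  rw [Real.dist_eq] at hs ⊢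
  refine (h s t hs.le).trans_lt ?_
  calc c * (e / (2 * (|c| + 1))) ≤ (|c| + 1) * (e / (2 * (|c| + 1))) := by
        gcongr
        linarith [le_abs_self c]
    _ = e / 2 := by field_simp
    _ < e := half_lt_self he

/-- A smooth approximation of the indicator of `[s,∞)`. -/
def smoothStep (s h τ : ℝ) : ℝ := Real.smoothTransition ((τ - s) / h)

theorem contDiff_smoothStep (s h : ℝ) : ContDiff ℝ ∞ (smoothStep s h) :=
  Real.smoothTransition.contDiff.comp ((contDiff_id.sub contDiff_const).div_const h)

theorem smoothStep_of_le {s h τ : ℝ} (hh : 0 < h) (hτ : τ ≤ s) : smoothStep s h τ = 0 :=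
  Real.smoothTransition.zero_of_nonpos (div_nonpos_of_nonpos_of_nonneg (by linarith) hh.le)

theorem smoothStep_of_ge {s h τ : ℝ} (hh : 0 < h) (hτ : s + h ≤ τ) : smoothStep s h τ = 1 :=
  Real.smoothTransition.one_of_one_le (by rw [le_div_iff₀ hh]; linarith)

theorem monotone_smoothStep {s h : ℝ} (hh : 0 < h) : Monotone (smoothStep s h) := fun a b hab =>
  Real.smoothTransition.monotone (by gcongr)

/-- The derivative of the step is nonnegative, has unit mass and vanishes outside [s, s + h]: a
one-sided approximate identity at s. -/
theorem abs_integral_deriv_smoothStep_sub_le {P : ℝ → ℝ} (hP : Continuous P) {s h e T : ℝ}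
    (hh : 0 < h) (hs : 0 ≤ s) (hsT : s + h ≤ T) (hPe : ∀ τ ∈ Icc s (s + h), |P τ - P s| ≤ e) :
    |(∫ τ in (0 : ℝ)..T, deriv (smoothStep s h) τ * P τ) - P s| ≤ e := by
  have hT : 0 ≤ T := by linarith
  have hd : Differentiable ℝ (smoothStep s h) := (contDiff_smoothStep s h).differentiable (by simp)
  have hc : Continuous (deriv (smoothStep s h)) :=
    (contDiff_smoothStep s h).continuous_deriv (by simp)
  have h1 : ∫ τ in (0 : ℝ)..T, deriv (smoothStep s h) τ = 1 := by
    rw [intervalIntegral.integral_deriv_eq_sub (fun x _ => hd x) (hc.intervalIntegrable _ _),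
      smoothStep_of_le hh hs, smoothStep_of_ge hh hsT, sub_zero]
  have hi : ∀ g : ℝ → ℝ, Continuous g →
      IntervalIntegrable (fun τ => deriv (smoothStep s h) τ * g τ) volume 0 T := fun g hg =>
    (hc.mul hg).intervalIntegrable _ _
  have h2 : (∫ τ in (0 : ℝ)..T, deriv (smoothStep s h) τ * P τ) - P s =
      ∫ τ in (0 : ℝ)..T, deriv (smoothStep s h) τ * (P τ - P s) := by
    simp_rw [mul_sub (deriv (smoothStep s h) _)]
    rw [intervalIntegral.integral_sub (hi _ hP) (hi _ continuous_const), intervalIntegral.integral_mul_const, h1,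
      one_mul]
  have h3 : ∫ τ in (0 : ℝ)..T, deriv (smoothStep s h) τ * e = e := by
    rw [intervalIntegral.integral_mul_const, h1, one_mul]
  rw [h2, ← Real.norm_eq_abs]
  refine (intervalIntegral.norm_integral_le_of_norm_le hT (Eventually.of_forall fun τ _ => ?_)
    (hi (fun _ => e) continuous_const)).trans h3.le
  have h4 : 0 ≤ deriv (smoothStep s h) τ := (monotone_smoothStep hh).deriv_nonneg
  rw [norm_mul, Real.norm_of_nonneg h4, Real.norm_eq_abs]
  by_cases hτ : τ ∈ Icc s (s + h)
  · exact mul_le_mul_of_nonneg_left (hPe τ hτ) h4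
  · have h5 : deriv (smoothStep s h) τ = 0 := by
      rw [mem_Icc, not_and_or, not_le, not_le] at hτ
      rcases hτ with hτ | hτ
      · have : smoothStep s h =ᶠ[𝓝 τ] fun _ => 0 :=
          Filter.Eventually.mono (Iio_mem_nhds hτ) (fun y hy => smoothStep_of_le hh (le_of_lt hy))
        rw [this.deriv_eq, deriv_const]
      · have : smoothStep s h =ᶠ[𝓝 τ] fun _ => 1 :=
          Filter.Eventually.mono (Ioi_mem_nhds hτ) (fun y hy => smoothStep_of_ge hh (le_of_lt hy))
        rw [this.deriv_eq, deriv_const]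
    rw [h5, zero_mul, zero_mul]

/-- The lemma of du Bois-Reymond for continuous functions. -/
theorem sub_eq_integral_of_weak {F G : ℝ → ℝ} (hF : Continuous F) (hG : Continuous G) {T : ℝ}
    (h : ∀ α : ℝ → ℝ, ContDiff ℝ ∞ α → HasCompactSupport α → tsupport α ⊆ Ioo 0 T →
      ∫ t in (0 : ℝ)..T, (deriv α t * F t + α t * G t) = 0) {s t : ℝ} (hs : 0 ≤ s) (hst : s ≤ t)
    (htT : t ≤ T) : F t - F s = ∫ τ in s..t, G τ := by
  rcases hst.eq_or_lt with rfl | hst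
  · simp
  have hT : 0 < T := by linarith
  have hGi : ∀ a b, IntervalIntegrable G volume a b := fun a b => hG.intervalIntegrable a b
  -- An integration by parts turns the hypothesis into ∫ α' P = 0, so P must be constant.
  set P : ℝ → ℝ := fun t => F t - ∫ τ in (0 : ℝ)..t, G τ with hPdef
  have hIc : Continuous fun t => ∫ τ in (0 : ℝ)..t, G τ :=
    intervalIntegral.continuous_primitive hGi 0
  have hP : Continuous P := hF.sub hIc
  have key : ∀ s ∈ Ioo 0 T, ∀ t ∈ Ioo 0 T, s < t → P s = P t := by
    intro s hs t ht hst
    refine eq_of_abs_sub_le_all fun e he => ?_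
    obtain ⟨r₁, hr₁, h1⟩ := Metric.continuous_iff.1 hP s (e / 2) (half_pos he)
    obtain ⟨r₂, hr₂, h2⟩ := Metric.continuous_iff.1 hP t (e / 2) (half_pos he)
    obtain ⟨k, hk0, hk⟩ : ∃ k, 0 < k ∧ k < min (min r₁ r₂) (T - t) :=
      exists_between (lt_min (lt_min hr₁ hr₂) (sub_pos.2 ht.2))
    have hk1 : k < r₁ := hk.trans_le ((min_le_left _ _).trans (min_le_left _ _))
    have hk2 : k < r₂ := hk.trans_le ((min_le_left _ _).trans (min_le_right _ _))
    have hk3 : k < T - t := hk.trans_le (min_le_right _ _)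
    have e1 := abs_integral_deriv_smoothStep_sub_le hP (e := e / 2) hk0 hs.1.le
      (by linarith : s + k ≤ T) fun τ hτ => (h1 τ (by
        rw [Real.dist_eq, abs_of_nonneg (by linarith [hτ.1])]; linarith [hτ.2])).le
    have e2 := abs_integral_deriv_smoothStep_sub_le hP (e := e / 2) hk0 ht.1.le
      (by linarith : t + k ≤ T) fun τ hτ => (h2 τ (by
        rw [Real.dist_eq, abs_of_nonneg (by linarith [hτ.1])]; linarith [hτ.2])).le
    -- The difference of two steps is an admissible test function with support in [s, t + k]; its
    -- derivative averages P near s minus P near t.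
    set a := smoothStep s k with ha
    set b := smoothStep t k with hb
    have had : ContDiff ℝ ∞ a := contDiff_smoothStep s k
    have hbd : ContDiff ℝ ∞ b := contDiff_smoothStep t k
    have had' : Differentiable ℝ a := had.differentiable (by simp)
    have hbd' : Differentiable ℝ b := hbd.differentiable (by simp)
    have hac : Continuous (deriv a) := had.continuous_deriv (by simp)
    have hbc : Continuous (deriv b) := hbd.continuous_deriv (by simp)
    have hdd : ∀ τ, deriv (fun τ => a τ - b τ) τ = deriv a τ - deriv b τ := fun τ =>
      deriv_fun_sub (had' τ) (hbd' τ)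
    have hsupp : tsupport (fun τ => a τ - b τ) ⊆ Icc s (t + k) := by
      refine closure_minimal (fun τ hτ => ?_) isClosed_Icc
      by_contra hτ'
      apply hτ
      rw [mem_Icc, not_and_or, not_le, not_le] at hτ'
      rcases hτ' with hτ' | hτ'
      · simp only [ha, hb]
        rw [smoothStep_of_le hk0 hτ'.le, smoothStep_of_le hk0 (by linarith), sub_zero]
      · simp only [ha, hb]
        rw [smoothStep_of_ge hk0 (by linarith), smoothStep_of_ge hk0 hτ'.le, sub_self]
    have h3 := h (fun τ => a τ - b τ) (had.sub hbd)
      (HasCompactSupport.of_support_subset_isCompact isCompact_Icc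
        ((subset_tsupport _).trans hsupp))
      (hsupp.trans fun τ hτ => ⟨hs.1.trans_le hτ.1, by linarith [hτ.2]⟩)
    simp only [hdd] at h3
    have h4 := intervalIntegral.integral_mul_deriv_eq_deriv_mul (a := 0) (b := T)
      (u := fun τ => a τ - b τ) (v := fun t => ∫ τ in (0 : ℝ)..t, G τ)
      (u' := fun τ => deriv a τ - deriv b τ) (v' := G)
      (fun x _ => (had' x).hasDerivAt.sub (hbd' x).hasDerivAt)
      (fun x _ => hG.integral_hasStrictDerivAt 0 x |>.hasDerivAt)
      ((hac.sub hbc).intervalIntegrable _ _) (hGi _ _)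
    have e3 : a T - b T = 0 := by
      rw [ha, hb, smoothStep_of_ge hk0 (by linarith), smoothStep_of_ge hk0 (by linarith), sub_self]
    have e4 : a 0 - b 0 = 0 := by
      rw [ha, hb, smoothStep_of_le hk0 hs.1.le, smoothStep_of_le hk0 ht.1.le, sub_self]
    simp only [e3, e4, zero_mul, zero_sub, neg_zero] at h4
    have hai : Continuous a := had.continuous
    have hbi : Continuous b := hbd.continuous
    have i1 : IntervalIntegrable (fun τ => (deriv a τ - deriv b τ) * F τ) volume 0 T :=
      Continuous.intervalIntegrable (by fun_prop) _ _
    have i2 : IntervalIntegrable (fun τ => (a τ - b τ) * G τ) volume 0 T :=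
      Continuous.intervalIntegrable (by fun_prop) _ _
    have i3 : IntervalIntegrable (fun t => (deriv a t - deriv b t) * ∫ τ in (0 : ℝ)..t, G τ)
      volume 0 T := Continuous.intervalIntegrable (by fun_prop) _ _
    have i4 : IntervalIntegrable (fun τ => deriv a τ * P τ) volume 0 T :=
      Continuous.intervalIntegrable (by fun_prop) _ _
    have i5 : IntervalIntegrable (fun τ => deriv b τ * P τ) volume 0 T :=
      Continuous.intervalIntegrable (by fun_prop) _ _
    rw [intervalIntegral.integral_add i1 i2, h4,
      ← sub_eq_add_neg, ← intervalIntegral.integral_sub i1 i3] at h3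
    have h5 : (∫ τ in (0 : ℝ)..T, deriv a τ * P τ) - (∫ τ in (0 : ℝ)..T, deriv b τ * P τ) = 0 := by
      rw [← intervalIntegral.integral_sub i4 i5]
      refine (intervalIntegral.integral_congr fun τ _ => ?_).trans h3
      simp only [hPdef]
      ring
    rw [abs_le] at e1 e2 ⊢
    constructor <;> linarith [e1.1, e1.2, e2.1, e2.2]
  -- Test functions do not see the endpoints, which are reached by continuity of P.
  have key2 : ∀ s ∈ Icc 0 T, P s = P (T / 2) := by
    have h1 : closure (Ioo 0 T) = Icc 0 T := closure_Ioo hT.ne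
    rw [← h1]
    have h2 : IsClosed {s | P s = P (T / 2)} := isClosed_eq hP continuous_const
    refine fun s hs => closure_minimal (fun s hs => ?_) h2 hs
    have h3 : T / 2 ∈ Ioo 0 T := ⟨by linarith, by linarith⟩
    rcases lt_trichotomy s (T / 2) with h4 | h4 | h4
    · exact key s hs _ h3 h4
    · rw [mem_ofPred_eq, h4]
    · exact (key _ h3 s hs h4).symm
  have h1 := (key2 s ⟨hs, by linarith⟩).trans (key2 t ⟨by linarith, htT⟩).symm
  simp only [hPdef] at h1
  rw [← intervalIntegral.integral_interval_sub_left (hGi 0 t) (hGi 0 s)]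
  linarith

variable {u : ℝ → Space d → Space d} {A : ℝ → Space d → Space d →L[ℝ] Space d}
  {M L K T : ℝ} {ρ : ℝ → Measure (Space d)}

theorem exists_isTest {χ : Space d → ℝ} (hχ : ContDiff ℝ ∞ χ) (hc : HasCompactSupport χ) :
    ∃ a, IsTest a χ := by
  obtain ⟨B, hB⟩ := hc.exists_bound_of_continuous hχ.continuous
  obtain ⟨D, hD⟩ := (hc.fderiv ℝ).exists_bound_of_continuous (hχ.continuous_fderiv (by simp))
  obtain ⟨l, hl⟩ := ContDiff.lipschitzWith_of_hasCompactSupport (𝕂 := ℝ) (n := 1) (hc.fderiv ℝ)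
    ((contDiff_infty.1 hχ 2).fderiv_right (by norm_num)) (by norm_num)
  refine ⟨max D l, hχ.of_le (by exact_mod_cast le_top), ⟨B, hB⟩,
    fun x => (hD x).trans (le_max_left _ _), fun x y => ?_⟩
  have := hl.dist_le_mul x y
  rw [dist_eq_norm, dist_eq_norm] at this
  exact this.trans (mul_le_mul_of_nonneg_right (le_max_right _ _) (norm_nonneg _))

/-- Testing against products of test functions in time and space suffices. -/
theorem isWeakCurve_of_test (hp : ∀ t, IsProbabilityMeasure (ρ t)) (hu : IsRegularField u A M L K)
    (htime : ∀ η, 0 < η → ∃ τ, 0 < τ ∧ ∀ s t, |s - t| ≤ τ → ∀ (g : Space d → ℝ) (l : ℝ≥0),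
      LipschitzWith l g → (∃ B, ∀ x, |g x| ≤ B) → |∫ x, g x ∂ρ s - ∫ x, g x ∂ρ t| ≤ l * η)
    (h : ∀ (α : ℝ → ℝ) (χ : Space d → ℝ), ContDiff ℝ ∞ α → HasCompactSupport α →
      tsupport α ⊆ Ioo 0 T → ContDiff ℝ ∞ χ → HasCompactSupport χ →
      ∫ t in (0 : ℝ)..T, ∫ x, (deriv α t * χ x + α t * fderiv ℝ χ x (u t x)) ∂ρ t = 0) :
    IsWeakCurve u T ρ := by
  have hcc : ∀ χ : Space d → ℝ, ContDiff ℝ ∞ χ → HasCompactSupport χ →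
      Continuous fun t => ∫ x, fderiv ℝ χ x (u t x) ∂ρ t := by
    intro χ hχ hc
    obtain ⟨a, ha⟩ := exists_isTest hχ hc
    refine continuous_of_modulus (c := a * (1 + M + L)) fun η hη => ?_
    obtain ⟨τ₁, hτ₁, h1⟩ := htime η hη
    obtain ⟨τ₂, hτ₂, h2⟩ := hu.time η hη
    refine ⟨min τ₁ τ₂, lt_min hτ₁ hτ₂, fun s t hst => ?_⟩
    rw [mul_assoc]
    exact pairing_close hp hu ha
      (fun s t hst x => (h2 s t (hst.trans (min_le_right _ _)) x).1)
      (fun s t hst => h1 s t (hst.trans (min_le_left _ _))) hst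
  have smooth : ∀ χ : Space d → ℝ, ContDiff ℝ ∞ χ → HasCompactSupport χ → ∀ s t, 0 ≤ s → s ≤ t →
      t ≤ T → ∫ x, χ x ∂ρ t - ∫ x, χ x ∂ρ s = ∫ τ in s..t, ∫ x, fderiv ℝ χ x (u τ x) ∂ρ τ := by
    intro χ hχ hc s t hs hst htT
    obtain ⟨a, ha⟩ := exists_isTest hχ hc
    refine sub_eq_integral_of_weak (F := fun t => ∫ x, χ x ∂ρ t) ?_ (hcc χ hχ hc)
      (fun α hα hαc hαs => ?_) hs hst htT
    · refine continuous_of_modulus (c := a.toNNReal) fun η hη => ?_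
      obtain ⟨τ, hτ, h1⟩ := htime η hη
      exact ⟨τ, hτ, fun s t hst => h1 s t hst χ _ ha.lipschitz ha.bdd⟩
    · refine (intervalIntegral.integral_congr fun τ _ => ?_).trans (h α χ hα hαc hαs hχ hc)
      obtain ⟨B, hB⟩ := ha.bdd
      have hi1 : Integrable χ (ρ τ) := Integrable.of_bound hχ.continuous.aestronglyMeasurable B
        (Eventually.of_forall hB)
      have hi2 : Integrable (fun x => fderiv ℝ χ x (u τ x)) (ρ τ) :=
        Integrable.of_bound
          (ha.continuous_fderiv.clm_apply (hu.continuous_field τ)).aestronglyMeasurable (a * M)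
          (Eventually.of_forall fun x => (ContinuousLinearMap.le_opNorm _ _).trans
            (mul_le_mul (ha.fderiv_le x) (hu.norm_le τ x) (norm_nonneg _) ha.nonneg))
      rw [integral_add (hi1.const_mul _) (hi2.const_mul _), integral_const_mul, integral_const_mul]
  refine ⟨hp, fun ψ hψ hB hB' s t hs hst htT => ?_, htime⟩
  -- Only now are bounded C¹ functions without compact support admitted, through bounded pointwise
  -- C¹ convergence; the pressure is such a function.
  obtain ⟨χ, C, hχ, hχC, hχC', hlim, hlim'⟩ := exists_smooth_approx hψ hB hB'
  have hdom : ∀ t, Tendsto (fun n => ∫ x, χ n x ∂ρ t) atTop (𝓝 (∫ x, ψ x ∂ρ t)) := fun t =>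
    tendsto_integral_of_dominated_convergence (fun _ => C)
      (fun n => (hχ n).1.continuous.aestronglyMeasurable) (integrable_const _)
      (fun n => Eventually.of_forall (hχC n)) (Eventually.of_forall hlim)
  have hC0 : 0 ≤ C := (norm_nonneg _).trans (hχC' 0 0)
  have hbd : ∀ n τ x, ‖fderiv ℝ (χ n) x (u τ x)‖ ≤ C * M := fun n τ x =>
    (ContinuousLinearMap.le_opNorm _ _).trans
      (mul_le_mul (hχC' n x) (hu.norm_le τ x) (norm_nonneg _) hC0)
  have hdom' : ∀ τ, Tendsto (fun n => ∫ x, fderiv ℝ (χ n) x (u τ x) ∂ρ τ) atTop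
      (𝓝 (∫ x, fderiv ℝ ψ x (u τ x) ∂ρ τ)) := fun τ =>
    tendsto_integral_of_dominated_convergence (fun _ => C * M)
      (fun n => (((hχ n).1.continuous_fderiv (by simp)).clm_apply
        (hu.continuous_field τ)).aestronglyMeasurable) (integrable_const _)
      (fun n => Eventually.of_forall (hbd n τ))
      (Eventually.of_forall fun x =>
        ((ContinuousLinearMap.apply ℝ ℝ (u τ x)).continuous.tendsto _).comp (hlim' x))
  refine tendsto_nhds_unique ((hdom t).sub (hdom s)) ?_
  have h1 : ∀ n, ∫ x, χ n x ∂ρ t - ∫ x, χ n x ∂ρ s =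
      ∫ τ in s..t, ∫ x, fderiv ℝ (χ n) x (u τ x) ∂ρ τ := fun n =>
    smooth (χ n) (hχ n).1 (hχ n).2 s t hs hst htT
  simp only [h1]
  refine intervalIntegral.tendsto_integral_filter_of_dominated_convergence (fun _ => C * M)
    (Eventually.of_forall fun n => (hcc (χ n) (hχ n).1 (hχ n).2).aestronglyMeasurable)
    (Eventually.of_forall fun n => Eventually.of_forall fun τ _ => ?_) intervalIntegrable_const
    (Eventually.of_forall fun τ _ => hdom' τ)
  have := hp τ
  simpa using norm_integral_le_of_norm_le_const (μ := ρ τ) (Eventually.of_forall (hbd n τ))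

end TestFunctions

end NonlocalDiffusion

end

noncomputable section

namespace NonlocalDiffusion

/-! ### The velocity field of the regularized equation -/

section Drift

variable {d : ℕ} {f : ℝ → EReal} {φ : Space d → ℝ} {γ ε M T : ℝ} {ρ : ℝ → Measure (Space d)}
  {v : ℝ → Space d → Space d} {V : ℝ → Space d → Space d →L[ℝ] Space d} {Mv Lv Kv : ℝ}

/-- The velocity is prescribed only for t ≥ 0. Clamping the time to [0,T] extends it to all times
and keeps the moduli of continuity, since the clamp is nonexpansive. -/
theorem IsSmoothVelocity.exists_isRegularField (hv : IsSmoothVelocity v) (hT : 0 ≤ T) :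
    ∃ M L K, IsRegularField (fun t => v (clamp T t)) (fun t x => fderiv ℝ (v (clamp T t)) x)
      M L K := by
  obtain ⟨w, hw, hwc, hvw⟩ := hv
  have hvt : ∀ t, v (clamp T t) = fun x => w (clamp T t, x) := fun t =>
    funext fun x => hvw _ (clamp_mem hT t).1 x
  obtain ⟨C, hC⟩ := hwc.exists_bound_of_continuous hw.continuous
  obtain ⟨D, hD⟩ := (hwc.fderiv ℝ).exists_bound_of_continuous (hw.continuous_fderiv (by simp))
  obtain ⟨l, hl⟩ := ContDiff.lipschitzWith_of_hasCompactSupport (𝕂 := ℝ) (n := 1) hwc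
    (contDiff_infty.1 hw 1) (by norm_num)
  obtain ⟨l', hl'⟩ := ContDiff.lipschitzWith_of_hasCompactSupport (𝕂 := ℝ) (n := 1) (hwc.fderiv ℝ)
    ((contDiff_infty.1 hw 2).fderiv_right (by norm_num)) (by norm_num)
  set I := ContinuousLinearMap.inr ℝ ℝ (Space d) with hI
  have hIn : ‖I‖ ≤ 1 := ContinuousLinearMap.norm_inr_le_one ℝ ℝ (Space d)
  have hder : ∀ t x, HasFDerivAt (v (clamp T t)) ((fderiv ℝ w (clamp T t, x)).comp I) x := by
    intro t x
    rw [hvt t]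
    exact ((hw.differentiable (by simp) _).hasFDerivAt).comp x (hasFDerivAt_prodMk_right _ x)
  have hcomp : ∀ B : ℝ × Space d →L[ℝ] Space d, ‖B.comp I‖ ≤ ‖B‖ := fun B =>
    (ContinuousLinearMap.opNorm_comp_le _ _).trans
      ((mul_le_mul_of_nonneg_left hIn (norm_nonneg _)).trans (mul_one _).le)
  refine ⟨C, D, l', fun t x => ?_, fun t x => ?_, fun t x => ?_, fun t x y => ?_, l'.2,
    fun η hη => ?_⟩
  · rw [hvt t]; exact hC _
  · exact (hder t x).differentiableAt.hasFDerivAt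
  · rw [(hder t x).fderiv]
    exact (hcomp _).trans (hD _)
  · rw [(hder t x).fderiv, (hder t y).fderiv, ← ContinuousLinearMap.sub_comp]
    refine (hcomp _).trans ?_
    have := hl'.norm_sub_le (clamp T t, x) (clamp T t, y)
    rwa [Prod.mk_sub_mk, sub_self, Prod.norm_mk, norm_zero, max_eq_right (norm_nonneg _)] at this
  · refine ⟨η / (max l l' + 1), by positivity, fun s t hst x => ?_⟩
    have h1 : ∀ c : ℝ≥0, c ≤ max l l' → (c : ℝ) * |clamp T s - clamp T t| ≤ η := fun c hc => by
      have hc' : (c : ℝ) ≤ max l l' := by exact_mod_cast hc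
      calc (c : ℝ) * |clamp T s - clamp T t| ≤ (max l l' + 1) * (η / (max l l' + 1)) := by
            gcongr
            · linarith
            · exact (abs_clamp_sub_le s t).trans hst
        _ = η := by field_simp
    have h2 : ∀ s t : ℝ, ‖((s, x) : ℝ × Space d) - (t, x)‖ = |s - t| := fun s t => by
      rw [Prod.mk_sub_mk, sub_self, Prod.norm_mk, norm_zero, max_eq_left (norm_nonneg _),
        Real.norm_eq_abs]
    constructor
    · rw [hvt, hvt]
      have := hl.norm_sub_le (clamp T s, x) (clamp T t, x)
      rw [h2] at this
      exact this.trans (h1 _ (le_max_left _ _))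
    · rw [(hder s x).fderiv, (hder t x).fderiv, ← ContinuousLinearMap.sub_comp]
      refine (hcomp _).trans ?_
      have := hl'.norm_sub_le (clamp T s, x) (clamp T t, x)
      rw [h2] at this
      exact this.trans (h1 _ (le_max_right _ _))

/-- The velocity field `-(∇p + v)` transporting the solution. -/
def drift (f : ℝ → EReal) (φ : Space d → ℝ) (γ ε : ℝ) (v : ℝ → Space d → Space d)
    (ρ : ℝ → Measure (Space d)) (t : ℝ) (x : Space d) : Space d :=
  -(gradient (pressure f φ γ ε (ρ t)) x + v t x)

/-- The derivative of the velocity field. -/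
def driftDeriv (f : ℝ → EReal) (φ : Space d → ℝ) (γ ε : ℝ)
    (V : ℝ → Space d → Space d →L[ℝ] Space d)
    (ρ : ℝ → Measure (Space d)) (t : ℝ) (x : Space d) : Space d →L[ℝ] Space d :=
  -(conv (potential f φ γ ε (ρ t)) (fderiv ℝ (gradient (rescale φ ε))) x + V t x)

/-- Curves of probability measures with finite second moment, uniformly continuous in time against
Lipschitz functions. -/
structure IsRegularCurve (ρ : ℝ → Measure (Space d)) : Prop where
  prob : ∀ t, IsProbabilityMeasure (ρ t)
  moment : ∀ t, secondMoment (ρ t) < ⊤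
  time : ∀ η, 0 < η → ∃ τ, 0 < τ ∧ ∀ s t, |s - t| ≤ τ → ∀ (g : Space d → ℝ) (l : ℝ≥0),
    LipschitzWith l g → (∃ B, ∀ x, |g x| ≤ B) → |∫ x, g x ∂ρ s - ∫ x, g x ∂ρ t| ≤ l * η

theorem IsAC2.isRegularCurve (hρ : IsAC2 ρ) (hT : 0 < T) :
    IsRegularCurve fun t => ρ (clamp T t) :=
  ⟨fun t => (hρ.1 _ (clamp_mem hT.le t).1).1, fun t => (hρ.1 _ (clamp_mem hT.le t).1).2,
    fun _ hη => hρ.time hT hη⟩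

theorem IsRegularCurve.smoothed_time (hρ : IsRegularCurve ρ) (hk : IsKernel (rescale φ ε))
    (hM : IsKernelBound (rescale φ ε) M) {η : ℝ} (hη : 0 < η) : ∃ τ, 0 < τ ∧ ∀ s t,
    |s - t| ≤ τ → ∀ x, |smoothed φ ε (ρ s) x - smoothed φ ε (ρ t) x| ≤ η := by
  have hM0 := hM.nonneg
  obtain ⟨τ, hτ, h⟩ := hρ.time (η / (M + 1)) (by positivity)
  refine ⟨τ, hτ, fun s t hst x => ?_⟩
  have hl : LipschitzWith M.toNNReal fun y => rescale φ ε (x - y) := by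
    refine LipschitzWith.of_dist_le_mul fun y z => ?_
    refine ((hM.lipschitz hk).dist_le_mul _ _).trans (le_of_eq ?_)
    rw [dist_sub_left]
  refine (h s t hst _ _ hl ⟨M, fun y => (hM _).1⟩).trans ?_
  rw [Real.coe_toNNReal _ hM0]
  calc M * (η / (M + 1)) ≤ (M + 1) * (η / (M + 1)) := by gcongr; linarith
    _ = η := by field_simp

theorem IsRegularCurve.potential_time (hρ : IsRegularCurve ρ) (hf : IsEnergyDensity d f)
    (hγ : 0 < γ) (hk : IsKernel (rescale φ ε))
    (hM : IsKernelBound (rescale φ ε) M) {η : ℝ} (hη : 0 < η) : ∃ τ, 0 < τ ∧ ∀ s t,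
    |s - t| ≤ τ → ∀ x, |potential f φ γ ε (ρ s) x - potential f φ γ ε (ρ t) x| ≤ η := by
  obtain ⟨τ, hτ, h⟩ := hρ.smoothed_time hk hM (η := η / (γ + 1 / γ)) (by positivity)
  refine ⟨τ, hτ, fun s t hst x => ?_⟩
  have := hρ.prob s
  have := hρ.prob t
  refine (abs_potential_sub_le hf hγ hk x).trans ?_
  calc (γ + 1 / γ) * |smoothed φ ε (ρ s) x - smoothed φ ε (ρ t) x|
      ≤ (γ + 1 / γ) * (η / (γ + 1 / γ)) := by gcongr; exact h s t hst x
    _ = η := by field_simp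

/-- All derivatives fall on the kernel: ∇p and D²p are convolutions of the bounded function q with
integrable kernels, and D²p is Lipschitz because q is. Continuity in time comes from that of q,
uniformly in x. -/
theorem IsRegularCurve.exists_isRegularField (hρ : IsRegularCurve ρ) (hf : IsEnergyDensity d f)
    (hγ : 0 < γ) (hk : IsKernel (rescale φ ε)) (hM : IsKernelBound (rescale φ ε) M)
    (hv : IsRegularField v V Mv Lv Kv) :
    ∃ M' L' K', IsRegularField (drift f φ γ ε v ρ) (driftDeriv f φ γ ε V ρ) M' L' K' := by
  set B := |regDensityDeriv f γ 0| + (γ + 1 / γ) * M with hBdef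
  set l := (((γ + 1 / γ) * M).toNNReal : ℝ) with hl
  set N := ∫ z, ‖gradient (rescale φ ε) z‖ with hN
  set N' := ∫ z, ‖fderiv ℝ (gradient (rescale φ ε)) z‖ with hN'
  have hN0 : 0 ≤ N := integral_nonneg fun _ => norm_nonneg _
  have hN0' : 0 ≤ N' := integral_nonneg fun _ => norm_nonneg _
  have hB : ∀ t x, |potential f φ γ ε (ρ t) x| ≤ B := fun t x => by
    have := hρ.prob t
    exact abs_potential_le hf hγ hk hM x
  have hL : ∀ t, LipschitzWith ((γ + 1 / γ) * M).toNNReal (potential f φ γ ε (ρ t)) := fun t => by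
    have := hρ.prob t
    exact lipschitz_potential hf hγ hk hM
  have hg : ∀ t, gradient (pressure f φ γ ε (ρ t)) =
      conv (potential f φ γ ε (ρ t)) (gradient (rescale φ ε)) := fun t => by
    have := hρ.prob t
    exact gradient_pressure hf hγ hk hM
  refine ⟨B * N + Mv, B * N' + Lv, l * N' + Kv, fun t x => ?_, fun t x => ?_, fun t x => ?_,
    fun t x y => ?_, ?_, fun η hη => ?_⟩
  · rw [drift, norm_neg, hg]
    exact (norm_add_le _ _).trans (add_le_add (norm_conv_le (hB t) hk.integrable_gradient x)
      (hv.norm_le t x))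
  · have := hρ.prob t
    exact ((hasFDerivAt_gradient_pressure hf hγ hk hM x).add (hv.hasFDerivAt t x)).neg
  · rw [driftDeriv, norm_neg]
    exact (norm_add_le _ _).trans (add_le_add
      (norm_conv_le (hB t) hk.integrable_fderiv_gradient x) (hv.fderiv_le t x))
  · have e : driftDeriv f φ γ ε V ρ t x - driftDeriv f φ γ ε V ρ t y =
        -((conv (potential f φ γ ε (ρ t)) (fderiv ℝ (gradient (rescale φ ε))) x -
          conv (potential f φ γ ε (ρ t)) (fderiv ℝ (gradient (rescale φ ε))) y)
          + (V t x - V t y)) := by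
      simp only [driftDeriv]; abel
    rw [e, norm_neg, add_mul]
    exact (norm_add_le _ _).trans (add_le_add
      (norm_conv_sub_conv_le (hL t) (hB t) hk.integrable_fderiv_gradient x y)
      (hv.fderiv_lip t x y))
  · have := hv.nonneg
    positivity
  · obtain ⟨τ₁, hτ₁, h1⟩ := hv.time (η / 2) (half_pos hη)
    obtain ⟨τ₂, hτ₂, h2⟩ := hρ.potential_time hf hγ hk hM (η := η / (2 * (N + N' + 1)))
      (by positivity)
    refine ⟨min τ₁ τ₂, lt_min hτ₁ hτ₂, fun s t hst x => ?_⟩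
    obtain ⟨h3, h4⟩ := h1 s t (hst.trans (min_le_left _ _)) x
    have h5 := h2 s t (hst.trans (min_le_right _ _))
    have h6 : ∀ n, 0 ≤ n → n ≤ N + N' → η / (2 * (N + N' + 1)) * n ≤ η / 2 := fun n hn hn' => by
      calc η / (2 * (N + N' + 1)) * n ≤ η / (2 * (N + N' + 1)) * (N + N' + 1) := by
            gcongr; linarith
        _ = η / 2 := by field_simp
    constructor
    · rw [drift, drift, hg, hg, neg_sub_neg, add_sub_add_comm]
      have h7 := norm_conv_sub_le (hL t).continuous (hB t) (hL s).continuous (hB s)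
        (fun x => by rw [abs_sub_comm]; exact h5 x) hk.integrable_gradient x
      rw [norm_sub_rev] at h3
      refine (norm_add_le _ _).trans ((add_le_add (h7.trans (h6 N hN0 (by linarith))) h3).trans ?_)
      linarith
    · rw [driftDeriv, driftDeriv, neg_sub_neg, add_sub_add_comm]
      have h7 := norm_conv_sub_le (hL t).continuous (hB t) (hL s).continuous (hB s)
        (fun x => by rw [abs_sub_comm]; exact h5 x) hk.integrable_fderiv_gradient x
      rw [norm_sub_rev] at h4
      refine (norm_add_le _ _).trans ((add_le_add (h7.trans (h6 N' hN0' (by linarith))) h4).trans ?_)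
      linarith

/-- Products of a function of time and a function of space suffice as tests; the factor in time is
supported in (0,T), where clamping changes nothing and beyond which the integrand vanishes. -/
theorem IsSolution.isWeakCurve {ρ₀ : Measure (Space d)} (hsol : IsSolution f φ γ ε v ρ₀ ρ)
    (hT : 0 < T) {A : ℝ → Space d → Space d →L[ℝ] Space d} {L K : ℝ}
    (hu : IsRegularField (drift f φ γ ε (fun t => v (clamp T t)) fun t => ρ (clamp T t)) A M L K) :
    IsWeakCurve (drift f φ γ ε (fun t => v (clamp T t)) fun t => ρ (clamp T t)) T
      (fun t => ρ (clamp T t)) := by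
  have hr := hsol.ac.isRegularCurve hT
  refine isWeakCurve_of_test hr.prob hu hr.time fun α χ hα hαc hαs hχ hχc => ?_
  set ψ : ℝ × Space d → ℝ := fun z => α z.1 * χ z.2 with hψ
  have hsub : tsupport ψ ⊆ tsupport α ×ˢ tsupport χ := by
    refine closure_minimal (fun z hz => ?_) ((isClosed_tsupport α).prod (isClosed_tsupport χ))
    have hz' : α z.1 * χ z.2 ≠ 0 := hz
    exact ⟨subset_tsupport _ (left_ne_zero_of_mul hz'), subset_tsupport _ (right_ne_zero_of_mul hz')⟩
  have h1 := hsol.weak ψ ((hα.comp contDiff_fst).mul (hχ.comp contDiff_snd))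
    (HasCompactSupport.of_support_subset_isCompact (hαc.isCompact.prod hχc.isCompact)
      ((subset_tsupport ψ).trans hsub))
    (fun z hz => ⟨(hαs (hsub hz).1).1, mem_univ _⟩)
  have h2 : ∀ t x, deriv (fun s => ψ (s, x)) t - ⟪gradient (fun y => ψ (t, y)) x,
      gradient (pressure f φ γ ε (ρ t)) x + v t x⟫_ℝ = deriv α t * χ x +
        α t * fderiv ℝ χ x (-(gradient (pressure f φ γ ε (ρ t)) x + v t x)) := by
    intro t x
    have h3 : deriv (fun s => ψ (s, x)) t = deriv α t * χ x :=
      deriv_mul_const_field (χ x)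
    have h4 : fderiv ℝ (fun y => ψ (t, y)) x = α t • fderiv ℝ χ x :=
      fderiv_const_mul (hχ.differentiable (by simp) x) (α t)
    rw [h3, inner_gradient, h4, smul_apply, smul_eq_mul, map_neg]
    ring
  simp only [h2] at h1
  rw [intervalIntegral.integral_of_le hT.le]
  refine Eq.trans ?_ h1
  rw [setIntegral_eq_of_subset_of_forall_sdiff_eq_zero measurableSet_Ioi
    (Ioc_subset_Ioi_self : Ioc 0 T ⊆ Ioi 0)]
  · refine setIntegral_congr_fun measurableSet_Ioc fun t ht => ?_
    simp only [drift, clamp_of_mem (Ioc_subset_Icc_self ht)]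
  · intro t ht
    have h3 : t ∉ tsupport α := fun h => ht.2 ⟨ht.1, (hαs h).2.le⟩
    have h4 : α t = 0 := image_eq_zero_of_notMem_tsupport h3
    have h5 : deriv α t = 0 :=
      image_eq_zero_of_notMem_tsupport fun h => h3 (tsupport_deriv_subset (f := α) h)
    simp [h4, h5]

end Drift

end NonlocalDiffusion

end

noncomputable section

namespace NonlocalDiffusion

/-! ### Measures transported by a flow -/

section Transported

variable {d : ℕ} {w : Space d → ℝ} {X : ℝ → Space d → Space d} {ρ : ℝ → Measure (Space d)}
  {E : Type*} [NormedAddCommGroup E] [NormedSpace ℝ E]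

theorem integral_toMeasure (hw : Measurable w) (hw0 : ∀ x, 0 ≤ w x) (g : Space d → E) :
    ∫ x, g x ∂toMeasure w = ∫ x, w x • g x := by
  rw [toMeasure, integral_withDensity_eq_integral_toReal_smul (by fun_prop) (by simp)]
  simp only [ENNReal.toReal_ofReal (hw0 _)]

theorem integrable_toMeasure_iff (hw : Measurable w) (hw0 : ∀ x, 0 ≤ w x) {g : Space d → E} :
    Integrable g (toMeasure w) ↔ Integrable fun x => w x • g x := by
  rw [toMeasure, integrable_withDensity_iff_integrable_smul' (by fun_prop) (by simp)]
  simp only [ENNReal.toReal_ofReal (hw0 _)]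

/-- The curve `ρ` is the push-forward of the measure with density `w` under the maps `X`. -/
structure IsTransported (w : Space d → ℝ) (X : ℝ → Space d → Space d) (ρ : ℝ → Measure (Space d)) :
    Prop where
  continuous_density : Continuous w
  hasCompactSupport : HasCompactSupport w
  nonneg : ∀ x, 0 ≤ w x
  integral_eq_one : ∫ x, w x = 1
  continuous_flow : Continuous fun z : ℝ × Space d => X z.1 z.2
  map : ∀ t, ρ t = (toMeasure w).map (X t)

namespace IsTransported

theorem continuous (h : IsTransported w X ρ) (t : ℝ) : Continuous (X t) :=
  h.continuous_flow.comp (by fun_prop : Continuous fun x : Space d => (t, x))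

theorem integral_eq (h : IsTransported w X ρ) (t : ℝ) {g : Space d → E} (hg : StronglyMeasurable g) :
    ∫ x, g x ∂ρ t = ∫ x, w x • g (X t x) := by
  rw [h.map, integral_map (h.continuous t).measurable.aemeasurable hg.aestronglyMeasurable,
    integral_toMeasure h.continuous_density.measurable h.nonneg]

theorem integrable_iff (h : IsTransported w X ρ) (t : ℝ) {g : Space d → E}
    (hg : StronglyMeasurable g) : Integrable g (ρ t) ↔ Integrable fun x => w x • g (X t x) := by
  rw [h.map, integrable_map_measure hg.aestronglyMeasurable (h.continuous t).measurable.aemeasurable,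
    integrable_toMeasure_iff h.continuous_density.measurable h.nonneg]
  rfl

theorem integrable (h : IsTransported w X ρ) (t : ℝ) {g : Space d → ℝ} (hg : Continuous g) :
    Integrable g (ρ t) :=
  (h.integrable_iff t hg.stronglyMeasurable).2
    ((h.continuous_density.smul (hg.comp (h.continuous t))).integrable_of_hasCompactSupport
      h.hasCompactSupport.smul_right)

theorem integral_eq' (h : IsTransported w X ρ) {g : ℝ → Space d → ℝ}
    (hg : Continuous fun z : ℝ × Space d => g z.1 z.2) (t : ℝ) :
    ∫ x, g t x ∂ρ t = ∫ x in tsupport w, w x * g t (X t x) := by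
  have hgt : Continuous (g t) := hg.comp (by fun_prop : Continuous fun x : Space d => (t, x))
  rw [h.integral_eq t hgt.stronglyMeasurable, setIntegral_eq_integral_of_forall_compl_eq_zero]
  · rfl
  · intro x hx
    rw [image_eq_zero_of_notMem_tsupport hx, zero_mul]

theorem continuous_integral (h : IsTransported w X ρ) {g : ℝ → Space d → ℝ}
    (hg : Continuous fun z : ℝ × Space d => g z.1 z.2) : Continuous fun t => ∫ x, g t x ∂ρ t := by
  simp only [h.integral_eq' hg]
  refine continuous_parametric_integral_of_continuous ?_ h.hasCompactSupport.isCompact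
  exact (h.continuous_density.comp continuous_snd).mul
    (hg.comp (continuous_fst.prodMk h.continuous_flow))

theorem integral_swap (h : IsTransported w X ρ) {g : ℝ → Space d → ℝ}
    (hg : Continuous fun z : ℝ × Space d => g z.1 z.2) (a b : ℝ) :
    ∫ x, w x * (∫ s in a..b, g s (X s x)) = ∫ s in a..b, ∫ x, g s x ∂ρ s := by
  simp only [h.integral_eq' hg]
  rw [intervalIntegral_integral_swap]
  · rw [setIntegral_eq_integral_of_forall_compl_eq_zero]
    · simp only [intervalIntegral.integral_const_mul]
    · intro x hx
      simp [image_eq_zero_of_notMem_tsupport hx]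
  · rw [Measure.prod_restrict, ← Measure.volume_eq_prod]
    refine IntegrableOn.mono_set (t := uIcc a b ×ˢ tsupport w) ?_
      (prod_mono uIoc_subset_uIcc subset_rfl)
    refine ContinuousOn.integrableOn_compact (isCompact_uIcc.prod h.hasCompactSupport.isCompact) ?_
    exact ((h.continuous_density.comp continuous_snd).mul
      (hg.comp (continuous_fst.prodMk h.continuous_flow))).continuousOn

end IsTransported

end Transported

/-! ### The energy inequality -/

section Energy

variable {d : ℕ} {f : ℝ → EReal} {φ : Space d → ℝ} {γ ε M T : ℝ} {ρ : ℝ → Measure (Space d)}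
  {v : ℝ → Space d → Space d} {V : ℝ → Space d → Space d →L[ℝ] Space d} {Mv Lv Kv : ℝ}

theorem IsEnergyDensity.regDensityDeriv_mono (hf : IsEnergyDensity d f) (hγ : 0 < γ) {a b : ℝ}
    (ha : 0 ≤ a) (hab : a ≤ b) : regDensityDeriv f γ a ≤ regDensityDeriv f γ b := by
  have h := (sq_nonneg _).trans (hf.sq_regDensityDeriv_sub_le hγ (ha.trans hab) ha)
  rcases hab.eq_or_lt with rfl | hab
  · rfl
  by_contra! h2
  have h3 : 0 < γ + 1 / γ := by positivity
  have h4 := nonneg_of_mul_nonneg_right h h3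
  nlinarith

theorem IsEnergyDensity.regDensity_sub_le (hf : IsEnergyDensity d f) (hγ : 0 < γ) {a b : ℝ}
    (ha : 0 ≤ a) (hb : 0 ≤ b) :
    regDensity f γ b - regDensity f γ a ≤ regDensityDeriv f γ b * (b - a) := by
  have hd : ∀ c, 0 ≤ c → HasDerivAt (regDensity f γ) (regDensityDeriv f γ c) c := fun c hc =>
    hf.hasDerivAt_regDensity' hγ hc
  have hc := hf.continuous_regDensity hγ
  rcases lt_trichotomy a b with hab | rfl | hab
  · obtain ⟨c, hc, h⟩ := exists_hasDerivAt_eq_slope (regDensity f γ) (regDensityDeriv f γ) hab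
      hc.continuousOn fun c hc => hd c (ha.trans hc.1.le)
    rw [eq_div_iff (sub_pos.2 hab).ne'] at h
    rw [← h]
    exact mul_le_mul_of_nonneg_right
      (hf.regDensityDeriv_mono hγ (ha.trans hc.1.le) hc.2.le) (sub_pos.2 hab).le
  · simp
  · obtain ⟨c, hc, h⟩ := exists_hasDerivAt_eq_slope (regDensity f γ) (regDensityDeriv f γ) hab
      hc.continuousOn fun c hc => hd c (hb.trans hc.1.le)
    rw [eq_div_iff (sub_pos.2 hab).ne'] at h
    have := mul_le_mul_of_nonneg_right
      (hf.regDensityDeriv_mono hγ hb hc.1.le) (sub_pos.2 hab).le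
    linarith

/-- Convolution with an even kernel is self-adjoint. -/
theorem integral_pressure {ρ ν : Measure (Space d)} [IsProbabilityMeasure ρ]
    [IsProbabilityMeasure ν] (hf : IsEnergyDensity d f) (hγ : 0 < γ) (hk : IsKernel (rescale φ ε))
    (hM : IsKernelBound (rescale φ ε) M) :
    ∫ x, pressure f φ γ ε ρ x ∂ν = ∫ y, potential f φ γ ε ρ y * smoothed φ ε ν y := by
  have hi : Integrable (fun z : Space d × Space d =>
      rescale φ ε (z.1 - z.2) * potential f φ γ ε ρ z.2) (ν.prod volume) := by
    refine (integrable_comp_rsub_prod (ρ := ν) hk.integrable).mul_bdd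
      (c := |regDensityDeriv f γ 0| + (γ + 1 / γ) * M) ?_
      (Eventually.of_forall fun z => abs_potential_le hf hγ hk hM z.2)
    exact ((lipschitz_potential hf hγ hk hM).continuous.comp continuous_snd).aestronglyMeasurable
  simp only [pressure]
  rw [integral_integral_swap hi]
  refine integral_congr_ae (Eventually.of_forall fun y => ?_)
  simp only [smoothed]
  rw [integral_mul_const, mul_comm]
  simp only [hk.symm y]

theorem integrable_potential_mul {ρ ν : Measure (Space d)} [IsProbabilityMeasure ρ]
    [IsProbabilityMeasure ν] (hf : IsEnergyDensity d f) (hγ : 0 < γ) (hk : IsKernel (rescale φ ε))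
    (hM : IsKernelBound (rescale φ ε) M) :
    Integrable fun y => potential f φ γ ε ρ y * smoothed φ ε ν y :=
  (integrable_smoothed hk).bdd_mul (c := |regDensityDeriv f γ 0| + (γ + 1 / γ) * M)
    (lipschitz_potential hf hγ hk hM).continuous.aestronglyMeasurable
    (Eventually.of_forall fun z => abs_potential_le hf hγ hk hM z)

/-- The pressure is the first variation of the energy, and convexity of f_ε gives a subgradient
inequality at the later measure. One side is enough for an energy inequality, so the energy is never
differentiated in time. -/
theorem regEnergy_sub_le {ρ ν : Measure (Space d)} [IsProbabilityMeasure ρ]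
    [IsProbabilityMeasure ν] (hf : IsEnergyDensity d f) (hγ : 0 < γ) (hk : IsKernel (rescale φ ε))
    (hM : IsKernelBound (rescale φ ε) M) :
    regEnergy f φ γ ε ρ - regEnergy f φ γ ε ν ≤
      ∫ x, pressure f φ γ ε ρ x ∂ρ - ∫ x, pressure f φ γ ε ρ x ∂ν := by
  have h1 := integrable_potential_mul (ρ := ρ) (ν := ρ) hf hγ hk hM
  have h2 := integrable_potential_mul (ρ := ρ) (ν := ν) hf hγ hk hM
  have h3 := integrable_regDensity_smoothed (ρ := ρ) hf hγ hk hM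
  have h4 := integrable_regDensity_smoothed (ρ := ν) hf hγ hk hM
  rw [integral_pressure hf hγ hk hM, integral_pressure hf hγ hk hM, regEnergy, regEnergy,
    ← integral_sub h3 h4, ← integral_sub h1 h2]
  refine integral_mono (h3.sub h4) (h1.sub h2) fun x => ?_
  simp only [← mul_sub]
  exact hf.regDensity_sub_le hγ (smoothed_nonneg hk x) (smoothed_nonneg hk x)

/-- An estimate on short intervals with an error proportional to their length adds up over a
subdivision; then the factor η tends to 0. -/
theorem sub_le_integral_of_local {e G : ℝ → ℝ} (hG : Continuous G)
    (h : ∀ η, 0 < η → ∃ τ, 0 < τ ∧ ∀ s t, 0 ≤ s → s ≤ t → t ≤ T → t - s ≤ τ →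
      e t - e s ≤ (∫ r in s..t, G r) + η * (t - s)) {s t : ℝ} (hs : 0 ≤ s) (hst : s ≤ t)
    (ht : t ≤ T) : e t - e s ≤ ∫ r in s..t, G r := by
  have hGi : ∀ a b, IntervalIntegrable G volume a b := fun a b => hG.intervalIntegrable a b
  have key : ∀ η, 0 < η → e t - e s ≤ (∫ r in s..t, G r) + η * (t - s) := by
    intro η hη
    obtain ⟨τ, hτ, h⟩ := h η hη
    have ind : ∀ n : ℕ, ∀ t, s ≤ t → t ≤ T → t - s ≤ n * τ →
        e t - e s ≤ (∫ r in s..t, G r) + η * (t - s) := by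
      intro n
      induction n with
      | zero =>
        intro t hst _ hn
        have : t = s := by simp at hn; linarith
        simp [this]
      | succ n ih =>
        intro t hst htT hn
        push_cast at hn
        have h1 : s ≤ max s (t - τ) := le_max_left _ _
        have h2 : max s (t - τ) ≤ t := max_le hst (by linarith)
        have h3 := ih _ h1 (h2.trans htT) (by
          rw [sub_le_iff_le_add]
          refine max_le ?_ (by linarith)
          have : 0 ≤ (n : ℝ) * τ := by positivity
          linarith)
        have h4 := h _ t (hs.trans h1) h2 htT (by linarith [le_max_right s (t - τ)])
        rw [← intervalIntegral.integral_add_adjacent_intervals (hGi s (max s (t - τ)))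
          (hGi (max s (t - τ)) t)]
        linarith
    obtain ⟨n, hn⟩ := exists_nat_gt ((t - s) / τ)
    exact ind n t hst ht ((div_lt_iff₀ hτ).1 hn).le
  have hl : Tendsto (fun η : ℝ => (∫ r in s..t, G r) + η * (t - s)) (𝓝[>] 0)
      (𝓝 (∫ r in s..t, G r)) := by
    have : Continuous fun η : ℝ => (∫ r in s..t, G r) + η * (t - s) := by fun_prop
    have h := (this.tendsto 0).mono_left (nhdsWithin_le_nhds (s := Ioi 0))
    simpa using h
  exact ge_of_tendsto hl (eventually_mem_nhdsWithin.mono fun η hη => key η hη)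

theorem isRegularField_zero : IsRegularField (d := d) (fun _ _ => 0) (fun _ _ => 0) 0 0 0 :=
  ⟨by simp, fun t x => hasFDerivAt_const _ _, by simp, by simp, le_rfl,
    fun η hη => ⟨1, one_pos, fun s t _ x => by simp [hη.le]⟩⟩

/-- With v = 0 the drift is −∇p, so the estimates for drifts specialize to ∇p. -/
theorem IsRegularCurve.gradient_pressure_time (hρ : IsRegularCurve ρ) (hf : IsEnergyDensity d f)
    (hγ : 0 < γ) (hk : IsKernel (rescale φ ε)) (hM : IsKernelBound (rescale φ ε) M) {η : ℝ}
    (hη : 0 < η) : ∃ τ, 0 < τ ∧ ∀ s t, |s - t| ≤ τ → ∀ x,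
      ‖gradient (pressure f φ γ ε (ρ s)) x - gradient (pressure f φ γ ε (ρ t)) x‖ ≤ η := by
  obtain ⟨_, _, _, hp⟩ := hρ.exists_isRegularField hf hγ hk hM isRegularField_zero
  obtain ⟨τ, hτ, h⟩ := hp.time η hη
  refine ⟨τ, hτ, fun s t hst x => ?_⟩
  have := (h s t hst x).1
  rwa [drift, drift, neg_sub_neg, add_zero, add_zero, norm_sub_rev] at this

theorem IsRegularCurve.continuous_gradient_pressure (hρ : IsRegularCurve ρ)
    (hf : IsEnergyDensity d f) (hγ : 0 < γ) (hk : IsKernel (rescale φ ε))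
    (hM : IsKernelBound (rescale φ ε) M) :
    Continuous fun z : ℝ × Space d => gradient (pressure f φ γ ε (ρ z.1)) z.2 := by
  obtain ⟨_, _, _, hp⟩ := hρ.exists_isRegularField hf hγ hk hM isRegularField_zero
  have h := hp.continuous_uncurry.neg
  simp only [drift, add_zero] at h
  convert h using 2
  exact (neg_neg _).symm

/-- The subgradient inequality bounds the energy increment by ∫ p(t) d(ρ_t − ρ_s), and the weak
equation with p(t) as a frozen test function rewrites this through ∇p(t)·u. On short intervals ∇p(t)
may be replaced by ∇p(τ) with a small error, and the local estimates are then chained. -/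
theorem IsRegularCurve.regEnergy_sub_le_integral (hρ : IsRegularCurve ρ) (hf : IsEnergyDensity d f)
    (hγ : 0 < γ) (hk : IsKernel (rescale φ ε)) (hM : IsKernelBound (rescale φ ε) M)
    {u : ℝ → Space d → Space d} {A : ℝ → Space d → Space d →L[ℝ] Space d} {Mu Lu Ku : ℝ}
    (hu : IsRegularField u A Mu Lu Ku) (hw : IsWeakCurve u T ρ) {w : Space d → ℝ}
    {X : ℝ → Space d → Space d} (hX : IsTransported w X ρ) {s t : ℝ} (hs : 0 ≤ s) (hst : s ≤ t)
    (ht : t ≤ T) : regEnergy f φ γ ε (ρ t) - regEnergy f φ γ ε (ρ s) ≤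
      ∫ τ in s..t, ∫ x, ⟪gradient (pressure f φ γ ε (ρ τ)) x, u τ x⟫_ℝ ∂ρ τ := by
  have hpc := hρ.continuous_gradient_pressure hf hγ hk hM
  have huc := hu.continuous_uncurry
  have hMu := hu.M_nonneg
  have hG := hX.continuous_integral
    (g := fun τ x => ⟪gradient (pressure f φ γ ε (ρ τ)) x, u τ x⟫_ℝ) (hpc.inner huc)
  refine sub_le_integral_of_local (e := fun t => regEnergy f φ γ ε (ρ t)) hG (fun η hη => ?_) hs hst ht
  obtain ⟨τ₀, hτ₀, hmod⟩ := hρ.gradient_pressure_time hf hγ hk hM (η := η / (Mu + 1)) (by positivity)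
  refine ⟨τ₀, hτ₀, fun s t hs hst ht hd => ?_⟩
  have := hρ.prob t
  have := hρ.prob s
  have hp1 : ContDiff ℝ 1 (pressure f φ γ ε (ρ t)) := by
    rw [contDiff_one_iff_fderiv]
    refine ⟨fun x => (hasFDerivAt_pressure hf hγ hk hM x).differentiableAt, ?_⟩
    have h1 : fderiv ℝ (pressure f φ γ ε (ρ t)) =
        fun x => InnerProductSpace.toDual ℝ (Space d) (gradient (pressure f φ γ ε (ρ t)) x) := by
      funext x
      simp [gradient]
    rw [h1]
    exact (InnerProductSpace.toDual ℝ (Space d)).continuous.comp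
      (hpc.comp (by fun_prop : Continuous fun x : Space d => (t, x)))
  have hp2 : ∃ B, ∀ x, |pressure f φ γ ε (ρ t) x| ≤ B := by
    refine ⟨(|regDensityDeriv f γ 0| + (γ + 1 / γ) * M) * ∫ z, ‖rescale φ ε z‖, fun x => ?_⟩
    rw [pressure_eq_conv, ← Real.norm_eq_abs]
    exact norm_conv_le (abs_potential_le hf hγ hk hM) hk.integrable x
  have hp3 : ∃ B, ∀ x, ‖fderiv ℝ (pressure f φ γ ε (ρ t)) x‖ ≤ B := by
    refine ⟨(|regDensityDeriv f γ 0| + (γ + 1 / γ) * M) * ∫ z, ‖gradient (rescale φ ε) z‖,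
      fun x => ?_⟩
    rw [← norm_gradient, gradient_pressure hf hγ hk hM]
    exact norm_conv_le (abs_potential_le hf hγ hk hM) hk.integrable_gradient x
  have h1 := regEnergy_sub_le (ρ := ρ t) (ν := ρ s) hf hγ hk hM
  rw [hw.weak _ hp1 hp2 hp3 s t hs hst ht] at h1
  refine h1.trans ?_
  simp only [← inner_gradient]
  have hpt : Continuous fun z : ℝ × Space d => gradient (pressure f φ γ ε (ρ t)) z.2 :=
    hpc.comp (by fun_prop : Continuous fun z : ℝ × Space d => (t, z.2))
  have hG' := hX.continuous_integral
    (g := fun τ x => ⟪gradient (pressure f φ γ ε (ρ t)) x, u τ x⟫_ℝ) (hpt.inner huc)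
  have h2 : (∫ τ in s..t, ∫ x, ⟪gradient (pressure f φ γ ε (ρ τ)) x, u τ x⟫_ℝ ∂ρ τ) + η * (t - s) =
      ∫ τ in s..t, ((∫ x, ⟪gradient (pressure f φ γ ε (ρ τ)) x, u τ x⟫_ℝ ∂ρ τ) + η) := by
    rw [intervalIntegral.integral_add (hG.intervalIntegrable _ _) intervalIntegrable_const,
      intervalIntegral.integral_const, smul_eq_mul, mul_comm η]
  rw [h2]
  refine intervalIntegral.integral_mono_on hst (hG'.intervalIntegrable _ _)
    ((hG.add continuous_const).intervalIntegrable _ _) fun τ hτ => ?_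
  have := hρ.prob τ
  have hτu : Continuous (u τ) := hu.continuous_field τ
  have hτp : ∀ t, Continuous fun x => gradient (pressure f φ γ ε (ρ t)) x := fun t =>
    hpc.comp (by fun_prop : Continuous fun x : Space d => (t, x))
  have i1 := hX.integrable τ ((hτp t).inner hτu)
  have i2 := hX.integrable τ ((hτp τ).inner hτu)
  rw [← sub_le_iff_le_add', ← integral_sub i1 i2]
  have h3 : ∫ x, η ∂ρ τ = η := by simp
  rw [← h3]
  refine integral_mono (i1.sub i2) (integrable_const _) fun x => ?_
  simp only [← inner_sub_left]
  refine (real_inner_le_norm _ _).trans ?_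
  calc ‖gradient (pressure f φ γ ε (ρ t)) x - gradient (pressure f φ γ ε (ρ τ)) x‖ * ‖u τ x‖
      ≤ η / (Mu + 1) * (Mu + 1) := by
        gcongr
        · exact hmod t τ (by rw [abs_of_nonneg (by linarith [hτ.2])]; linarith [hτ.1]) x
        · linarith [hu.norm_le τ x]
    _ = η := by field_simp

/-- The function |x|² is not an admissible test function. It is differentiated along single
trajectories instead, and compact support of the initial density makes every integral finite. -/
theorem IsFlow.integral_sq_norm {u : ℝ → Space d → Space d}
    {A : ℝ → Space d → Space d →L[ℝ] Space d} {Mu Lu Ku : ℝ}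
    (hu : IsRegularField u A Mu Lu Ku) {w : Space d → ℝ}
    {X : ℝ → Space d → Space d} (hF : IsFlow u T X) (hX : IsTransported w X ρ) {t : ℝ}
    (ht : t ∈ Icc 0 T) : ∫ x, ‖x‖ ^ 2 ∂ρ t = ∫ x, ‖x‖ ^ 2 ∂ρ 0 +
      ∫ s in (0 : ℝ)..t, ∫ x, 2 * ⟪x, u s x⟫_ℝ ∂ρ s := by
  have huc := hu.continuous_uncurry
  have hg : Continuous fun z : ℝ × Space d => 2 * ⟪z.2, u z.1 z.2⟫_ℝ :=
    continuous_const.mul (continuous_snd.inner huc)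
  have hn : StronglyMeasurable fun x : Space d => ‖x‖ ^ 2 :=
    Continuous.stronglyMeasurable (by fun_prop)
  rw [← hX.integral_swap (g := fun s x => 2 * ⟪x, u s x⟫_ℝ) hg, hX.integral_eq t hn,
    hX.integral_eq 0 hn]
  have hXX := hX.continuous_flow
  have hftc : ∀ x, ∫ s in (0 : ℝ)..t, 2 * ⟪X s x, u s (X s x)⟫_ℝ = ‖X t x‖ ^ 2 - ‖X 0 x‖ ^ 2 := by
    intro x
    have hXx : Continuous fun s => X s x :=
      hXX.comp (by fun_prop : Continuous fun s : ℝ => (s, x))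
    refine intervalIntegral.integral_eq_sub_of_hasDerivAt_of_le ht.1
      (f := fun s => ‖X s x‖ ^ 2) (by fun_prop) (fun s hs => ?_)
      (Continuous.intervalIntegrable ?_ _ _)
    · have h1 := (hF.deriv x s ⟨hs.1.le, hs.2.le.trans ht.2⟩).hasDerivAt
        (Icc_mem_nhds hs.1 (hs.2.trans_le ht.2))
      exact h1.norm_sq
    · exact hg.comp (continuous_id.prodMk hXx)
  simp only [hftc, smul_eq_mul, mul_sub]
  have hi : ∀ t, Integrable fun x => w x * ‖X t x‖ ^ 2 := fun t =>
    (hX.integrable_iff t hn).1 (hX.integrable t (by fun_prop))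
  rw [integral_sub (hi t) (hi 0)]
  ring

/-- Gronwall's lemma by an integrating factor: the right-hand side of the hypothesis, multiplied by
exp(−∫ b), is nonincreasing. -/
theorem le_exp_integral_of_le {y b : ℝ → ℝ} {c : ℝ} (hy : Continuous y) (hb : Continuous b)
    (hb0 : ∀ t, 0 ≤ b t) (h : ∀ t ∈ Icc 0 T, y t ≤ c + ∫ s in (0 : ℝ)..t, b s * y s) {t : ℝ}
    (ht : t ∈ Icc 0 T) : y t ≤ c * Real.exp (∫ s in (0 : ℝ)..t, b s) := by
  set z : ℝ → ℝ := fun t => (c + ∫ s in (0 : ℝ)..t, b s * y s) *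
    Real.exp (-∫ s in (0 : ℝ)..t, b s) with hz
  have hd : ∀ t, HasDerivAt z ((b t * y t) * Real.exp (-∫ s in (0 : ℝ)..t, b s) +
      (c + ∫ s in (0 : ℝ)..t, b s * y s) * (Real.exp (-∫ s in (0 : ℝ)..t, b s) * (-b t))) t := by
    intro t
    have h1 := ((hb.mul hy).integral_hasStrictDerivAt 0 t).hasDerivAt
    have h2 := (hb.integral_hasStrictDerivAt 0 t).hasDerivAt
    exact (h1.const_add c).mul h2.neg.exp
  have hanti : AntitoneOn z (Icc 0 T) := by
    refine antitoneOn_of_deriv_nonpos (convex_Icc 0 T)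
      (continuous_iff_continuousAt.2 fun t => (hd t).continuousAt).continuousOn
      (fun t _ => (hd t).differentiableAt.differentiableWithinAt) fun t ht => ?_
    rw [(hd t).deriv]
    have h1 := h t (interior_subset ht)
    have h2 := mul_nonneg (hb0 t) (Real.exp_pos (-∫ s in (0 : ℝ)..t, b s)).le
    nlinarith
  have h1 := hanti ⟨le_rfl, ht.1.trans ht.2⟩ ht ht.1
  simp only [hz, intervalIntegral.integral_same, neg_zero, Real.exp_zero, add_zero, mul_one] at h1
  rw [Real.exp_neg, ← div_eq_mul_inv, div_le_iff₀ (Real.exp_pos _)] at h1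
  exact (h t ht).trans h1

/-- Uniform bounds on the second moment, the `L²` norm of the smoothed density and the dissipation. -/
theorem IsRegularCurve.uniform_bounds (hρ : IsRegularCurve ρ) (hf : IsEnergyDensity d f)
    (hγ : 0 < γ) (hk : IsKernel (rescale φ ε)) (hM : IsKernelBound (rescale φ ε) M)
    (hv : IsRegularField v V Mv Lv Kv) {Mu Lu Ku : ℝ}
    (hu : IsRegularField (drift f φ γ ε v ρ) (driftDeriv f φ γ ε V ρ) Mu Lu Ku)
    (hw : IsWeakCurve (drift f φ γ ε v ρ) T ρ) {w : Space d → ℝ} {X : ℝ → Space d → Space d}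
    (hF : IsFlow (drift f φ γ ε v ρ) T X) (hX : IsTransported w X ρ)
    {a : ℝ → ℝ} (ha : Continuous a) (ha0 : ∀ t, 0 ≤ a t)
    (hav : ∀ t x, ‖v t x‖ ^ 2 ≤ a t * (1 + ‖x‖ ^ 2))
    (haV : ∀ t x, divOf (V t x) ≤ a t * (1 + ‖x‖ ^ 2)) {C m : ℝ} (hC : 0 ≤ C)
    (hlow : ∀ t, γ / 2 * (∫ x, smoothed φ ε (ρ t) x ^ 2) ≤ regEnergy f φ γ ε (ρ t)
      + C * (1 + (∫ x, ‖x‖ ^ 2 ∂ρ t) + m)) (hT : 0 ≤ T) {Y : ℝ}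
    (hY : (regEnergy f φ γ ε (ρ 0) + (C + 1) * (1 + ∫ x, ‖x‖ ^ 2 ∂ρ 0) + C * m) *
      Real.exp ((∫ s in (0 : ℝ)..T, a s) + 4 * (C + 1) ^ 2 * T) ≤ Y) :
    (∀ t ∈ Icc 0 T, 1 + ∫ x, ‖x‖ ^ 2 ∂ρ t ≤ Y) ∧
    (∀ t ∈ Icc 0 T, γ / 2 * (∫ x, smoothed φ ε (ρ t) x ^ 2) ≤ regEnergy f φ γ ε (ρ 0)
      + (∫ s in (0 : ℝ)..T, a s) * Y + C * (Y + m)) ∧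
    Continuous (fun t => ∫ y, ⟪gradient (potential f φ γ ε (ρ t)) y,
      gradient (smoothed φ ε (ρ t)) y⟫_ℝ) ∧
    ∫ t in (0 : ℝ)..T, ∫ y, ⟪gradient (potential f φ γ ε (ρ t)) y,
      gradient (smoothed φ ε (ρ t)) y⟫_ℝ ≤ (∫ x, w x * Real.log (w x)) + Real.pi * Y
        + (∫ s in (0 : ℝ)..T, a s) * Y := by
  have hpc := hρ.continuous_gradient_pressure hf hγ hk hM
  have huc := hu.continuous_uncurry
  have hsq : Continuous fun z : ℝ × Space d => ‖z.2‖ ^ 2 := by fun_prop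
  have hsq1 : Continuous fun x : Space d => ‖x‖ ^ 2 := by fun_prop
  -- The energy can be as low as −C(y + m), so it does not control the moment y. Adding K times y
  -- compensates this loss and leaves one full copy of y for Gronwall's lemma.
  set K := C + 1 with hK
  set e : ℝ → ℝ := fun t => regEnergy f φ γ ε (ρ t) with he
  set y : ℝ → ℝ := fun t => 1 + ∫ x, ‖x‖ ^ 2 ∂ρ t with hy
  set I := ∫ s in (0 : ℝ)..T, a s with hI
  have hyc : Continuous y := continuous_const.add (hX.continuous_integral (g := fun _ x => ‖x‖ ^ 2) hsq)
  have hy1 : ∀ t, 1 ≤ y t := fun t => by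
    have : 0 ≤ ∫ x, ‖x‖ ^ 2 ∂ρ t := integral_nonneg fun x => by positivity
    simp only [hy]; linarith
  have hyint : ∀ t, ∫ x, (1 + ‖x‖ ^ 2) ∂ρ t = y t := fun t => by
    have := hρ.prob t
    rw [integral_add (integrable_const _) (hX.integrable t hsq1)]
    simp [hy]
  have hI0 : 0 ≤ I := intervalIntegral.integral_nonneg hT fun s _ => ha0 s
  set G : ℝ → Space d → ℝ := fun τ x =>
    ⟪gradient (pressure f φ γ ε (ρ τ)) x, drift f φ γ ε v ρ τ x⟫_ℝ with hG
  set P : ℝ → Space d → ℝ := fun τ x => 2 * ⟪x, drift f φ γ ε v ρ τ x⟫_ℝ with hP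
  have hGc : Continuous fun z : ℝ × Space d => G z.1 z.2 := hpc.inner huc
  have hPc : Continuous fun z : ℝ × Space d => P z.1 z.2 :=
    continuous_const.mul (continuous_snd.inner huc)
  have hsl : ∀ {g : ℝ → Space d → ℝ} (t : ℝ), (Continuous fun z : ℝ × Space d => g z.1 z.2) →
      Continuous (g t) := fun t hg => hg.comp (by fun_prop : Continuous fun x : Space d => (t, x))
  have hGi := hX.continuous_integral hGc
  have hPi := hX.continuous_integral hPc
  -- Young's inequality: the cross term −∇p·v is absorbed by −|∇p|² and leaves at most |v|²/4.
  have hGle : ∀ t x, G t x ≤ a t * (1 + ‖x‖ ^ 2) := by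
    intro t x
    refine le_trans ?_ (hav t x)
    simp only [hG, drift]
    set g := gradient (pressure f φ γ ε (ρ t)) x
    rw [inner_neg_right, inner_add_right, real_inner_self_eq_norm_sq]
    nlinarith [abs_le.1 (abs_real_inner_le_norm g (v t x)), norm_nonneg g, norm_nonneg (v t x),
      sq_nonneg (‖g‖ - ‖v t x‖ / 2)]
  -- The moment equation produces −2K x·∇p, which has no sign; the same −|∇p|² absorbs it after
  -- completing the square, at the cost of K²|x|².
  have hGPle : ∀ t x, G t x + K * P t x ≤ (a t + 4 * K ^ 2) * (1 + ‖x‖ ^ 2) := by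
    intro t x
    refine le_trans (?_ : _ ≤ ‖v t x‖ ^ 2 + 4 * K ^ 2 * ‖x‖ ^ 2) ?_
    · simp only [hG, hP, drift]
      set g := gradient (pressure f φ γ ε (ρ t)) x
      have hK0 : 0 ≤ K := by positivity
      have e1 := (abs_le.1 (abs_real_inner_le_norm g (v t x))).1
      have e2 := (abs_le.1 (abs_real_inner_le_norm x (v t x))).1
      have e3 := (abs_le.1 (abs_real_inner_le_norm x g)).1
      rw [inner_neg_right, inner_add_right, real_inner_self_eq_norm_sq, inner_neg_right,
        inner_add_right]
      have e4 := mul_le_mul_of_nonneg_left e2 hK0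
      have e5 := mul_le_mul_of_nonneg_left e3 hK0
      have e6 := sq_nonneg (‖g‖ - (‖v t x‖ + 2 * (K * ‖x‖)) / 2)
      have e7 := sq_nonneg (‖v t x‖ - 2 * (K * ‖x‖))
      nlinarith
    · have := hav t x
      have : 0 ≤ K ^ 2 := sq_nonneg K
      nlinarith
  have hen : ∀ t ∈ Icc 0 T, e t ≤ e 0 + ∫ s in (0 : ℝ)..t, ∫ x, G s x ∂ρ s := fun t ht => by
    have := hρ.regEnergy_sub_le_integral hf hγ hk hM hu hw hX le_rfl ht.1 ht.2
    linarith
  have hmo : ∀ t ∈ Icc 0 T, y t = y 0 + ∫ s in (0 : ℝ)..t, ∫ x, P s x ∂ρ s := fun t ht => by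
    have := hF.integral_sq_norm hu hX ht
    simp only [hy, this]
    ring
  have hμ0 : ∀ t, 0 ≤ γ / 2 * (∫ x, smoothed φ ε (ρ t) x ^ 2) := fun t =>
    mul_nonneg (by positivity) (integral_nonneg fun x => sq_nonneg _)
  have hlow' : ∀ t, γ / 2 * (∫ x, smoothed φ ε (ρ t) x ^ 2) ≤ e t + C * (y t + m) := hlow
  have hgron : ∀ t ∈ Icc 0 T, y t ≤ (e 0 + K * y 0 + C * m) +
      ∫ s in (0 : ℝ)..t, (a s + 4 * K ^ 2) * y s := by
    intro t ht
    have h1 : ∫ s in (0 : ℝ)..t, ((∫ x, G s x ∂ρ s) + K * ∫ x, P s x ∂ρ s) ≤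
        ∫ s in (0 : ℝ)..t, (a s + 4 * K ^ 2) * y s := by
      refine intervalIntegral.integral_mono_on ht.1
        ((hGi.add (continuous_const.mul hPi)).intervalIntegrable _ _)
        (Continuous.intervalIntegrable (by fun_prop) _ _) fun s _ => ?_
      have := hρ.prob s
      rw [← hyint s, ← integral_const_mul, ← integral_const_mul,
        ← integral_add (hX.integrable s (hsl s hGc)) ((hX.integrable s (hsl s hPc)).const_mul _)]
      exact integral_mono ((hX.integrable s (hsl s hGc)).add
        ((hX.integrable s (hsl s hPc)).const_mul _))
        (hX.integrable s (by fun_prop)) (hGPle s)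
    have hKP : IntervalIntegrable (fun s => K * ∫ x, P s x ∂ρ s) volume 0 t :=
      (continuous_const.mul hPi).intervalIntegrable _ _
    rw [intervalIntegral.integral_add (hGi.intervalIntegrable _ _) hKP,
      intervalIntegral.integral_const_mul] at h1
    have h2 := hen t ht
    have h3 := hmo t ht
    have h4 := (hμ0 t).trans (hlow' t)
    have h5 : K * y t = K * y 0 + K * ∫ s in (0 : ℝ)..t, ∫ x, P s x ∂ρ s := by rw [h3]; ring
    have h6 : K * y t = C * y t + y t := by rw [hK]; ring
    linarith
  have hc0 : 0 ≤ e 0 + K * y 0 + C * m := by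
    have h4 := (hμ0 0).trans (hlow' 0)
    have h6 : K * y 0 = C * y 0 + y 0 := by rw [hK]; ring
    linarith [hy1 0]
  have hyY : ∀ t ∈ Icc 0 T, y t ≤ Y := by
    intro t ht
    refine (le_exp_integral_of_le hyc (b := fun s => a s + 4 * K ^ 2) (by fun_prop)
      (fun s => by have := ha0 s; positivity) hgron ht).trans (le_trans ?_ hY)
    refine mul_le_mul_of_nonneg_left (Real.exp_le_exp.2 ?_) hc0
    rw [intervalIntegral.integral_add (ha.intervalIntegrable _ _) intervalIntegrable_const,
      intervalIntegral.integral_const, sub_zero, smul_eq_mul, mul_comm t]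
    refine add_le_add ?_ (mul_le_mul_of_nonneg_left ht.2 (by positivity))
    exact intervalIntegral.integral_mono_interval le_rfl ht.1 ht.2
      (Eventually.of_forall ha0) (ha.intervalIntegrable _ _)
  have hay : ∀ t ∈ Icc 0 T, ∫ s in (0 : ℝ)..t, a s * y s ≤ I * Y := by
    intro t ht
    rw [hI, ← intervalIntegral.integral_mul_const]
    refine (intervalIntegral.integral_mono_interval le_rfl ht.1 ht.2
      (Eventually.of_forall fun s => mul_nonneg (ha0 s) (zero_le_one.trans (hy1 s)))
      ((ha.mul hyc).intervalIntegrable _ _)).trans ?_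
    refine intervalIntegral.integral_mono_on hT ((ha.mul hyc).intervalIntegrable _ _)
      ((ha.mul continuous_const).intervalIntegrable _ _) fun s hs => ?_
    exact mul_le_mul_of_nonneg_left (hyY s hs) (ha0 s)
  have hGint : ∀ t ∈ Icc 0 T, ∫ s in (0 : ℝ)..t, ∫ x, G s x ∂ρ s ≤ I * Y := by
    intro t ht
    refine le_trans ?_ (hay t ht)
    refine intervalIntegral.integral_mono_on ht.1 (hGi.intervalIntegrable _ _)
      ((ha.mul hyc).intervalIntegrable _ _) fun s hs => ?_
    have := hρ.prob s
    rw [← hyint s, ← integral_const_mul]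
    exact integral_mono (hX.integrable s (hsl s hGc)) (hX.integrable s (by fun_prop)) (hGle s)
  have hdc : Continuous fun z : ℝ × Space d => divOf (driftDeriv f φ γ ε V ρ z.1 z.2) :=
    hu.continuous_divOf
  have hVc : Continuous fun z : ℝ × Space d => divOf (V z.1 z.2) := hv.continuous_divOf
  -- Here div u = −Δp − div v, so the dissipation −∫ Δp dρ is the sum of the averages of div u,
  -- controlled by entropy, and of div v, controlled by the weight a.
  have hdiss : ∀ t, ∫ y, ⟪gradient (potential f φ γ ε (ρ t)) y,
      gradient (smoothed φ ε (ρ t)) y⟫_ℝ =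
      (∫ x, divOf (driftDeriv f φ γ ε V ρ t x) ∂ρ t) + ∫ x, divOf (V t x) ∂ρ t := by
    intro t
    have := hρ.prob t
    have h1 := integral_divOf_hessian_pressure (ρ := ρ t) hf hγ hk hM
    rw [← integral_add (hX.integrable t (hsl (g := fun t x => divOf (driftDeriv f φ γ ε V ρ t x)) t hdc))
      (hX.integrable t (hsl (g := fun t x => divOf (V t x)) t hVc)), ← neg_eq_iff_eq_neg.2 h1,
      ← integral_neg]
    refine integral_congr_ae (Eventually.of_forall fun x => ?_)
    simp only [driftDeriv, ← divOfL_apply, map_neg, map_add]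
    ring
  have hc1 := hX.continuous_integral (g := fun t x => divOf (driftDeriv f φ γ ε V ρ t x)) hdc
  have hc2 := hX.continuous_integral (g := fun t x => divOf (V t x)) hVc
  refine ⟨hyY, fun t ht => ?_, ?_, ?_⟩
  · have h1 := hlow' t
    have h2 := hen t ht
    have h3 := hGint t ht
    have h4 := mul_le_mul_of_nonneg_left (hyY t ht) hC
    linarith
  · simp only [hdiss]
    exact hc1.add hc2
  · simp only [hdiss]
    rw [intervalIntegral.integral_add (hc1.intervalIntegrable _ _) (hc2.intervalIntegrable _ _)]
    have hTT : T ∈ Icc 0 T := ⟨hT, le_rfl⟩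
    refine add_le_add ?_ ?_
    · have h1 := hF.integral_divOf_le hu hX.continuous_density hX.hasCompactSupport hX.nonneg
        hX.integral_eq_one hTT
      rw [hX.integral_swap (g := fun t x => divOf (driftDeriv f φ γ ε V ρ t x)) hdc] at h1
      refine h1.trans ?_
      have h2 := hyY T hTT
      have h3 : ∫ x, ‖x‖ ^ 2 ∂ρ T = ∫ x, w x * ‖X T x‖ ^ 2 :=
        hX.integral_eq T hsq1.stronglyMeasurable
      rw [← h3]
      have h4 : ∫ x, ‖x‖ ^ 2 ∂ρ T ≤ Y := by simp only [hy] at h2; linarith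
      have := mul_le_mul_of_nonneg_left h4 Real.pi_pos.le
      linarith
    · refine le_trans ?_ (hay T hTT)
      refine intervalIntegral.integral_mono_on hT (hc2.intervalIntegrable _ _)
        ((ha.mul hyc).intervalIntegrable _ _) fun s hs => ?_
      have := hρ.prob s
      rw [← hyint s, ← integral_const_mul]
      exact integral_mono (hX.integrable s (hsl (g := fun t x => divOf (V t x)) s hVc))
        (hX.integrable s (by fun_prop)) (haV s)

end Energy

end NonlocalDiffusion

end

noncomputable section

namespace NonlocalDiffusion

/-! ### The weighted norm of a regular velocity field -/

section Weight

variable {d : ℕ} {v : ℝ → Space d → Space d} {V : ℝ → Space d → Space d →L[ℝ] Space d}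
  {M L K : ℝ}

theorem le_toReal_eLpNorm_top {g : Space d → ℝ} (hg : Continuous g) {B : ℝ}
    (hB : ∀ x, ‖g x‖ ≤ B) (x : Space d) : g x ≤ (eLpNorm g ⊤ volume).toReal := by
  have hfin : eLpNorm g ⊤ volume ≠ ⊤ := by
    have : MemLp g ⊤ volume := memLp_top_of_bound hg.aestronglyMeasurable B (ae_of_all _ hB)
    exact this.eLpNorm_ne_top
  refine continuous_forall_le_of_ae_le hg ?_ x
  filter_upwards [ae_le_eLpNormEssSup (f := g) (μ := volume)] with x hx
  have h2 : ‖g x‖ = ‖g x‖ₑ.toReal := by simp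
  refine (le_abs_self _).trans ?_
  rw [← Real.norm_eq_abs, h2]
  refine ENNReal.toReal_mono hfin ?_
  rwa [eLpNorm_exponent_top]

theorem toReal_eLpNorm_top_le {g : Space d → ℝ} {B : ℝ} (hB0 : 0 ≤ B) (hB : ∀ x, ‖g x‖ ≤ B) :
    (eLpNorm g ⊤ volume).toReal ≤ B := by
  refine ENNReal.toReal_le_of_le_ofReal hB0 ?_
  rw [eLpNorm_exponent_top]
  exact eLpNormEssSup_le_of_ae_bound (ae_of_all _ hB)

theorem velocityWeight_nonneg (b : Space d → Space d) (G : Space d → Space d →L[ℝ] Space d)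
    (x : Space d) : 0 ≤ velocityWeight b G x := by
  unfold velocityWeight
  positivity

theorem IsRegularField.continuous_velocityWeight (hv : IsRegularField v V M L K) (t : ℝ) :
    Continuous (velocityWeight (v t) (V t)) := by
  have h1 : Continuous (v t) := continuous_iff_continuousAt.2 fun x =>
    (hv.hasFDerivAt t x).continuousAt
  have h2 : Continuous (V t) := by
    have : LipschitzWith K.toNNReal (V t) := LipschitzWith.of_dist_le_mul fun x y => by
      rw [dist_eq_norm, dist_eq_norm, Real.coe_toNNReal _ hv.nonneg]
      exact hv.fderiv_lip t x y
    exact this.continuous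
  have h3 : Continuous fun x => divOf (V t x) := (divOfL d).continuous.comp h2
  unfold velocityWeight
  refine ((h1.norm.pow 2).add (h3.max continuous_const)).div (by fun_prop) fun x => ?_
  positivity

theorem IsRegularField.velocityWeight_le (hv : IsRegularField v V M L K) (t : ℝ) (x : Space d) :
    velocityWeight (v t) (V t) x ≤ M ^ 2 + ‖divOfL d‖ * L := by
  have hL := hv.L_nonneg
  have h1 : ‖v t x‖ ^ 2 ≤ M ^ 2 := by gcongr; exact hv.norm_le t x
  have h2 : max (divOf (V t x)) 0 ≤ ‖divOfL d‖ * L := by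
    refine max_le ((le_abs_self _).trans ?_) (by positivity)
    rw [← divOfL_apply, ← Real.norm_eq_abs]
    exact ((divOfL d).le_opNorm _).trans (by gcongr; exact hv.fderiv_le t x)
  unfold velocityWeight
  refine (div_le_self (by positivity) ?_).trans (add_le_add h1 h2)
  nlinarith [sq_nonneg ‖x‖]

theorem IsRegularField.velocityWeight_le_eLpNorm (hv : IsRegularField v V M L K) (t : ℝ)
    (x : Space d) :
    velocityWeight (v t) (V t) x ≤ (eLpNorm (velocityWeight (v t) (V t)) ⊤ volume).toReal :=
  le_toReal_eLpNorm_top (hv.continuous_velocityWeight t) (fun y => by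
    rw [Real.norm_of_nonneg (velocityWeight_nonneg _ _ y)]
    exact hv.velocityWeight_le t y) x

theorem IsRegularField.velocityWeight_sub_le (hv : IsRegularField v V M L K) {s t η : ℝ}
    {x : Space d} (h : ‖v s x - v t x‖ ≤ η ∧ ‖V s x - V t x‖ ≤ η) :
    velocityWeight (v s) (V s) x - velocityWeight (v t) (V t) x
      ≤ (2 * M + ‖divOfL d‖) * η := by
  have hM := hv.M_nonneg
  have hη : 0 ≤ η := (norm_nonneg _).trans h.1
  have h1 : ‖v s x‖ ^ 2 - ‖v t x‖ ^ 2 ≤ 2 * M * η := by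
    have h3 : ‖v s x‖ - ‖v t x‖ ≤ η := (norm_sub_norm_le _ _).trans h.1
    have h4 : ‖v s x‖ + ‖v t x‖ ≤ 2 * M := by linarith [hv.norm_le s x, hv.norm_le t x]
    have h5 : 0 ≤ ‖v s x‖ + ‖v t x‖ := by positivity
    nlinarith
  have h2 : max (divOf (V s x)) 0 - max (divOf (V t x)) 0 ≤ ‖divOfL d‖ * η := by
    refine (le_abs_self _).trans ((abs_max_sub_max_le_abs _ _ _).trans ?_)
    rw [← divOfL_apply, ← divOfL_apply, ← map_sub, ← Real.norm_eq_abs]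
    exact ((divOfL d).le_opNorm _).trans (by gcongr; exact h.2)
  unfold velocityWeight
  rw [← sub_div, div_le_iff₀ (by positivity)]
  have h6 : 0 ≤ (2 * M + ‖divOfL d‖) * η := by positivity
  have h7 : (1 : ℝ) ≤ 1 + ‖x‖ ^ 2 := by nlinarith [sq_nonneg ‖x‖]
  nlinarith

/-- Continuity makes this norm eligible as the coefficient of the Gronwall argument, so the
constants there depend on the velocity only through its time integral. -/
theorem IsRegularField.continuous_eLpNorm_velocityWeight (hv : IsRegularField v V M L K) :
    Continuous fun t => (eLpNorm (velocityWeight (v t) (V t)) ⊤ volume).toReal := by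
  refine continuous_of_modulus (c := 2 * M + ‖divOfL d‖) fun η hη => ?_
  obtain ⟨τ, hτ, h⟩ := hv.time η hη
  have hM := hv.M_nonneg
  refine ⟨τ, hτ, ?_⟩
  have key : ∀ s t, |s - t| ≤ τ → (eLpNorm (velocityWeight (v s) (V s)) ⊤ volume).toReal ≤
      (eLpNorm (velocityWeight (v t) (V t)) ⊤ volume).toReal + (2 * M + ‖divOfL d‖) * η := by
    intro s t hst
    refine toReal_eLpNorm_top_le (by positivity) fun x => ?_
    rw [Real.norm_of_nonneg (velocityWeight_nonneg _ _ x)]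
    linarith [hv.velocityWeight_sub_le (h s t hst x), hv.velocityWeight_le_eLpNorm t x]
  intro s t hst
  rw [abs_le]
  constructor
  · linarith [key t s (by rwa [abs_sub_comm])]
  · linarith [key s t hst]

theorem IsRegularField.sq_norm_le (hv : IsRegularField v V M L K) (t : ℝ) (x : Space d) :
    ‖v t x‖ ^ 2 ≤
      (eLpNorm (velocityWeight (v t) (V t)) ⊤ volume).toReal * (1 + ‖x‖ ^ 2) := by
  have := hv.velocityWeight_le_eLpNorm t x
  unfold velocityWeight at this ⊢
  rw [div_le_iff₀ (by positivity)] at this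
  linarith [le_max_right (divOf (V t x)) 0]

theorem IsRegularField.divOf_le (hv : IsRegularField v V M L K) (t : ℝ) (x : Space d) :
    divOf (V t x) ≤
      (eLpNorm (velocityWeight (v t) (V t)) ⊤ volume).toReal * (1 + ‖x‖ ^ 2) := by
  have := hv.velocityWeight_le_eLpNorm t x
  unfold velocityWeight at this ⊢
  rw [div_le_iff₀ (by positivity)] at this
  linarith [le_max_left (divOf (V t x)) 0, sq_nonneg ‖v t x‖]

end Weight

/-! ### Uniform estimates -/

section Estimates

variable {d : ℕ} {f : ℝ → EReal} {φ : Space d → ℝ} {γ ε T : ℝ} {ρ : ℝ → Measure (Space d)}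
  {v : ℝ → Space d → Space d} {w : Space d → ℝ}

/-- The dissipation `∫ ∇q · ∇μ`. -/
def dissipation (f : ℝ → EReal) (φ : Space d → ℝ) (γ ε : ℝ) (ρ : Measure (Space d)) : ℝ :=
  ∫ y, ⟪gradient (potential f φ γ ε ρ) y, gradient (smoothed φ ε ρ) y⟫_ℝ

/-- A curve of measures transported by a flow which does not concentrate volume, with energy and
dissipation controlled by `C` on `[0,T]`. -/
structure IsControlled (f : ℝ → EReal) (φ : Space d → ℝ) (γ ε T C : ℝ) (w : Space d → ℝ)
    (X : ℝ → Space d → Space d) (ρ : ℝ → Measure (Space d)) : Prop where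
  curve : IsRegularCurve ρ
  transported : IsTransported w X ρ
  null : ∀ t (s : Set (Space d)), volume s = 0 → volume (X t ⁻¹' s) = 0
  energy_le : ∀ t ∈ Icc 0 T, γ * (∫ x, smoothed φ ε (ρ t) x ^ 2) ≤ C
  continuous_dissipation : Continuous fun t => dissipation f φ γ ε (ρ t)
  dissipation_le : ∫ t in (0 : ℝ)..T, dissipation f φ γ ε (ρ t) ≤ C

theorem integral_sq_norm_eq (ρ : Measure (Space d)) :
    ∫ x, ‖x‖ ^ 2 ∂ρ = (secondMoment ρ).toReal := by
  rw [integral_eq_lintegral_of_nonneg_ae (ae_of_all _ fun x => by positivity)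
    (Continuous.aestronglyMeasurable (by fun_prop)), secondMoment]
  congr 2
  ext x
  rw [ENNReal.ofReal_pow (norm_nonneg _), ofReal_norm]

/-- Assembles regularity of the drift, its flow, the push-forward formula and the uniform bounds.
The resulting constant involves only the initial energy, entropy and moment, and the integrated
velocity weight; the regularity constants of the drift have disappeared. -/
theorem IsSolution.exists_isControlled (hf : IsEnergyDensity d f) (hγ : 0 < γ)
    (hk : IsKernel (rescale φ ε)) (hw : Continuous w) (hwc : HasCompactSupport w)
    (hw0 : ∀ x, 0 ≤ w x) (hw1 : ∫ x, w x = 1) (hv : IsSmoothVelocity v) (hT : 0 < T)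
    (hsol : IsSolution f φ γ ε v (toMeasure w) ρ) {C m : ℝ} (hC : 0 ≤ C)
    (hlow : ∀ ν : Measure (Space d), IsProbabilityMeasure ν → secondMoment ν < ⊤ →
      γ / 2 * (∫ x, smoothed φ ε ν x ^ 2) ≤ regEnergy f φ γ ε ν
        + C * (1 + (∫ x, ‖x‖ ^ 2 ∂ν) + m)) {Y I C' : ℝ}
    (hI : ∫ t in (0 : ℝ)..T, (eLpNorm (velocityWeight (v t) (fderiv ℝ (v t))) ⊤ volume).toReal = I)
    (hY : (regEnergy f φ γ ε (toMeasure w) + (C + 1) * (1 + ∫ x, ‖x‖ ^ 2 * w x) + C * m) *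
      Real.exp (I + 4 * (C + 1) ^ 2 * T) ≤ Y)
    (hC₁ : 2 * (regEnergy f φ γ ε (toMeasure w) + I * Y + C * (Y + m)) ≤ C')
    (hC₂ : (∫ x, w x * Real.log (w x)) + Real.pi * Y + I * Y ≤ C') :
    ∃ X, IsControlled f φ γ ε T C' w X fun t => ρ (clamp T t) := by
  obtain ⟨M, hM⟩ := hk.bound
  have hM : IsKernelBound (rescale φ ε) M := hM
  have hr := hsol.ac.isRegularCurve hT
  obtain ⟨Mv, Lv, Kv, hvr⟩ := hv.exists_isRegularField hT.le
  obtain ⟨Mu, Lu, Ku, hu⟩ := hr.exists_isRegularField hf hγ hk hM hvr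
  have hwk := hsol.isWeakCurve hT hu
  obtain ⟨X, hX⟩ := hu.exists_flow hT.le
  have h0 : clamp T 0 = 0 := clamp_of_mem ⟨le_rfl, hT.le⟩
  have hρ0 : ρ (clamp T 0) = toMeasure w := by rw [h0, hsol.initial]
  have htr : IsTransported w X fun t => ρ (clamp T t) := by
    refine ⟨hw, hwc, hw0, hw1, hX.continuous_uncurry hu hT.le, fun t => ?_⟩
    have := hwk.eq_map hu hX (clamp_mem hT.le t)
    rw [clamp_of_mem (clamp_mem hT.le t), hρ0] at this
    rw [this]
    congr 1
    ext1 x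
    exact (hX.clamp t x).symm
  have hIeq : ∫ t in (0 : ℝ)..T, (eLpNorm (velocityWeight (v (clamp T t))
      (fderiv ℝ (v (clamp T t)))) ⊤ volume).toReal = I := by
    rw [← hI]
    refine intervalIntegral.integral_congr fun t ht => ?_
    rw [uIcc_of_le hT.le] at ht
    simp only [clamp_of_mem ht]
  have hm0 : ∫ x, ‖x‖ ^ 2 ∂toMeasure w = ∫ x, ‖x‖ ^ 2 * w x := by
    rw [integral_toMeasure hw.measurable hw0]
    simp only [smul_eq_mul, mul_comm]
  obtain ⟨-, h2, h3, h4⟩ := hr.uniform_bounds hf hγ hk hM hvr hu hwk hX htr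
    hvr.continuous_eLpNorm_velocityWeight (fun t => ENNReal.toReal_nonneg) hvr.sq_norm_le
    hvr.divOf_le hC (fun t => hlow _ (hr.prob t) (hr.moment t)) hT.le (Y := Y)
    (by rw [hρ0, hIeq, hm0]; exact hY)
  rw [hIeq] at h2 h4
  rw [hρ0] at h2
  refine ⟨X, hr, htr, fun t s hs => ?_, fun t ht => ?_, h3, h4.trans hC₂⟩
  · have : X t ⁻¹' s = X (clamp T t) ⁻¹' s := by
      ext x
      rw [mem_preimage, hX.clamp t x, mem_preimage]
    rw [this]
    exact hX.volume_preimage_eq_zero hu (clamp_mem hT.le t) hs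
  · linarith [h2 t ht]

/-- Well-prepared data bound only a sum, two of whose terms may be negative. The moment is bounded
through W₂-convergence; energy and entropy are bounded below by the moment; hence each single term
is bounded above uniformly in ε. -/
theorem WellPrepared.exists_isControlled (hf : IsEnergyDensity d f) {r : ℝ}
    (hφ : IsMollifierProfile φ r) (hφ₂ : Integrable fun x => ‖x‖ ^ 2 * φ x) {δ : ℝ → ℝ}
    (hδ : IsRegularizationScale δ) {ρ₀ : Measure (Space d)} (hρ₀ : IsP2 ρ₀)
    {u₀ : ℝ → Space d → ℝ} {vε : ℝ → ℝ → Space d → Space d}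
    (hwp : WellPrepared f φ δ v ρ₀ u₀ vε) {ρ : ℝ → ℝ → Measure (Space d)}
    (hρ : ∀ ε ∈ Ioo (0 : ℝ) 1,
      IsSolution f φ (δ ε) ε (vε ε) (toMeasure (u₀ ε)) (ρ ε)) (hT : 0 < T) :
    ∃ C : ℝ, 0 < C ∧ ∃ ε₀ ∈ Ioo (0 : ℝ) 1, ∀ ε ∈ Ioo (0 : ℝ) ε₀,
      δ ε + 1 / δ ε ≤ C / δ ε ∧
      ∃ X, IsControlled f φ (δ ε) ε T C (u₀ ε) X fun t => ρ ε (clamp T t) := by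
  obtain ⟨C₀, hC₀, hlow⟩ := exists_regEnergy_lower_bound hf
  obtain ⟨B, hB⟩ := hwp.bound T hT
  set m := ∫ x, ‖x‖ ^ 2 * φ x with hm
  have hm0 : 0 ≤ m := integral_nonneg fun x => mul_nonneg (by positivity) (hφ.nonneg x)
  -- Twice the square of the radius 1, plus twice the moment of the limit: a bound for the initial
  -- moments as soon as the W₂-distance to the limit is below 1.
  set m₁ : ℝ := 2 + 2 * (secondMoment ρ₀).toReal with hm₁
  have hm₁0 : 0 ≤ m₁ := by positivity
  -- One bound for all four terms: the bound of the sum plus everything that the negative parts of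
  -- energy and entropy can compensate.
  set B₁ : ℝ := |B| + C₀ * (1 + m₁ + m) + Real.pi * m₁ + m₁ with hB₁
  have hB₁0 : 0 ≤ B₁ := by positivity
  set Y : ℝ := (B₁ + (C₀ + 1) * (1 + B₁) + C₀ * m) * Real.exp (B₁ + 4 * (C₀ + 1) ^ 2 * T) with hY
  have hY0 : 0 ≤ Y := by positivity
  have hhalf : (1 / 2 : ℝ) ∈ Ioo (0 : ℝ) 1 := ⟨by norm_num, by norm_num⟩
  -- The last summand dominates δ(ε)² + 1 for ε < 1/2, by monotonicity of δ, which gives δ + 1/δ ≤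
  -- C'/δ.
  set C' : ℝ := 2 * (B₁ + B₁ * Y + C₀ * (Y + m)) + (B₁ + Real.pi * Y + B₁ * Y)
    + (δ (1 / 2) ^ 2 + 1) with hC'
  obtain ⟨ε₁, hε₁, hW⟩ : ∃ ε₁ > 0, ∀ ε ∈ Ioo (0 : ℝ) ε₁, W2 (toMeasure (u₀ ε)) ρ₀ < (1 : ℝ≥0) := by
    have := (tendsto_order.1 hwp.tendsto_datum).2 ((1 : ℝ≥0) : ℝ≥0∞) (by simp)
    rw [eventually_nhdsWithin_iff, Metric.eventually_nhds_iff] at this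
    obtain ⟨e, he, h⟩ := this
    exact ⟨e, he, fun ε hε => h (by rw [Real.dist_eq, sub_zero, abs_of_pos hε.1]; exact hε.2) hε.1⟩
  refine ⟨C', by positivity, min ε₁ (1 / 2), ⟨lt_min hε₁ (by norm_num),
    (min_le_right _ _).trans_lt (by norm_num)⟩, fun ε hε => ?_⟩
  have hε1 : ε ∈ Ioo (0 : ℝ) 1 := ⟨hε.1, (hε.2.trans_le (min_le_right _ _)).trans (by norm_num)⟩
  have hγ := hδ.pos ε hε1
  have hδle : δ ε ≤ δ (1 / 2) := hδ.mono hε1 hhalf (hε.2.trans_le (min_le_right _ _)).le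
  have hk := hφ.isKernel hφ₂ hε.1
  obtain ⟨M, hM⟩ := hk.bound
  have hM : IsKernelBound (rescale φ ε) M := hM
  constructor
  · rw [← sub_nonneg, show C' / δ ε - (δ ε + 1 / δ ε) = (C' - (δ ε ^ 2 + 1)) / δ ε by
      field_simp]
    have : δ ε ^ 2 ≤ δ (1 / 2) ^ 2 := by gcongr
    have h1 : 0 ≤ 2 * (B₁ + B₁ * Y + C₀ * (Y + m)) + (B₁ + Real.pi * Y + B₁ * Y) := by positivity
    exact div_nonneg (by linarith) hγ.le
  have hwC := (hwp.smooth ε hε1).1.continuous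
  have hwc := (hwp.smooth ε hε1).2
  have hw0 := hwp.nonneg ε hε1
  have hw1 := hwp.integral_eq_one ε hε1
  have hinit := (hρ ε hε1).initial
  have hP2 : IsP2 (toMeasure (u₀ ε)) := hinit ▸ (hρ ε hε1).ac.1 0 le_rfl
  have hmε : ∫ x, ‖x‖ ^ 2 * rescale φ ε x ≤ m := by
    rw [integral_sq_mul_rescale φ hε.1]
    exact mul_le_of_le_one_left hm0 (by nlinarith [hε.1, hε1.2])
  have hlow' : ∀ ν : Measure (Space d), IsProbabilityMeasure ν → secondMoment ν < ⊤ →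
      δ ε / 2 * (∫ x, smoothed φ ε ν x ^ 2) ≤ regEnergy f φ (δ ε) ε ν
        + C₀ * (1 + (∫ x, ‖x‖ ^ 2 ∂ν) + m) := fun ν hν h2 =>
    (hlow φ (δ ε) ε M ν hν hγ hk hM h2).trans (by gcongr)
  have hmom : ∫ x, ‖x‖ ^ 2 ∂toMeasure (u₀ ε) = ∫ x, ‖x‖ ^ 2 * u₀ ε x := by
    rw [integral_toMeasure hwC.measurable hw0]
    simp only [smul_eq_mul, mul_comm]
  have hmle : ∫ x, ‖x‖ ^ 2 * u₀ ε x ≤ m₁ := by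
    have h1 := secondMoment_le_of_W2 (hW ε ⟨hε.1, hε.2.trans_le (min_le_left _ _)⟩)
    have h2 : 2 * ((1 : ℝ≥0) : ℝ≥0∞) ^ 2 + 2 * secondMoment ρ₀ ≠ ⊤ :=
      ENNReal.add_ne_top.2 ⟨by simp, ENNReal.mul_ne_top (by simp) hρ₀.2.ne⟩
    rw [← hmom, integral_sq_norm_eq]
    refine (ENNReal.toReal_mono h2 h1).trans (le_of_eq ?_)
    rw [ENNReal.toReal_add (by simp) (ENNReal.mul_ne_top (by simp) hρ₀.2.ne)]
    simp [hm₁]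
  have hment : 0 ≤ ∫ x, ‖x‖ ^ 2 * u₀ ε x :=
    integral_nonneg fun x => mul_nonneg (by positivity) (hw0 x)
  have hS := integral_entropy_lower hwC hwc hw0 hw1
  have hcomm : ∫ x, u₀ ε x * ‖x‖ ^ 2 = ∫ x, ‖x‖ ^ 2 * u₀ ε x := by simp only [mul_comm]
  rw [hcomm] at hS
  have he := hlow' _ hP2.1 hP2.2
  rw [hmom] at he
  have he' : 0 ≤ δ ε / 2 * (∫ x, smoothed φ ε (toMeasure (u₀ ε)) x ^ 2) :=
    mul_nonneg (by positivity) (integral_nonneg fun x => by positivity)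
  have hI : 0 ≤ ∫ t in (0 : ℝ)..T,
      (eLpNorm (velocityWeight (vε ε t) (fderiv ℝ (vε ε t))) ⊤ volume).toReal :=
    intervalIntegral.integral_nonneg hT.le fun t _ => ENNReal.toReal_nonneg
  have hBε := hB ε hε1
  have hsol := @IsSolution.exists_isControlled d f φ (δ ε) ε T (ρ ε) (vε ε) (u₀ ε) hf hγ hk hwC hwc
    hw0 hw1 (hwp.velocity ε hε1) hT (hρ ε hε1) C₀ m
  set e₀ := regEnergy f φ (δ ε) ε (toMeasure (u₀ ε))
  set S₀ := ∫ x, u₀ ε x * Real.log (u₀ ε x)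
  set n₀ := ∫ x, ‖x‖ ^ 2 * u₀ ε x
  set I₀ := ∫ t in (0 : ℝ)..T,
      (eLpNorm (velocityWeight (vε ε t) (fderiv ℝ (vε ε t))) ⊤ volume).toReal
  have hπ := Real.pi_pos
  clear_value e₀ S₀ n₀ I₀ C' Y B₁ m₁ m
  have hn : C₀ * (1 + n₀ + m) ≤ C₀ * (1 + m₁ + m) := by gcongr
  have hn' : Real.pi * n₀ ≤ Real.pi * m₁ := by gcongr
  have hBabs := le_abs_self B
  have hp1 : 0 ≤ C₀ * (1 + m₁ + m) := by positivity
  have hp2 : 0 ≤ Real.pi * m₁ := by positivity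
  have habs : 0 ≤ |B| := abs_nonneg B
  have he₀ : e₀ ≤ B₁ := by linarith
  have hS₀ : S₀ ≤ B₁ := by linarith
  have hn₀ : n₀ ≤ B₁ := by linarith
  have hI₁ : I₀ ≤ B₁ := by linarith
  have hIY : I₀ * Y ≤ B₁ * Y := by gcongr
  have hq1 : 0 ≤ B₁ * Y := by positivity
  have hq2 : 0 ≤ C₀ * (Y + m) := by positivity
  have hq3 : 0 ≤ Real.pi * Y := by positivity
  have hq4 : 0 ≤ δ (1 / 2) ^ 2 := by positivity
  have hYle : (e₀ + (C₀ + 1) * (1 + n₀) + C₀ * m) * Real.exp (I₀ + 4 * (C₀ + 1) ^ 2 * T) ≤ Y := by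
    rw [hY]
    refine mul_le_mul ?_ (Real.exp_le_exp.2 (by linarith)) (Real.exp_pos _).le (by positivity)
    have : (C₀ + 1) * (1 + n₀) ≤ (C₀ + 1) * (1 + B₁) := by gcongr
    linarith
  have hC₁ : 2 * (e₀ + I₀ * Y + C₀ * (Y + m)) ≤ C' := by linarith
  have hC₂ : S₀ + Real.pi * Y + I₀ * Y ≤ C' := by linarith
  exact hsol hC₀ hlow' rfl hYle hC₁ hC₂

end Estimates

end NonlocalDiffusion

end

noncomputable section

namespace NonlocalDiffusion

/-! ### Exchanging the mollifier at a fixed time -/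

section Exchange

variable {d : ℕ} {f : ℝ → EReal} {φ : Space d → ℝ} {γ ε M r : ℝ} {ρ : Measure (Space d)}

theorem integral_mul_le_sqrt_mul_sqrt {α : Type*} [MeasurableSpace α] {μ : Measure α}
    {a b : α → ℝ} (ha0 : ∀ x, 0 ≤ a x) (hb0 : ∀ x, 0 ≤ b x) (ha : MemLp a 2 μ)
    (hb : MemLp b 2 μ) :
    ∫ x, a x * b x ∂μ ≤ √(∫ x, a x ^ 2 ∂μ) * √(∫ x, b x ^ 2 ∂μ) := by
  have h2 : ENNReal.ofReal 2 = 2 := by simp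
  have := integral_mul_le_Lp_mul_Lq_of_nonneg Real.HolderConjugate.two_two (ae_of_all μ ha0)
    (ae_of_all μ hb0) (h2 ▸ ha) (h2 ▸ hb)
  simpa only [Real.sqrt_eq_rpow, Real.rpow_two] using this

/-- Rescaling the decay gives |z|^r φ_ε(z) ≤ C ε^{r−d}. The power θ/r of this bound is spent on
|z|^θ, and the power 1 − θ/r of the kernel is kept. As θ/r ≤ 1, the constant max(1, C) serves every
θ. -/
theorem IsMollifierProfile.exists_rpow_mul_rescale_le (hφ : IsMollifierProfile φ r) :
    ∃ K : ℝ, 0 < K ∧ ∀ ε θ : ℝ, 0 < ε → 0 < θ → θ < 1 → ∀ z : Space d,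
      ‖z‖ ^ θ * rescale φ ε z ≤ K * ε ^ (θ * (r - d) / r) * rescale φ ε z ^ (1 - θ / r) := by
  obtain ⟨C, hC, hdec⟩ := hφ.decay
  have hr2 : 2 < r := (le_max_right _ _).trans_lt hφ.lt_exponent
  have hr : 0 < r := by linarith
  refine ⟨max 1 C, by positivity, fun ε θ hε hθ hθ1 z => ?_⟩
  have hk0 : 0 ≤ rescale φ ε z := mul_nonneg (by positivity) (hφ.nonneg _)
  have hθr : 0 < θ / r := by positivity
  have hθr1 : θ / r < 1 := by rw [div_lt_one hr]; linarith
  have key : ‖z‖ ^ r * rescale φ ε z ≤ C * ε ^ (r - d) := by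
    rcases eq_or_ne z 0 with rfl | hz
    · rw [norm_zero, Real.zero_rpow hr.ne', zero_mul]
      positivity
    have hzn : 0 < ‖z‖ := norm_pos_iff.2 hz
    have h1 := hdec (ε⁻¹ • z) (by simp [hz, hε.ne'])
    rw [norm_smul, norm_inv, Real.norm_of_nonneg hε.le] at h1
    calc ‖z‖ ^ r * rescale φ ε z ≤ ‖z‖ ^ r * ((ε ^ d)⁻¹ * (C * (ε⁻¹ * ‖z‖) ^ (-r))) := by
          unfold rescale; gcongr
      _ = C * ε ^ (r - d) := by
          rw [Real.mul_rpow (by positivity) hzn.le, Real.rpow_neg hzn.le,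
            Real.inv_rpow hε.le, Real.rpow_neg hε.le, inv_inv, Real.rpow_sub hε,
            Real.rpow_natCast]
          field_simp
  calc ‖z‖ ^ θ * rescale φ ε z
      = (‖z‖ ^ r * rescale φ ε z) ^ (θ / r) * rescale φ ε z ^ (1 - θ / r) := by
        rw [Real.mul_rpow (by positivity) hk0, ← Real.rpow_mul (norm_nonneg _),
          mul_div_cancel₀ _ hr.ne', mul_assoc, ← Real.rpow_add_of_nonneg hk0 hθr.le (by linarith),
          add_sub_cancel, Real.rpow_one]
    _ ≤ (C * ε ^ (r - d)) ^ (θ / r) * rescale φ ε z ^ (1 - θ / r) := by gcongr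
    _ = C ^ (θ / r) * ε ^ (θ * (r - d) / r) * rescale φ ε z ^ (1 - θ / r) := by
        rw [Real.mul_rpow hC.le (by positivity), ← Real.rpow_mul hε.le]
        congr 3
        ring
    _ ≤ max 1 C * ε ^ (θ * (r - d) / r) * rescale φ ε z ^ (1 - θ / r) := by
        gcongr
        calc C ^ (θ / r) ≤ max 1 C ^ (θ / r) := by gcongr; exact le_max_right _ _
          _ ≤ max 1 C ^ (1 : ℝ) := Real.rpow_le_rpow_of_exponent_le (le_max_left _ _) hθr1.le
          _ = max 1 C := Real.rpow_one _

theorem smul_exchangeError (h : Space d → ℝ) (x : Space d) :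
    h x • exchangeError f φ γ ε ρ x = density ρ x • h x • gradient (pressure f φ γ ε ρ) x
      - smoothed φ ε ρ x • h x • gradient (potential f φ γ ε ρ) x := by
  rw [exchangeError, smul_sub, smul_comm (h x), smul_comm (h x)]

/-- With m the smoothed density, m^{2σ} = γ^{−(2σ−1)} m (γm)^{2σ−1}, and s^{2σ−1} ≤ 1 + s since 0 ≤
2σ − 1 ≤ 1. This uses exactly the two quantities available uniformly, the mass of μ and γ ∫ μ². -/
theorem smoothed_rpow_le (hγ : 0 < γ) (hk : IsKernel (rescale φ ε)) {σ : ℝ} (hσ : 1 / 2 ≤ σ)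
    (hσ1 : σ ≤ 1) (y : Space d) :
    (smoothed φ ε ρ y ^ σ) ^ 2 ≤
      γ ^ (-(2 * σ - 1)) * (smoothed φ ε ρ y + γ * smoothed φ ε ρ y ^ 2) := by
  have h0 := smoothed_nonneg (ρ := ρ) hk y
  set m := smoothed φ ε ρ y
  have h1 : (γ * m) ^ (2 * σ - 1) ≤ 1 + γ * m := by
    have hp : 0 ≤ γ * m := by positivity
    rcases le_total (γ * m) 1 with h | h
    · linarith [Real.rpow_le_one hp h (by linarith : 0 ≤ 2 * σ - 1)]
    · have := Real.rpow_le_rpow_of_exponent_le h (by linarith : 2 * σ - 1 ≤ 1)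
      rw [Real.rpow_one] at this
      linarith
  have h2 : (m ^ σ) ^ 2 = m * m ^ (2 * σ - 1) := by
    rw [← Real.rpow_natCast, ← Real.rpow_mul h0]
    nth_rw 2 [← Real.rpow_one m]
    rw [← Real.rpow_add_of_nonneg h0 zero_le_one (by linarith)]
    congr 1
    push_cast
    ring
  calc (m ^ σ) ^ 2 = γ ^ (-(2 * σ - 1)) * (m * (γ * m) ^ (2 * σ - 1)) := by
        rw [h2, Real.mul_rpow hγ.le h0, Real.rpow_neg hγ.le]
        have : 0 < γ ^ (2 * σ - 1) := by positivity
        field_simp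
    _ ≤ γ ^ (-(2 * σ - 1)) * (m * (1 + γ * m)) := by gcongr
    _ = _ := by ring

variable [IsProbabilityMeasure ρ]

theorem integrable_kernel_rpow (hk : IsKernel (rescale φ ε)) (hM : IsKernelBound (rescale φ ε) M)
    {σ : ℝ} (hσ : 0 ≤ σ) (y : Space d) : Integrable (fun x => rescale φ ε (y - x) ^ σ) ρ := by
  have hc := hk.continuous
  refine Integrable.of_bound (Continuous.aestronglyMeasurable
    (Continuous.rpow_const (by fun_prop) fun _ => Or.inr hσ)) (M ^ σ) (ae_of_all _ fun x => ?_)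
  rw [Real.norm_of_nonneg (Real.rpow_nonneg (hk.nonneg _) _)]
  exact Real.rpow_le_rpow (hk.nonneg _) ((le_abs_self _).trans (hM _).1) hσ

/-- Jensen's inequality for the concave power σ and the probability measure ρ. -/
theorem integral_kernel_rpow_le (hk : IsKernel (rescale φ ε)) (hM : IsKernelBound (rescale φ ε) M)
    {σ : ℝ} (hσ : 0 ≤ σ) (hσ1 : σ ≤ 1) (y : Space d) :
    ∫ x, rescale φ ε (y - x) ^ σ ∂ρ ≤ smoothed φ ε ρ y ^ σ :=
  (Real.concaveOn_rpow hσ hσ1).le_map_integral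
    (continuousOn_id.rpow_const fun _ _ => Or.inr hσ) isClosed_Ici
    (ae_of_all _ fun _ => hk.nonneg _) (integrable_kernel hk hM y)
    (integrable_kernel_rpow hk hM hσ y)

theorem memLp_smoothed_rpow (hγ : 0 < γ) (hk : IsKernel (rescale φ ε))
    (hM : IsKernelBound (rescale φ ε) M) {σ : ℝ} (hσ : 1 / 2 ≤ σ) (hσ1 : σ ≤ 1) :
    MemLp (fun y => smoothed φ ε ρ y ^ σ) 2 := by
  have hc : Continuous fun y => smoothed φ ε ρ y ^ σ :=
    (continuous_smoothed hk hM).rpow_const fun _ => Or.inr (by linarith)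
  rw [memLp_two_iff_integrable_sq hc.aestronglyMeasurable]
  refine (((integrable_smoothed (ρ := ρ) hk).add
    ((integrable_smoothed_sq (ρ := ρ) hk hM).const_mul γ)).const_mul (γ ^ (-(2 * σ - 1)))).mono'
    (hc.pow 2).aestronglyMeasurable (ae_of_all _ fun y => ?_)
  rw [Real.norm_of_nonneg (by positivity)]
  exact smoothed_rpow_le hγ hk hσ hσ1 y

theorem integral_smoothed_rpow_le (hγ : 0 < γ) (hk : IsKernel (rescale φ ε))
    (hM : IsKernelBound (rescale φ ε) M) {σ : ℝ} (hσ : 1 / 2 ≤ σ) (hσ1 : σ ≤ 1) {C : ℝ}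
    (hC : γ * (∫ x, smoothed φ ε ρ x ^ 2) ≤ C) :
    ∫ y, (smoothed φ ε ρ y ^ σ) ^ 2 ≤ γ ^ (-(2 * σ - 1)) * (1 + C) := by
  have h1 := integrable_smoothed (ρ := ρ) hk
  have h2 : Integrable fun y => γ * smoothed φ ε ρ y ^ 2 :=
    (integrable_smoothed_sq (ρ := ρ) hk hM).const_mul γ
  calc ∫ y, (smoothed φ ε ρ y ^ σ) ^ 2
      ≤ ∫ y, γ ^ (-(2 * σ - 1)) * (smoothed φ ε ρ y + γ * smoothed φ ε ρ y ^ 2) :=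
        integral_mono (memLp_smoothed_rpow hγ hk hM hσ hσ1).integrable_sq
          ((h1.add h2).const_mul _) fun y => smoothed_rpow_le hγ hk hσ hσ1 y
    _ = γ ^ (-(2 * σ - 1)) * (1 + γ * ∫ y, smoothed φ ε ρ y ^ 2) := by
        rw [integral_const_mul, integral_add h1 h2, integral_smoothed hk, integral_const_mul]
    _ ≤ _ := by gcongr

theorem integrable_gradient_smoothed (hk : IsKernel (rescale φ ε))
    (hM : IsKernelBound (rescale φ ε) M) : Integrable (gradient (smoothed φ ε ρ)) := by
  have := (integrable_comp_sub_prod (ρ := ρ) hk.integrable_gradient).integral_prod_left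
  refine this.congr (ae_of_all _ fun y => ?_)
  exact (gradient_smoothed hk hM y).symm

theorem integrable_inner_gradient (hf : IsEnergyDensity d f) (hγ : 0 < γ)
    (hk : IsKernel (rescale φ ε)) (hM : IsKernelBound (rescale φ ε) M) :
    Integrable fun y => ⟪gradient (potential f φ γ ε ρ) y, gradient (smoothed φ ε ρ) y⟫_ℝ := by
  refine ((integrable_gradient_smoothed (ρ := ρ) hk hM).norm.const_mul
    (((γ + 1 / γ) * M).toNNReal : ℝ)).mono'
    ((measurable_gradient _).inner (measurable_gradient _)).aestronglyMeasurable
    (ae_of_all _ fun y => ?_)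
  refine (norm_inner_le_norm _ _).trans ?_
  gcongr
  exact norm_gradient_le_of_lipschitz (lipschitz_potential hf hγ hk hM) y

theorem memLp_gradient_potential (hf : IsEnergyDensity d f) (hγ : 0 < γ)
    (hk : IsKernel (rescale φ ε)) (hM : IsKernelBound (rescale φ ε) M) :
    MemLp (fun y => ‖gradient (potential f φ γ ε ρ) y‖) 2 := by
  have hm := (measurable_gradient (potential f φ γ ε ρ)).norm
  rw [memLp_two_iff_integrable_sq hm.aestronglyMeasurable]
  refine ((integrable_inner_gradient (ρ := ρ) hf hγ hk hM).const_mul (γ + 1 / γ)).mono'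
    (hm.pow_const 2).aestronglyMeasurable (ae_of_all _ fun y => ?_)
  rw [Real.norm_of_nonneg (by positivity)]
  exact sq_norm_gradient_potential_le hf hγ hk hM y

theorem integral_sq_norm_gradient_potential_le (hf : IsEnergyDensity d f) (hγ : 0 < γ)
    (hk : IsKernel (rescale φ ε)) (hM : IsKernelBound (rescale φ ε) M) :
    ∫ y, ‖gradient (potential f φ γ ε ρ) y‖ ^ 2 ≤ (γ + 1 / γ) * dissipation f φ γ ε ρ := by
  rw [dissipation, ← integral_const_mul]
  exact integral_mono (memLp_gradient_potential hf hγ hk hM).integrable_sq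
    ((integrable_inner_gradient hf hγ hk hM).const_mul _)
    fun y => sq_norm_gradient_potential_le hf hγ hk hM y

theorem dissipation_nonneg (hf : IsEnergyDensity d f) (hγ : 0 < γ)
    (hk : IsKernel (rescale φ ε)) (hM : IsKernelBound (rescale φ ε) M) :
    0 ≤ dissipation f φ γ ε ρ := by
  have h := integral_sq_norm_gradient_potential_le (ρ := ρ) hf hγ hk hM
  have h1 : 0 ≤ ∫ y, ‖gradient (potential f φ γ ε ρ) y‖ ^ 2 := integral_nonneg fun y => by positivity
  have h2 : 0 < γ + 1 / γ := by positivity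
  nlinarith

/-- By Cauchy–Schwarz the gradient contributes a multiple of γ^{−1/2} √D and the power of μ
contributes γ^{−(2σ−1)/2}; the product scales like γ^{−σ}. -/
theorem integral_norm_gradient_mul_le (hf : IsEnergyDensity d f) (hγ : 0 < γ)
    (hk : IsKernel (rescale φ ε)) (hM : IsKernelBound (rescale φ ε) M) {σ : ℝ} (hσ : 1 / 2 ≤ σ)
    (hσ1 : σ ≤ 1) {C : ℝ} (hC0 : 0 ≤ C) (hC : γ * (∫ x, smoothed φ ε ρ x ^ 2) ≤ C)
    (hCγ : γ + 1 / γ ≤ C / γ) :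
    ∫ y, ‖gradient (potential f φ γ ε ρ) y‖ * smoothed φ ε ρ y ^ σ ≤
      √(C * (1 + C)) * γ ^ (-σ) * √(dissipation f φ γ ε ρ) := by
  have hD := dissipation_nonneg (ρ := ρ) hf hγ hk hM
  set D := dissipation f φ γ ε ρ with hDdef
  have h1 : ∫ y, ‖gradient (potential f φ γ ε ρ) y‖ ^ 2 ≤ C / γ * D :=
    (integral_sq_norm_gradient_potential_le hf hγ hk hM).trans (by gcongr)
  have h2 := integral_smoothed_rpow_le hγ hk hM hσ hσ1 hC
  calc _ ≤ √(∫ y, ‖gradient (potential f φ γ ε ρ) y‖ ^ 2) *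
        √(∫ y, (smoothed φ ε ρ y ^ σ) ^ 2) :=
        integral_mul_le_sqrt_mul_sqrt (fun y => norm_nonneg _)
          (fun y => Real.rpow_nonneg (smoothed_nonneg hk y) _)
          (memLp_gradient_potential hf hγ hk hM) (memLp_smoothed_rpow hγ hk hM hσ hσ1)
    _ ≤ √(C / γ * D) * √(γ ^ (-(2 * σ - 1)) * (1 + C)) := by gcongr
    _ = √(C * (1 + C) * (γ ^ (-σ)) ^ 2 * D) := by
        rw [← Real.sqrt_mul (by positivity)]
        congr 1
        have : (γ ^ (-σ)) ^ 2 = γ ^ (-(2 * σ - 1)) / γ := by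
          rw [← Real.rpow_natCast, ← Real.rpow_mul hγ.le, ← Real.rpow_sub_one hγ.ne']
          congr 1
          push_cast
          ring
        rw [this]
        ring
    _ = _ := by
        rw [Real.sqrt_mul (by positivity), Real.sqrt_mul (by positivity),
          Real.sqrt_sq (by positivity)]

/-- Growth is at most quadratic because θ ≤ 1, so finite second moments suffice to integrate against
Hölder functions. -/
theorem holder_abs_le {h : Space d → ℝ} {N θ : ℝ≥0} (hθ1 : θ ≤ 1) (hh : HolderWith N θ h)
    (x : Space d) : ‖h x‖ ≤ (‖h 0‖ + 2 * N) + N * ‖x‖ ^ 2 := by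
  have h1 := hh.dist_le x 0
  rw [dist_zero_right, dist_eq_norm] at h1
  have h2 : ‖h x‖ ≤ ‖h 0‖ + ‖h x - h 0‖ := by
    have := norm_add_le (h 0) (h x - h 0)
    rwa [add_sub_cancel] at this
  have h3 : ‖x‖ ^ (θ : ℝ) ≤ 2 + ‖x‖ ^ 2 := by
    have h4 : ‖x‖ ^ (θ : ℝ) ≤ 1 + ‖x‖ := by
      rcases le_total ‖x‖ 1 with h | h
      · linarith [Real.rpow_le_one (norm_nonneg x) h (NNReal.coe_nonneg θ), norm_nonneg x]
      · have := Real.rpow_le_rpow_of_exponent_le h (by exact_mod_cast hθ1 : (θ : ℝ) ≤ 1)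
        rw [Real.rpow_one] at this
        linarith
    nlinarith [sq_nonneg (‖x‖ - 1)]
  have h5 : (N : ℝ) * ‖x‖ ^ (θ : ℝ) ≤ N * (2 + ‖x‖ ^ 2) := by gcongr
  linarith

theorem integrable_weighted_kernel (hf : IsEnergyDensity d f) (hγ : 0 < γ)
    (hk : IsKernel (rescale φ ε)) (hM : IsKernelBound (rescale φ ε) M) (hρ : secondMoment ρ < ⊤)
    {h : Space d → ℝ} (hh : Continuous h) {a b : ℝ}
    (hab : ∀ x, ‖h x‖ ≤ a + b * ‖x‖ ^ 2) :
    Integrable (fun z : Space d × Space d => rescale φ ε (z.1 - z.2) • h z.1 •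
      gradient (potential f φ γ ε ρ) z.1) (volume.prod ρ) ∧
    Integrable (fun z : Space d × Space d => rescale φ ε (z.1 - z.2) • h z.2 •
      gradient (potential f φ γ ε ρ) z.1) (volume.prod ρ) := by
  have hc := hk.continuous
  set L : ℝ := NNReal.toReal ((γ + 1 / γ) * M).toNNReal
  have hL : ∀ y, ‖gradient (potential f φ γ ε ρ) y‖ ≤ L :=
    norm_gradient_le_of_lipschitz (lipschitz_potential hf hγ hk hM)
  have hL0 : 0 ≤ L := NNReal.coe_nonneg _
  have hm : Measurable fun z : Space d × Space d => gradient (potential f φ γ ε ρ) z.1 :=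
    (measurable_gradient _).comp measurable_fst
  have h0 := integrable_comp_sub_prod (ρ := ρ) hk.integrable
  obtain ⟨h1, h2⟩ := integrable_sq_smoothed_prod hk hρ
  have key : ∀ x y z : Space d, ‖rescale φ ε z • h x • gradient (potential f φ γ ε ρ) y‖ ≤
      L * (a * rescale φ ε z + b * (‖x‖ ^ 2 * rescale φ ε z)) := fun x y z => by
    have hz := hk.nonneg z
    rw [norm_smul, norm_smul, Real.norm_of_nonneg hz]
    have hx := hab x
    calc rescale φ ε z * (‖h x‖ * ‖gradient (potential f φ γ ε ρ) y‖)
        ≤ rescale φ ε z * ((a + b * ‖x‖ ^ 2) * L) := by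
          gcongr
          · exact (norm_nonneg _).trans hx
          · exact hL y
      _ = _ := by ring
  constructor
  · refine (((h0.const_mul a).add (h1.const_mul b)).const_mul L).mono' ?_
      (ae_of_all _ fun z => key _ _ _)
    exact ((by fun_prop : Measurable fun z : Space d × Space d => rescale φ ε (z.1 - z.2)).smul
      ((hh.measurable.comp measurable_fst).smul hm)).aestronglyMeasurable
  · refine (((h0.const_mul a).add (h2.const_mul b)).const_mul L).mono' ?_
      (ae_of_all _ fun z => key _ _ _)
    exact ((by fun_prop : Measurable fun z : Space d × Space d => rescale φ ε (z.1 - z.2)).smul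
      ((hh.measurable.comp measurable_snd).smul hm)).aestronglyMeasurable

theorem integral_kernel_smul_gradient (hf : IsEnergyDensity d f) (hγ : 0 < γ)
    (hk : IsKernel (rescale φ ε)) (hM : IsKernelBound (rescale φ ε) M) (h : Space d → ℝ)
    (x : Space d) : ∫ y, rescale φ ε (y - x) • h x • gradient (potential f φ γ ε ρ) y =
      h x • gradient (pressure f φ γ ε ρ) x := by
  rw [gradient_pressure_eq_integral hf hγ hk hM, ← integral_smul]
  refine integral_congr_ae (ae_of_all _ fun y => ?_)
  simp only [hk.symm x y]
  rw [smul_comm]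

/-- The two parts of the exchange error are integrable against Hölder functions. -/
theorem integrable_exchangeError_parts (hf : IsEnergyDensity d f) (hγ : 0 < γ)
    (hk : IsKernel (rescale φ ε)) (hM : IsKernelBound (rescale φ ε) M) (hρ : secondMoment ρ < ⊤)
    (hac : ρ ≪ volume) {h : Space d → ℝ} {N θ : ℝ≥0} (hθ : 0 < θ) (hθ1 : θ < 1)
    (hh : HolderWith N θ h) :
    Integrable (fun x => density ρ x • h x • gradient (pressure f φ γ ε ρ) x) ∧
    Integrable (fun y => smoothed φ ε ρ y • h y • gradient (potential f φ γ ε ρ) y) := by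
  obtain ⟨h1, h2⟩ := integrable_weighted_kernel hf hγ hk hM hρ (hh.continuous hθ)
    (holder_abs_le hθ1.le hh)
  constructor
  · refine (integrable_rnDeriv_smul_iff hac).2 (h2.integral_prod_right.congr
      (ae_of_all _ fun x => ?_))
    exact integral_kernel_smul_gradient hf hγ hk hM h x
  · refine h1.integral_prod_left.congr (ae_of_all _ fun y => ?_)
    exact integral_smul_const (fun x => rescale φ ε (y - x))
      (h y • gradient (potential f φ γ ε ρ) y)

theorem integrable_smul_exchangeError (hf : IsEnergyDensity d f) (hγ : 0 < γ)
    (hk : IsKernel (rescale φ ε)) (hM : IsKernelBound (rescale φ ε) M) (hρ : secondMoment ρ < ⊤)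
    (hac : ρ ≪ volume) {h : Space d → ℝ} {N θ : ℝ≥0} (hθ : 0 < θ) (hθ1 : θ < 1)
    (hh : HolderWith N θ h) : Integrable fun x => h x • exchangeError f φ γ ε ρ x := by
  obtain ⟨h1, h2⟩ := integrable_exchangeError_parts hf hγ hk hM hρ hac hθ hθ1 hh
  simp only [smul_exchangeError]
  exact h1.sub h2

theorem integral_smul_exchangeError (hf : IsEnergyDensity d f) (hγ : 0 < γ)
    (hk : IsKernel (rescale φ ε)) (hM : IsKernelBound (rescale φ ε) M) (hρ : secondMoment ρ < ⊤)
    (hac : ρ ≪ volume) {h : Space d → ℝ} {N θ : ℝ≥0} (hθ : 0 < θ) (hθ1 : θ < 1)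
    (hh : HolderWith N θ h) : ∫ x, h x • exchangeError f φ γ ε ρ x =
      (∫ x, h x • gradient (pressure f φ γ ε ρ) x ∂ρ)
        - ∫ y, smoothed φ ε ρ y • h y • gradient (potential f φ γ ε ρ) y := by
  obtain ⟨h1, h2⟩ := integrable_exchangeError_parts hf hγ hk hM hρ hac hθ hθ1 hh
  simp only [smul_exchangeError]
  rw [integral_sub h1 h2]
  congr 1
  exact integral_rnDeriv_smul hac

/-- The commutator estimate: the Hölder bound, the trade of |z|^θ for a power of the kernel,
Jensen's inequality in x, then Cauchy–Schwarz in y. -/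
theorem norm_integral_smul_exchangeError_le (hf : IsEnergyDensity d f) (hγ : 0 < γ)
    (hk : IsKernel (rescale φ ε)) (hM : IsKernelBound (rescale φ ε) M) (hρ : secondMoment ρ < ⊤)
    (hac : ρ ≪ volume) {h : Space d → ℝ} {N θ : ℝ≥0} (hθ : 0 < θ) (hθ1 : θ < 1)
    (hh : HolderWith N θ h) {κ σ : ℝ} (hσ : 1 / 2 ≤ σ) (hσ1 : σ ≤ 1) (hκ0 : 0 ≤ κ)
    (hκ : ∀ z : Space d, ‖z‖ ^ (θ : ℝ) * rescale φ ε z ≤ κ * rescale φ ε z ^ σ) {C : ℝ}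
    (hC0 : 0 ≤ C) (hC : γ * (∫ x, smoothed φ ε ρ x ^ 2) ≤ C) (hCγ : γ + 1 / γ ≤ C / γ) :
    ‖∫ x, h x • exchangeError f φ γ ε ρ x‖ ≤
      N * (κ * (√(C * (1 + C)) * γ ^ (-σ) * √(dissipation f φ γ ε ρ))) := by
  obtain ⟨h1, h2⟩ := integrable_weighted_kernel hf hγ hk hM hρ (hh.continuous hθ)
    (holder_abs_le hθ1.le hh)
  have hL := memLp_gradient_potential (ρ := ρ) hf hγ hk hM
  have hS := memLp_smoothed_rpow (ρ := ρ) hγ hk hM hσ hσ1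
  have hLS : Integrable fun y => ‖gradient (potential f φ γ ε ρ) y‖ * smoothed φ ε ρ y ^ σ :=
    hL.integrable_mul hS
  -- Both terms are double integrals of the same kernel against ∇q(y); only the point at which the
  -- test function is evaluated differs.
  have hid : ∫ x, h x • exchangeError f φ γ ε ρ x = ∫ y, ∫ x, (rescale φ ε (y - x) •
      (h x - h y) • gradient (potential f φ γ ε ρ) y) ∂ρ := by
    rw [integral_smul_exchangeError hf hγ hk hM hρ hac hθ hθ1 hh]
    have e1 : ∫ x, h x • gradient (pressure f φ γ ε ρ) x ∂ρ =
        ∫ y, ∫ x, rescale φ ε (y - x) • h x • gradient (potential f φ γ ε ρ) y ∂ρ := by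
      rw [integral_integral_swap h2]
      simp only [integral_kernel_smul_gradient hf hγ hk hM]
    have e2 : ∫ y, smoothed φ ε ρ y • h y • gradient (potential f φ γ ε ρ) y =
        ∫ y, ∫ x, rescale φ ε (y - x) • h y • gradient (potential f φ γ ε ρ) y ∂ρ := by
      simp only [smoothed, integral_smul_const]
    rw [e1, e2, ← integral_sub h2.integral_prod_left h1.integral_prod_left]
    refine integral_congr_ae ?_
    filter_upwards [h1.prod_right_ae, h2.prod_right_ae] with y hy1 hy2
    rw [← integral_sub hy2 hy1]
    simp only [sub_smul, smul_sub]
  have hin : ∀ y, ‖∫ x, (rescale φ ε (y - x) • (h x - h y) •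
      gradient (potential f φ γ ε ρ) y) ∂ρ‖ ≤
      N * (κ * (‖gradient (potential f φ γ ε ρ) y‖ * smoothed φ ε ρ y ^ σ)) := fun y => by
    have hi := integrable_kernel_rpow (ρ := ρ) hk hM (by linarith : 0 ≤ σ) y
    refine (norm_integral_le_of_norm_le
      (hi.const_mul (N * κ * ‖gradient (potential f φ γ ε ρ) y‖)) (ae_of_all _ fun x => ?_)).trans ?_
    · rw [norm_smul, norm_smul, Real.norm_of_nonneg (hk.nonneg _), ← dist_eq_norm]
      have h3 := hh.dist_le x y
      rw [dist_comm x y, dist_eq_norm y x] at h3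
      have h4 := hκ (y - x)
      have h5 := hk.nonneg (y - x)
      calc rescale φ ε (y - x) * (dist (h x) (h y) * ‖gradient (potential f φ γ ε ρ) y‖)
          ≤ rescale φ ε (y - x) * ((N * ‖y - x‖ ^ (θ : ℝ)) *
            ‖gradient (potential f φ γ ε ρ) y‖) := by gcongr
        _ = N * ‖gradient (potential f φ γ ε ρ) y‖ *
            (‖y - x‖ ^ (θ : ℝ) * rescale φ ε (y - x)) := by ring
        _ ≤ N * ‖gradient (potential f φ γ ε ρ) y‖ * (κ * rescale φ ε (y - x) ^ σ) := by gcongr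
        _ = _ := by ring
    · rw [integral_const_mul]
      calc _ ≤ N * κ * ‖gradient (potential f φ γ ε ρ) y‖ * smoothed φ ε ρ y ^ σ := by
            gcongr
            exact integral_kernel_rpow_le hk hM (by linarith) hσ1 y
        _ = _ := by ring
  rw [hid]
  refine (norm_integral_le_of_norm_le ((hLS.const_mul κ).const_mul (N : ℝ))
    (ae_of_all _ hin)).trans ?_
  rw [integral_const_mul, integral_const_mul]
  gcongr
  exact integral_norm_gradient_mul_le hf hγ hk hM hσ hσ1 hC0 hC hCγ

end Exchange

end NonlocalDiffusion

end

noncomputable section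

namespace NonlocalDiffusion

/-! ### Integration in time -/

section Time

variable {d : ℕ} {f : ℝ → EReal} {φ : Space d → ℝ} {γ ε M T C : ℝ} {ρ : ℝ → Measure (Space d)}
  {w : Space d → ℝ} {X : ℝ → Space d → Space d} {θ : ℝ≥0} {g : ℝ → Space d → ℝ}

theorem IsRegularCurve.continuous_smoothed_uncurry (hρ : IsRegularCurve ρ)
    (hk : IsKernel (rescale φ ε)) (hM : IsKernelBound (rescale φ ε) M) :
    Continuous fun z : ℝ × Space d => smoothed φ ε (ρ z.1) z.2 := by
  refine IsRegularField.uniform_time_continuous_of_norm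
    (w := fun t => smoothed φ ε (ρ t)) hM.nonneg (fun t x y => ?_)
    fun η hη => ?_
  · have := hρ.prob t
    have := (lipschitz_smoothed (ρ := ρ t) hk hM).dist_le_mul x y
    rwa [dist_eq_norm, dist_eq_norm, Real.coe_toNNReal _ hM.nonneg] at this
  · exact hρ.smoothed_time hk hM hη

theorem IsRegularCurve.continuous_potential_uncurry (hρ : IsRegularCurve ρ)
    (hf : IsEnergyDensity d f) (hγ : 0 < γ) (hk : IsKernel (rescale φ ε))
    (hM : IsKernelBound (rescale φ ε) M) :
    Continuous fun z : ℝ × Space d => potential f φ γ ε (ρ z.1) z.2 := by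
  have hM0 := hM.nonneg
  have hL : 0 ≤ (γ + 1 / γ) * M := by positivity
  refine IsRegularField.uniform_time_continuous_of_norm
    (w := fun t => potential f φ γ ε (ρ t)) hL (fun t x y => ?_) fun η hη => ?_
  · have := hρ.prob t
    have := (lipschitz_potential (ρ := ρ t) hf hγ hk hM).dist_le_mul x y
    rwa [dist_eq_norm, dist_eq_norm, Real.coe_toNNReal _ hL] at this
  · exact hρ.potential_time hf hγ hk hM hη

theorem measurable_gradient_uncurry {q : ℝ → Space d → ℝ}
    (hq : Continuous fun z : ℝ × Space d => q z.1 z.2) :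
    Measurable fun z : ℝ × Space d => gradient (q z.1) z.2 :=
  (InnerProductSpace.toDual ℝ (Space d)).symm.continuous.measurable.comp
    (measurable_fderiv_with_param ℝ (f := q) hq)

theorem IsControlled.absolutelyContinuous (h : IsControlled f φ γ ε T C w X ρ) (t : ℝ) :
    ρ t ≪ volume := by
  rw [h.transported.map t]
  refine Measure.AbsolutelyContinuous.mk fun s hs h0 => ?_
  rw [Measure.map_apply (h.transported.continuous t).measurable hs]
  exact withDensity_absolutelyContinuous _ _ (h.null t s h0)

/-- In space-time g is measurable only up to null sets, a property that composition with the flow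
preserves because preimages of null sets are null. -/
theorem IsControlled.quasiMeasurePreserving (h : IsControlled f φ γ ε T C w X ρ)
    (ν : Measure ℝ) [SFinite ν] :
    Measure.QuasiMeasurePreserving (fun z : ℝ × Space d => (z.1, X z.1 z.2))
      (ν.prod volume) (ν.prod volume) := by
  have hm : Measurable fun z : ℝ × Space d => (z.1, X z.1 z.2) :=
    measurable_fst.prodMk h.transported.continuous_flow.measurable
  refine ⟨hm, Measure.AbsolutelyContinuous.mk fun s hs h0 => ?_⟩
  rw [Measure.map_apply hm hs, Measure.measure_prod_null (hm hs)]
  filter_upwards [Measure.measure_ae_null_of_prod_null h0] with t ht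
  exact h.null t _ ht

theorem MemHolderL2.aestronglyMeasurable_prod (hg : MemHolderL2 T θ g) :
    AEStronglyMeasurable (fun z : ℝ × Space d => g z.1 z.2)
      ((volume.restrict (Icc 0 T)).prod volume) := by
  have := hg.aestronglyMeasurable
  rwa [Measure.volume_eq_prod, ← Measure.prod_restrict, Measure.restrict_univ] at this

theorem MemHolderL2.memLp (hg : MemHolderL2 T θ g) :
    MemLp (fun t => (nnHolderNorm θ (g t) : ℝ)) 2 (volume.restrict (Icc 0 T)) ∧
      √(∫ t in Icc 0 T, (nnHolderNorm θ (g t) : ℝ) ^ 2) = (holderL2Norm T θ g).toReal := by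
  have he : eLpNorm (fun t => (nnHolderNorm θ (g t) : ℝ)) 2 (volume.restrict (Icc 0 T)) =
      holderL2Norm T θ g := by
    refine eLpNorm_congr_enorm_ae ?_
    filter_upwards [hg.memHolder] with t ht
    rw [← ht.coe_nnHolderNorm_eq_eHolderNorm]
    simp
  have hm : MemLp (fun t => (nnHolderNorm θ (g t) : ℝ)) 2 (volume.restrict (Icc 0 T)) :=
    ⟨(hg.aemeasurable_norm.ennreal_toReal).aestronglyMeasurable, he ▸ hg.norm_lt_top⟩
  refine ⟨hm, ?_⟩
  have h2 := hm.eLpNorm_eq_integral_rpow_norm (by norm_num) (by norm_num)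
  rw [← he, h2, ENNReal.toReal_ofReal (by positivity), Real.sqrt_eq_rpow]
  simp

/-- Rewriting the integral against ρ along the flow replaces the densities of ρ, chosen separately
at each time, by the fixed initial density; the integrand is then jointly measurable in time and
space. -/
theorem IsControlled.aestronglyMeasurable_integral (h : IsControlled f φ γ ε T C w X ρ)
    (hf : IsEnergyDensity d f) (hγ : 0 < γ) (hk : IsKernel (rescale φ ε))
    (hM : IsKernelBound (rescale φ ε) M) (hθ : 0 < θ) (hθ1 : θ < 1) (hg : MemHolderL2 T θ g) :
    AEStronglyMeasurable (fun t => ∫ x, g t x • exchangeError f φ γ ε (ρ t) x)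
      (volume.restrict (Icc 0 T)) := by
  have hgm := hg.aestronglyMeasurable_prod
  have hp := h.curve.continuous_gradient_pressure hf hγ hk hM
  have hq := measurable_gradient_uncurry (q := fun t => potential f φ γ ε (ρ t))
    (h.curve.continuous_potential_uncurry hf hγ hk hM)
  have hμ := h.curve.continuous_smoothed_uncurry hk hM
  have hXc := h.transported.continuous_flow
  have hΨ : Continuous fun z : ℝ × Space d => (z.1, X z.1 z.2) := continuous_fst.prodMk hXc
  have h1 : AEStronglyMeasurable (fun z : ℝ × Space d => w z.2 • g z.1 (X z.1 z.2) •
      gradient (pressure f φ γ ε (ρ z.1)) (X z.1 z.2))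
      ((volume.restrict (Icc 0 T)).prod volume) :=
    (h.transported.continuous_density.comp continuous_snd).aestronglyMeasurable.smul
      ((hgm.comp_quasiMeasurePreserving (h.quasiMeasurePreserving _)).smul
        (hp.comp hΨ).aestronglyMeasurable)
  have h2 : AEStronglyMeasurable (fun z : ℝ × Space d => smoothed φ ε (ρ z.1) z.2 • g z.1 z.2 •
      gradient (potential f φ γ ε (ρ z.1)) z.2)
      ((volume.restrict (Icc 0 T)).prod volume) :=
    hμ.aestronglyMeasurable.smul (hgm.smul hq.aestronglyMeasurable)
  refine (h1.integral_prod_right'.sub h2.integral_prod_right').congr ?_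
  filter_upwards [hg.memHolder] with t ht
  have := h.curve.prob t
  have hpt : Continuous (gradient (pressure f φ γ ε (ρ t))) :=
    hp.comp (by fun_prop : Continuous fun x : Space d => (t, x))
  rw [integral_smul_exchangeError hf hγ hk hM (h.curve.moment t) (h.absolutelyContinuous t) hθ hθ1
    ht.holderWith, h.transported.integral_eq t
    (g := fun x => g t x • gradient (pressure f φ γ ε (ρ t)) x) ((ht.holderWith.continuous hθ).smul hpt).stronglyMeasurable]
  rfl

/-- The estimate at a fixed time is a product of the Hölder seminorm and √D, both square integrable
in time; Cauchy–Schwarz and the bound on the total dissipation conclude. -/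
theorem IsControlled.exchange (h : IsControlled f φ γ ε T C w X ρ)
    (hf : IsEnergyDensity d f) (hγ : 0 < γ) (hk : IsKernel (rescale φ ε)) (hT : 0 ≤ T)
    (hC0 : 0 ≤ C) (hCγ : γ + 1 / γ ≤ C / γ) (hθ : 0 < θ) (hθ1 : θ < 1) (hg : MemHolderL2 T θ g)
    {κ σ : ℝ} (hσ : 1 / 2 ≤ σ) (hσ1 : σ ≤ 1) (hκ0 : 0 ≤ κ)
    (hκ : ∀ z : Space d, ‖z‖ ^ (θ : ℝ) * rescale φ ε z ≤ κ * rescale φ ε z ^ σ) :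
    (∀ᵐ t ∂(volume.restrict (Icc (0 : ℝ) T)),
      Integrable fun x => g t x • exchangeError f φ γ ε (ρ t) x) ∧
    IntegrableOn (fun t => ∫ x, g t x • exchangeError f φ γ ε (ρ t) x) (Icc 0 T) ∧
    ‖∫ t in Icc 0 T, ∫ x, g t x • exchangeError f φ γ ε (ρ t) x‖
      ≤ κ * (√(C * (1 + C)) * γ ^ (-σ)) * √C * (holderL2Norm T θ g).toReal := by
  obtain ⟨M, hM⟩ := hk.bound
  have hM : IsKernelBound (rescale φ ε) M := hM
  obtain ⟨hN, hNeq⟩ := hg.memLp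
  have hint : ∀ᵐ t ∂(volume.restrict (Icc (0 : ℝ) T)),
      Integrable fun x => g t x • exchangeError f φ γ ε (ρ t) x := by
    filter_upwards [hg.memHolder] with t ht
    have := h.curve.prob t
    exact integrable_smul_exchangeError hf hγ hk hM (h.curve.moment t) (h.absolutelyContinuous t)
      hθ hθ1 ht.holderWith
  have hD0 : ∀ t, 0 ≤ dissipation f φ γ ε (ρ t) := fun t => by
    have := h.curve.prob t
    exact dissipation_nonneg hf hγ hk hM
  have hDi : IntegrableOn (fun t => dissipation f φ γ ε (ρ t)) (Icc 0 T) :=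
    h.continuous_dissipation.integrableOn_Icc
  have hD : MemLp (fun t => √(dissipation f φ γ ε (ρ t))) 2 (volume.restrict (Icc 0 T)) := by
    rw [memLp_two_iff_integrable_sq h.continuous_dissipation.sqrt.aestronglyMeasurable]
    simp only [Real.sq_sqrt (hD0 _)]
    exact hDi
  set c := κ * (√(C * (1 + C)) * γ ^ (-σ)) with hc
  have hc0 : 0 ≤ c := by positivity
  have hle : ∀ᵐ t ∂(volume.restrict (Icc (0 : ℝ) T)),
      ‖∫ x, g t x • exchangeError f φ γ ε (ρ t) x‖ ≤
        c * ((nnHolderNorm θ (g t) : ℝ) * √(dissipation f φ γ ε (ρ t))) := by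
    filter_upwards [hg.memHolder, ae_restrict_mem measurableSet_Icc] with t ht htT
    have := h.curve.prob t
    refine (norm_integral_smul_exchangeError_le hf hγ hk hM (h.curve.moment t)
      (h.absolutelyContinuous t) hθ hθ1 ht.holderWith hσ hσ1 hκ0 hκ hC0 (h.energy_le t htT)
      hCγ).trans (le_of_eq ?_)
    rw [hc]
    ring
  have hND : Integrable (fun t => c * ((nnHolderNorm θ (g t) : ℝ) *
      √(dissipation f φ γ ε (ρ t)))) (volume.restrict (Icc 0 T)) :=
    (hN.integrable_mul hD).const_mul c
  refine ⟨hint, hND.mono' (h.aestronglyMeasurable_integral hf hγ hk hM hθ hθ1 hg) hle, ?_⟩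
  refine (norm_integral_le_of_norm_le hND hle).trans ?_
  rw [integral_const_mul, mul_assoc c]
  refine mul_le_mul_of_nonneg_left ?_ hc0
  have hDC : ∫ t in Icc 0 T, √(dissipation f φ γ ε (ρ t)) ^ 2 ≤ C := by
    simp only [Real.sq_sqrt (hD0 _)]
    rw [integral_Icc_eq_integral_Ioc, ← intervalIntegral.integral_of_le hT]
    exact h.dissipation_le
  calc _ ≤ √(∫ t in Icc 0 T, (nnHolderNorm θ (g t) : ℝ) ^ 2) *
        √(∫ t in Icc 0 T, √(dissipation f φ γ ε (ρ t)) ^ 2) :=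
        integral_mul_le_sqrt_mul_sqrt (fun t => NNReal.coe_nonneg _)
          (fun t => Real.sqrt_nonneg _) hN hD
    _ ≤ (holderL2Norm T θ g).toReal * √C := by rw [hNeq]; gcongr
    _ = _ := mul_comm _ _

end Time

end NonlocalDiffusion

end

/-! ### The mollifier exchange estimate -/

theorem proposition5p1 (d : ℕ) (hd : 1 ≤ d)
    (f : ℝ → EReal) (hf : IsEnergyDensity d f)
    (φ : Space d → ℝ) (r : ℝ) (hφ : IsMollifierProfile φ r)
    (hφ₂ : Integrable fun x => ‖x‖ ^ 2 * φ x)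
    (δ : ℝ → ℝ) (hδ : IsRegularizationScale δ)
    (v : ℝ → Space d → Space d) (hv : IsAdmissibleVelocity v)
    (ρ₀ : Measure (Space d)) (hρ₀ : IsAdmissibleDatum f ρ₀)
    (u₀ : ℝ → Space d → ℝ) (vε : ℝ → ℝ → Space d → Space d)
    (hwp : WellPrepared f φ δ v ρ₀ u₀ vε)
    (ρ : ℝ → ℝ → Measure (Space d))
    (hρ : ∀ ε ∈ Ioo (0 : ℝ) 1,
      IsSolution f φ (δ ε) ε (vε ε) (toMeasure (u₀ ε)) (ρ ε))
    (T : ℝ) (hT : 0 < T) :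
    ∃ C : ℝ, 0 < C ∧ ∃ ε₀ ∈ Ioo (0 : ℝ) 1, ∀ ε ∈ Ioo (0 : ℝ) ε₀,
      (∀ t ∈ Icc (0 : ℝ) T,
        ρ ε t ≪ volume ∧
        Differentiable ℝ (pressure f φ (δ ε) ε (ρ ε t)) ∧
        ∃ K : ℝ≥0, LipschitzWith K (potential f φ (δ ε) ε (ρ ε t))) ∧
      ∀ θ : ℝ≥0, 0 < θ → θ < 1 → ∀ g : ℝ → Space d → ℝ, MemHolderL2 T θ g →
        (∀ᵐ t ∂(volume.restrict (Icc (0 : ℝ) T)),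
          Integrable fun x => g t x • exchangeError f φ (δ ε) ε (ρ ε t) x) ∧
        IntervalIntegrable
          (fun t => ∫ x, g t x • exchangeError f φ (δ ε) ε (ρ ε t) x) volume 0 T ∧
        ‖∫ t in (0 : ℝ)..T, ∫ x, g t x • exchangeError f φ (δ ε) ε (ρ ε t) x‖
          ≤ C * ε ^ ((θ : ℝ) * (r - d) / r) * δ ε ^ (-((r - θ) / r))
            * (holderL2Norm T θ g).toReal := by
  obtain ⟨C, hC, ε₀, hε₀, hmain⟩ :=
    hwp.exists_isControlled hf hφ hφ₂ hδ hρ₀.1 hρ hT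
  obtain ⟨K, hK, hKle⟩ := hφ.exists_rpow_mul_rescale_le
  have hr2 : 2 < r := (le_max_right _ _).trans_lt hφ.lt_exponent
  -- K comes from the decay of the mollifier, √(C(1 + C)) from Cauchy–Schwarz in space and √C from
  -- the dissipation integrated in time.
  refine ⟨K * √(C * (1 + C)) * √C, by positivity, ε₀, hε₀, fun ε hε => ?_⟩
  obtain ⟨hCγ, X, hX⟩ := hmain ε hε
  have hγ := hδ.pos ε ⟨hε.1, hε.2.trans hε₀.2⟩
  have hk := hφ.isKernel hφ₂ hε.1
  obtain ⟨M, hM⟩ := hk.bound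
  refine ⟨fun t ht => ?_, fun θ hθ hθ1 g hg => ?_⟩
  · have hac := hX.absolutelyContinuous t
    have hprob := hX.curve.prob t
    rw [clamp_of_mem ht] at hac hprob
    exact ⟨hac, fun x => (hasFDerivAt_pressure hf hγ hk hM x).differentiableAt,
      _, lipschitz_potential hf hγ hk hM⟩
  have hθ0 : (0 : ℝ) < θ := by exact_mod_cast hθ
  have hθ1' : (θ : ℝ) < 1 := by exact_mod_cast hθ1
  -- This uses r > 2 and θ < 1, and is what makes σ = 1 − θ/r at least 1/2, so that μ^{2σ} lies
  -- between L¹ and L².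
  have hθr : (θ : ℝ) / r ≤ 1 / 2 := by rw [div_le_iff₀ (by linarith)]; linarith
  have hθr0 : 0 ≤ (θ : ℝ) / r := by positivity
  obtain ⟨h1, h2, h3⟩ := hX.exchange hf hγ hk hT.le hC.le hCγ hθ hθ1 hg
    (κ := K * ε ^ ((θ : ℝ) * (r - d) / r)) (σ := 1 - θ / r) (by linarith) (by linarith)
    (mul_nonneg hK.le (Real.rpow_nonneg hε.1.le _)) (hKle ε θ hε.1 hθ0 hθ1')
  have hcongr : ∀ t ∈ Icc 0 T, ∫ x, g t x • exchangeError f φ (δ ε) ε (ρ ε (clamp T t)) x =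
      ∫ x, g t x • exchangeError f φ (δ ε) ε (ρ ε t) x := fun t ht => by rw [clamp_of_mem ht]
  rw [setIntegral_congr_fun measurableSet_Icc hcongr] at h3
  refine ⟨?_, ?_, ?_⟩
  · filter_upwards [h1, ae_restrict_mem measurableSet_Icc] with t ht htT
    rwa [clamp_of_mem htT] at ht
  · rw [intervalIntegrable_iff_integrableOn_Icc_of_le hT.le]
    exact h2.congr_fun hcongr measurableSet_Icc
  · rw [intervalIntegral.integral_of_le hT.le, ← integral_Icc_eq_integral_Ioc]
    refine h3.trans (le_of_eq ?_)
    rw [show -(1 - (θ : ℝ) / r) = -((r - θ) / r) by field_simp]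
    ring
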